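/- Let $X$ be an irreducible normal complex affine variety of dimension $3$ with an algebraic action of $SL_2=SL_2(\mathbb C)$. Let $q\colon X\to Y$, $Y=\operatorname{Spec}\mathbb C[X]^{SL_2}$, be the categorical quotient. Suppose that $Y$ is a curve ($\dim Y=1$) and that $y\in Y$ is a (closed) point such that the scheme-theoretic fibre $q^{-1}(y)$ is reduced. Then there is a Zariski-open affine neighbourhood $\Delta\subseteq Y$ of $y$ such that $q^{-1}(\Delta)$ is $SL_2$-equivariantly isomorphic, over $\Delta$, to one of the following: 1. a product $\mathbb F^a_n\times\Delta$ for some $n\ge 1$, where $\mathbb F^a_n$ is the affine cone over the rational normal curve of degree $n$, whose coordinate ring is the subring of $\mathbb C[s,t]$ generated by the binary forms of degree $n$, and where $SL_2$ acts on $\mathbb F^a_n$ only, by the action induced from the standard one on $\mathbb C^2$; 2. the family $\{((x,y,z),\delta)\in\mathbb C^3\times\Delta \mid 4xz-y^2=P(\delta)\}$, where $P\in\mathcal O(\Delta)$ has no zeros in $\Delta$ except possibly at the point $y$, and where $SL_2$ acts trivially on $\Delta$ and on $\mathbb C^3$ by the $3$-dimensional irreducible representation, namely by $S\mapsto gSg^{T}$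 on the symmetric matrices $S=\begin{pmatrix}x&y/2\\ y/2&z\end{pmatrix}$ (here the coordinate $y$ on $\mathbb C^3$ is not to be confused with the point $y\in Y$); 3. the quotient of a family as in 2 by $\mathbb Z_2$, whose generator acts by $((x,y,z),\delta)\mapsto((-x,-y,-z),\delta)$, with the induced action of $SL_2$. -/

import Mathlib

open AlgebraicGeometry CategoryTheory MvPolynomial
open scoped MatrixGroups TensorProduct

noncomputable section

universe u

namespace SL2Variety

/-! ### Affine `SL₂`-varieties and their categorical quotients

An affine variety `X` is `Spec A`, where `A` is its coordinate ring. An action of `SL₂(ℂ)` on `X`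
is given by the induced left action `(g • a)(x) = a(g⁻¹ x)` on `A`. -/

/-- The action of `SL₂(ℂ)` on the coordinate ring `A` is algebraic: for every `a : A` the function
`(g, x) ↦ (g • a)(x) = a(g⁻¹ x)` on `SL₂ × X` is regular, that is, it lies in
`ℂ[SL₂] ⊗ A` and so has the form `∑ pᵢ(g) bᵢ(x)` with `pᵢ` polynomial in the entries of `g`. -/
def IsAlgebraicAction (A : Type u) [CommRing A] [Algebra ℂ A]
    [MulSemiringAction SL(2, ℂ) A] : Prop :=
  ∀ a : A, ∃ (m : ℕ) (p : Fin m → MvPolynomial (Fin 2 × Fin 2) ℂ) (b : Fin m → A),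
    ∀ g : SL(2, ℂ), g • a = ∑ i, eval (fun k => g.1 k.1 k.2) (p i) • b i

section Quotient

variable (A : Type u) [CommRing A]

/-- The affine scheme `X` with coordinate ring `A`. -/
abbrev space : Scheme.{u} := Spec (CommRingCat.of A)

/-- The automorphism `x ↦ g x` of `X`; its comorphism is `a ↦ g⁻¹ • a`. -/
def act [MulSemiringAction SL(2, ℂ) A] (g : SL(2, ℂ)) : space A ⟶ space A :=
  Spec.map (CommRingCat.ofHom (MulSemiringAction.toRingHom SL(2, ℂ) A g⁻¹))

variable [Algebra ℂ A] [MulSemiringAction SL(2, ℂ) A] [SMulCommClass SL(2, ℂ) ℂ A]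

/-- The ring of invariant functions on `X`. -/
abbrev Invariants : Subalgebra ℂ A := FixedPoints.subalgebra ℂ A SL(2, ℂ)

/-- The categorical quotient `Y` of `X`: the spectrum of the ring of invariant functions. -/
abbrev quotient : Scheme.{u} := Spec (CommRingCat.of (Invariants A))

/-- The categorical quotient map `q : X ⟶ Y`. -/
def quotientMap : space A ⟶ quotient A :=
  Spec.map (CommRingCat.ofHom (algebraMap (Invariants A) A))

/-- The structure of a `ℂ`-algebra on the ring `𝒪(Δ)` of regular functions on an open `Δ ⊆ Y`. -/
instance sectionsAlgebra (Δ : (quotient A).Opens) : Algebra ℂ Γ(quotient A, Δ) :=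
  (((Scheme.ΓSpecIso (CommRingCat.of (Invariants A))).inv ≫
    (quotient A).presheaf.map (homOfLE le_top).op).hom.comp (algebraMap ℂ (Invariants A))).toAlgebra

variable {A}

/-- Let `Δ ⊆ Y` be an affine open set and `M` an algebra over `𝒪(Δ)` on which `SL₂(ℂ)` acts by
`ρ` (a left action on functions), so that `Spec M` is an `SL₂`-scheme over `Δ`. The proposition
says that `q⁻¹(Δ)` and `Spec M` are isomorphic as schemes over `Δ`, equivariantly. -/
def PreimageIsoModel (Δ : (quotient A).Opens) (M : Type u) [CommRing M] [Algebra Γ(quotient A, Δ) M]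
    (ρ : SL(2, ℂ) →* (M →ₐ[Γ(quotient A, Δ)] M)) : Prop :=
  ∃ e : (quotientMap A ⁻¹ᵁ Δ).toScheme ≅ Spec (CommRingCat.of M),
    e.hom ≫ Spec.map (CommRingCat.ofHom (algebraMap Γ(quotient A, Δ) M)) = (quotientMap A ∣_ Δ) ≫ Δ.toSpecΓ ∧
    ∀ g : SL(2, ℂ),
      Spec.map (CommRingCat.ofHom (ρ g⁻¹).toRingHom) ≫ e.inv ≫ (quotientMap A ⁻¹ᵁ Δ).ι =
        e.inv ≫ (quotientMap A ⁻¹ᵁ Δ).ι ≫ act A g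

end Quotient

/-! ### The cone `𝔽ₙᵃ` over the rational normal curve of degree `n` -/

/-- The substitution `f ↦ f ∘ N` on polynomial functions on `ℂ²`. -/
def planeSubst (N : Matrix (Fin 2) (Fin 2) ℂ) :
    MvPolynomial (Fin 2) ℂ →ₐ[ℂ] MvPolynomial (Fin 2) ℂ :=
  aeval fun i => C (N i 0) * X 0 + C (N i 1) * X 1

theorem planeSubst_one : planeSubst 1 = AlgHom.id ℂ _ := by
  ext1 i
  fin_cases i <;> simp [planeSubst]

theorem planeSubst_mul (M N : Matrix (Fin 2) (Fin 2) ℂ) :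
    planeSubst (M * N) = (planeSubst N).comp (planeSubst M) := by
  ext1 i
  simp only [planeSubst, aeval_X, AlgHom.comp_apply, map_add, map_mul, algHom_C,
    Matrix.mul_apply, Fin.sum_univ_two, algebraMap_eq]
  ring

/-- The coordinate ring of `𝔽ₙᵃ`, the affine cone over the rational normal curve of degree `n`
(the image of `ℙ¹` under all binary forms of degree `n`): the subring of `ℂ[s, t]`
generated by the binary forms of degree `n`. -/
def coneRing (n : ℕ) : Subalgebra ℂ (MvPolynomial (Fin 2) ℂ) :=
  Algebra.adjoin ℂ {f | f.IsHomogeneous n}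

theorem planeSubst_mem_coneRing (n : ℕ) (N : Matrix (Fin 2) (Fin 2) ℂ)
    (f : MvPolynomial (Fin 2) ℂ) (hf : f ∈ coneRing n) : planeSubst N f ∈ coneRing n := by
  have h : coneRing n ≤ (coneRing n).comap (planeSubst N) := by
    refine Algebra.adjoin_le fun f hf => ?_
    refine Algebra.subset_adjoin ?_
    have := IsHomogeneous.aeval (n := 1) hf
      (fun i => C (N i 0) * X 0 + C (N i 1) * X 1 : Fin 2 → MvPolynomial (Fin 2) ℂ)
      (fun i => (isHomogeneous_C_mul_X _ _).add (isHomogeneous_C_mul_X _ _))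
    rwa [one_mul] at this
  exact h hf

/-- The action of `SL₂(ℂ)` on the functions on `𝔽ₙᵃ` induced by its standard
action on `ℂ²`: `(g • f)(v) = f(g⁻¹ v)`. -/
def coneAction (n : ℕ) : SL(2, ℂ) →* (coneRing n →ₐ[ℂ] coneRing n) where
  toFun g := ((planeSubst (g⁻¹).1).comp (coneRing n).val).codRestrict (coneRing n)
    fun f => planeSubst_mem_coneRing n _ _ f.2
  map_one' := by
    ext f : 2
    simp [planeSubst_one]
  map_mul' g h := by
    ext f : 2
    simp [planeSubst_mul]

/-! ### The family of quadrics `4 x z - y² = P` and its quotient by `ℤ/2` -/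

section Quadric

variable {R : Type u} [CommRing R]

/-- The polynomial `4 x z - y² - P`. -/
def quadricPoly (P : R) : MvPolynomial (Fin 3) R := 4 * X 0 * X 2 - X 1 ^ 2 - C P

/-- The coordinate ring of `{((x, y, z), δ) ∈ ℂ³ × Spec R | 4 x z - y² = P(δ)}`. -/
abbrev QuadricRing (P : R) : Type u := MvPolynomial (Fin 3) R ⧸ Ideal.span {quadricPoly P}

theorem span_le_comap (P : R) (φ : MvPolynomial (Fin 3) R →ₐ[R] MvPolynomial (Fin 3) R)
    (hφ : φ (quadricPoly P) = quadricPoly P) :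
    Ideal.span {quadricPoly P} ≤ (Ideal.span {quadricPoly P}).comap φ := by
  rw [Ideal.span_singleton_le_iff_mem, Ideal.mem_comap, hφ]
  exact Ideal.mem_span_singleton_self _

/-- The comorphism of `(v, δ) ↦ (-v, δ)` on `ℂ³ × Spec R`. -/
def negSubst : MvPolynomial (Fin 3) R →ₐ[R] MvPolynomial (Fin 3) R := aeval fun i => -X i

theorem negSubst_quadricPoly (P : R) : negSubst (quadricPoly P) = quadricPoly P := by
  simp only [negSubst, quadricPoly, map_sub, map_mul, map_pow, aeval_X, algHom_C,
    algebraMap_eq, map_ofNat]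
  ring

/-- The comorphism of the generator `((x, y, z), δ) ↦ ((-x, -y, -z), δ)` of the action of `ℤ/2`
with weights `(1, 1, 1)` on the family `4 x z - y² = P`. -/
def quadricNeg (P : R) : QuadricRing P →ₐ[R] QuadricRing P :=
  Ideal.quotientMapₐ _ negSubst (span_le_comap P _ (negSubst_quadricPoly P))

/-- The coordinate ring of the quotient of the family `4 x z - y² = P` by `ℤ/2`: the ring of
functions invariant under `((x, y, z), δ) ↦ ((-x, -y, -z), δ)`. -/
def halfQuadricRing (P : R) : Subalgebra R (QuadricRing P) :=
  AlgHom.equalizer (quadricNeg P) (AlgHom.id R _)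

end Quadric

/-! ### The actions of `SL₂(ℂ)` on the three models -/

section Models

variable (R : Type u) [CommRing R] [Algebra ℂ R]

/-- The action of `SL₂(ℂ)` on the functions on the product `𝔽ₙᵃ × Spec R`, through
`𝔽ₙᵃ` only. -/
def productAction (n : ℕ) : SL(2, ℂ) →* ((R ⊗[ℂ] coneRing n) →ₐ[R] (R ⊗[ℂ] coneRing n)) where
  toFun g := Algebra.TensorProduct.map (AlgHom.id R R) (coneAction n g)
  map_one' := by
    ext f
    simp
  map_mul' g h := by
    ext f
    simp

/-- The 3-dimensional irreducible representation of `SL₂(ℂ)` is realized on the symmetric matrices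
`S = (x, y/2; y/2, z)`, on which `g` acts by `S ↦ g S gᵀ`. It leaves `4 det S = 4 x z - y²`
invariant. This is the substitution `f ↦ f(N S Nᵀ)` on functions of `(x, y, z)`, with
coefficients in `R`. -/
def formSubst (N : Matrix (Fin 2) (Fin 2) ℂ) :
    MvPolynomial (Fin 3) R →ₐ[R] MvPolynomial (Fin 3) R :=
  let k : ℂ → MvPolynomial (Fin 3) R := fun c => C (algebraMap ℂ R c)
  aeval ![k (N 0 0 ^ 2) * X 0 + k (N 0 0 * N 0 1) * X 1 + k (N 0 1 ^ 2) * X 2,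
    2 * k (N 0 0 * N 1 0) * X 0 + k (N 0 0 * N 1 1 + N 0 1 * N 1 0) * X 1
      + 2 * k (N 0 1 * N 1 1) * X 2,
    k (N 1 0 ^ 2) * X 0 + k (N 1 0 * N 1 1) * X 1 + k (N 1 1 ^ 2) * X 2]

theorem formSubst_one : formSubst R 1 = AlgHom.id R _ := by
  ext1 i
  fin_cases i <;> simp [formSubst]

theorem formSubst_mul (M N : Matrix (Fin 2) (Fin 2) ℂ) :
    formSubst R (M * N) = (formSubst R N).comp (formSubst R M) := by
  ext1 i
  fin_cases i <;>
  · simp [formSubst, algHom_C, Matrix.mul_apply, Fin.sum_univ_two, -aeval_eq_bind₁]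
    ring

variable {R}

theorem formSubst_quadricPoly (P : R) (N : Matrix (Fin 2) (Fin 2) ℂ) (hN : N.det = 1) :
    formSubst R N (quadricPoly P) = quadricPoly P := by
  have h : (C (algebraMap ℂ R (N 0 0 * N 1 1 - N 0 1 * N 1 0)) : MvPolynomial (Fin 3) R) = 1 := by
    rw [← Matrix.det_fin_two, hN, map_one, map_one]
  simp only [map_sub, map_mul] at h
  simp only [formSubst, quadricPoly, map_sub, map_mul, map_pow, map_add, aeval_X, algHom_C,
    algebraMap_eq, map_ofNat, Matrix.cons_val]
  linear_combination (4 * X 0 * X 2 - X 1 ^ 2) * (C ((algebraMap ℂ R) (N 0 0)) *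
    C ((algebraMap ℂ R) (N 1 1)) - C ((algebraMap ℂ R) (N 0 1)) *
    C ((algebraMap ℂ R) (N 1 0)) + 1) * h

/-- The action of `SL₂(ℂ)` on the functions on the family `4 x z - y² = P`, induced by the
3-dimensional irreducible representation and the trivial action on `Spec R`:
`(g • f)(v, δ) = f(g⁻¹ v, δ)`. -/
def quadricAction (P : R) : SL(2, ℂ) →* (QuadricRing P →ₐ[R] QuadricRing P) where
  toFun g := Ideal.quotientMapₐ _ (formSubst R (g⁻¹).1)
    (span_le_comap P _ (formSubst_quadricPoly P _ (g⁻¹).2))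
  map_one' := by
    refine Ideal.Quotient.algHom_ext _ (AlgHom.ext fun f => ?_)
    simp [formSubst_one]
  map_mul' g h := by
    refine Ideal.Quotient.algHom_ext _ (AlgHom.ext fun f => ?_)
    simp [formSubst_mul]

theorem quadricNeg_comm (P : R) (g : SL(2, ℂ)) :
    (quadricNeg P).comp (quadricAction P g) = (quadricAction P g).comp (quadricNeg P) := by
  have h : (negSubst (R := R)).comp (formSubst R (g⁻¹).1) =
      (formSubst R (g⁻¹).1).comp negSubst := by
    ext1 i
    fin_cases i <;>
    · simp [formSubst, negSubst, algHom_C, -aeval_eq_bind₁]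
      ring
  refine Ideal.Quotient.algHom_ext _ (AlgHom.ext fun f => ?_)
  exact congrArg (Ideal.Quotient.mk (Ideal.span {quadricPoly P})) (DFunLike.congr_fun h f)

/-- The action of `SL₂(ℂ)` on the functions on the quotient by `ℤ/2` of the family
`4 x z - y² = P`. -/
def halfQuadricAction (P : R) :
    SL(2, ℂ) →* (halfQuadricRing P →ₐ[R] halfQuadricRing P) where
  toFun g := ((quadricAction P g).comp (halfQuadricRing P).val).codRestrict (halfQuadricRing P)
    fun f => by
      have h := DFunLike.congr_fun (quadricNeg_comm P g) f.1
      have hf : quadricNeg P f.1 = f.1 := f.2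
      simp only [AlgHom.comp_apply, hf] at h
      exact h
  map_one' := by
    ext f : 2
    simp
  map_mul' g h := by
    ext f : 2
    exact DFunLike.congr_fun (map_mul (quadricAction P) g h) f.1

end Models

end SL2Variety

end

/-!
The idea is to find, near `y`, one irreducible representation that generates the algebra `A` over
the ring of invariants `R`, and to read off `A` from the single relation that it satisfies.

The group acts through the locally nilpotent derivations `E = raise` and `F = lowerOp` and a grading
by weights, and `A` is spanned by the strings `Fʲ f` of its highest weight vectors `f`
(`E f = 0`). Splitting off the image of the Casimir operator shows that ideals of `R` are
contracted from `A`, so that `R` is Noetherian; being normal of dimension one, it is a Dedekind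
domain (`isDedekindDomain_invariants`).

Since `dim A = 3` and `dim R = 1`, two highest weight vectors `f`, `g` of the same positive weight
are proportional over `R`: otherwise `t`, `f / g`, `g` and `F g` would be algebraically
independent, for a nonconstant invariant `t`. As `A` is normal, all highest weight vectors are, up
to invariant factors, powers of one of minimal positive weight `d` (`exists_minimal_highest`).
Dividing by a local parameter of `R` at `y` one may assume that `f` does not vanish on the fibre
over `y`. Because the fibre is reduced, no power of `f` vanishes on it, so that the factors
can be taken in the local ring of `R` at `y`. Hence the `Fʲ f` generate `A` over a neighbourhood
of `y`.

Regard `f` as a binary form of degree `d` with coefficients `Fʲ f`. The leading coefficient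
`d f F²f - (d - 1) (F f)²` of its Hessian is a highest weight vector of weight `2 d - 4`
if it is not zero. As `2 d - 4` is then a multiple of `d`, there are three cases
(`exists_local_generators`).
* The Hessian vanishes. Then the form is the `d`-th power of a linear form and the family is a
  product with the cone over the rational normal curve of degree `d` (`isLocalModel_cone`).
* `d = 2` and the Hessian is an invariant `P`. This relation is `4 x z - y² = P` in the coordinates
  `z = f`, `y = -F f` and `2 x = F²f` (`isLocalModel_quadric`).
* `d = 4` and the Hessian is `4 P f` for an invariant `P`. Then the form is the square of a
  quadratic form over an extension field, with highest weight vector `√f` and discriminant `-P`,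
  and the family is the quotient by `±1` of a family of quadrics (`isLocalModel_halfQuadric`).
As `R` is a Dedekind domain, the zeros of `P` other than `y` are avoided by shrinking the
neighbourhood. In each case the model is embedded together with `A` into an algebraically closed
field, where the two have the same generators; since `E` and `F` act on these in the same way and
determine the group action, the identification is equivariant (`isLocalModel_of_generators`).
-/

universe u

set_option linter.unusedSectionVars false

namespace SL2Variety

/-! ### Polynomial one-parameter groups of algebra automorphisms -/

/-- Two polynomials over a domain containing `ℂ` that agree at all nonzero complex numbers
are equal. -/
theorem polynomial_ext_of_eval_complex {B : Type*} [CommRing B] [IsDomain B] [Algebra ℂ B]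
    {P Q : Polynomial B}
    (h : ∀ c : ℂ, c ≠ 0 → P.eval (algebraMap ℂ B c) = Q.eval (algebraMap ℂ B c)) : P = Q := by
  refine Polynomial.eq_of_infinite_eval_eq P Q ?_
  refine Set.Infinite.mono (s := algebraMap ℂ B '' {0}ᶜ) ?_ ?_
  · rintro _ ⟨c, hc, rfl⟩
    exact h c hc
  · exact (Set.finite_singleton 0).infinite_compl.image
      ((algebraMap ℂ B).injective.injOn)

/-- An action of the additive group `ℂ` on the `ℂ`-algebra `B` by algebra endomorphisms, such that
every orbit map `c ↦ θ c b` is given by a polynomial with coefficients in `B`. -/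
structure IsPolynomialFlow {B : Type*} [CommRing B] [Algebra ℂ B] (θ : ℂ → B →ₐ[ℂ] B) :
    Prop where
  zero : θ 0 = AlgHom.id ℂ B
  add : ∀ c c', θ (c + c') = (θ c).comp (θ c')
  exists_poly : ∀ b, ∃ P : Polynomial B, ∀ c, P.eval (algebraMap ℂ B c) = θ c b

namespace IsPolynomialFlow

variable {B : Type*} [CommRing B] [IsDomain B] [Algebra ℂ B] {θ : ℂ → B →ₐ[ℂ] B}
  (h : IsPolynomialFlow θ)

include h

/-- The polynomial `P` with `P(c) = θ c b` for all `c : ℂ`. -/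
noncomputable def poly (b : B) : Polynomial B := (h.exists_poly b).choose

theorem eval_poly (b : B) (c : ℂ) : (h.poly b).eval (algebraMap ℂ B c) = θ c b :=
  (h.exists_poly b).choose_spec c

theorem poly_eq {b : B} {P : Polynomial B}
    (hP : ∀ c : ℂ, P.eval (algebraMap ℂ B c) = θ c b) : h.poly b = P :=
  polynomial_ext_of_eval_complex fun c _ => by rw [eval_poly, hP]

theorem poly_add (a b : B) : h.poly (a + b) = h.poly a + h.poly b :=
  h.poly_eq fun c => by simp [eval_poly]

theorem poly_mul (a b : B) : h.poly (a * b) = h.poly a * h.poly b :=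
  h.poly_eq fun c => by simp [eval_poly]

theorem poly_coeff_zero (b : B) : (h.poly b).coeff 0 = b := by
  have := h.eval_poly b 0
  rwa [map_zero, ← Polynomial.coeff_zero_eq_eval_zero, h.zero] at this

/-- The infinitesimal generator of a polynomial one-parameter group. -/
noncomputable def deriv : Derivation ℂ B B where
  toFun b := (h.poly b).coeff 1
  map_add' a b := by rw [poly_add, Polynomial.coeff_add]
  map_smul' c b := by
    have : h.poly (c • b) = Polynomial.C (algebraMap ℂ B c) * h.poly b :=
      h.poly_eq fun c' => by simp [eval_poly, Algebra.smul_def]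
    rw [this, Polynomial.coeff_C_mul, RingHom.id_apply, Algebra.smul_def]
  map_one_eq_zero' := by
    have : h.poly 1 = Polynomial.C 1 := h.poly_eq fun c => by simp
    simp [this, Polynomial.coeff_one]
  leibniz' a b := by
    change (h.poly (a * b)).coeff 1 = a • (h.poly b).coeff 1 + b • (h.poly a).coeff 1
    rw [poly_mul, Polynomial.mul_coeff_one, poly_coeff_zero, poly_coeff_zero, smul_eq_mul,
      smul_eq_mul, mul_comm _ b]

theorem deriv_apply (b : B) : h.deriv b = (h.poly b).coeff 1 := rfl

theorem deriv_eq {b : B} {P : Polynomial B}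
    (hP : ∀ c : ℂ, P.eval (algebraMap ℂ B c) = θ c b) : h.deriv b = P.coeff 1 := by
  rw [deriv_apply, h.poly_eq hP]

theorem poly_deriv (b : B) : h.poly (h.deriv b) = Polynomial.derivative (h.poly b) := by
  refine h.poly_eq fun c => ?_
  have key : Polynomial.taylor (algebraMap ℂ B c) (h.poly b) =
      (h.poly b).map (θ c).toRingHom := by
    refine polynomial_ext_of_eval_complex fun c' _ => ?_
    have e : algebraMap ℂ B c' = (θ c).toRingHom (algebraMap ℂ B c') := by simp
    rw [Polynomial.taylor_eval, ← map_add, eval_poly]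
    conv_rhs => rw [e, Polynomial.eval_map_apply]
    rw [eval_poly, add_comm, h.add]
    rfl
  rw [← Polynomial.taylor_coeff_one, key, Polynomial.coeff_map]
  rfl

theorem poly_iterate_deriv (k : ℕ) (b : B) :
    h.poly (h.deriv^[k] b) = Polynomial.derivative^[k] (h.poly b) := by
  induction k with
  | zero => rfl
  | succ k ih => rw [Function.iterate_succ_apply', Function.iterate_succ_apply', poly_deriv, ih]

theorem iterate_deriv (k : ℕ) (b : B) :
    h.deriv^[k] b = (k.factorial : B) * (h.poly b).coeff k := by
  rw [← h.poly_coeff_zero (h.deriv^[k] b), poly_iterate_deriv,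
    Polynomial.coeff_iterate_derivative, zero_add, Nat.descFactorial_self, nsmul_eq_mul]

theorem exists_iterate_deriv_eq_zero (b : B) : ∃ k, h.deriv^[k] b = 0 :=
  ⟨(h.poly b).natDegree + 1, by
    rw [iterate_deriv, Polynomial.coeff_eq_zero_of_natDegree_lt (Nat.lt_succ_self _), mul_zero]⟩

theorem apply_eq_self_of_deriv_eq_zero {b : B} (hb : h.deriv b = 0) (c : ℂ) : θ c b = b := by
  have : CharZero B := charZero_of_injective_algebraMap (algebraMap ℂ B).injective
  have h1 : Polynomial.derivative (h.poly b) = 0 := by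
    rw [← poly_deriv, hb]
    exact h.poly_eq fun c => by simp
  have h2 := Polynomial.eq_C_of_derivative_eq_zero h1
  rw [← h.eval_poly, h2, Polynomial.eval_C, poly_coeff_zero]

theorem deriv_eq_zero_of_forall {b : B} (hb : ∀ c, θ c b = b) : h.deriv b = 0 := by
  rw [h.deriv_eq (P := Polynomial.C b) (by simp [hb])]
  simp

/-- Homomorphisms that commute with the infinitesimal generators commute with the flows. -/
theorem map_comm {B' : Type*} [CommRing B'] [IsDomain B'] [Algebra ℂ B'] {θ' : ℂ → B' →ₐ[ℂ] B'}
    (h' : IsPolynomialFlow θ') (φ : B →ₐ[ℂ] B') (hφ : ∀ b, φ (h.deriv b) = h'.deriv (φ b))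
    (c : ℂ) (b : B) : φ (θ c b) = θ' c (φ b) := by
  have : CharZero B' := charZero_of_injective_algebraMap (algebraMap ℂ B').injective
  have hk : ∀ k, φ (h.deriv^[k] b) = h'.deriv^[k] (φ b) := by
    intro k
    induction k with
    | zero => rfl
    | succ k ih => rw [Function.iterate_succ_apply', Function.iterate_succ_apply', hφ, ih]
  have hp : (h.poly b).map φ.toRingHom = h'.poly (φ b) := by
    ext k
    have := hk k
    rw [iterate_deriv, iterate_deriv, map_mul, map_natCast] at this
    rw [Polynomial.coeff_map]
    exact mul_left_cancel₀ (Nat.cast_ne_zero.2 (Nat.factorial_ne_zero k)) this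
  have e : algebraMap ℂ B' c = φ.toRingHom (algebraMap ℂ B c) := by simp
  rw [← h'.eval_poly, ← hp, e, Polynomial.eval_map_apply, eval_poly]
  rfl

/-- An element with nonzero, constant derivative has an infinite orbit. -/
theorem apply_of_deriv_deriv_eq_zero {b : B} (hb : h.deriv (h.deriv b) = 0) (c : ℂ) :
    θ c b = b + algebraMap ℂ B c * h.deriv b := by
  have : CharZero B := charZero_of_injective_algebraMap (algebraMap ℂ B).injective
  have h1 : Polynomial.derivative (h.poly b) = Polynomial.C (h.deriv b) := by
    rw [← poly_deriv]
    exact h.poly_eq fun c => by simp [h.apply_eq_self_of_deriv_eq_zero hb]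
  have h2 : h.poly b = Polynomial.C b + Polynomial.C (h.deriv b) * Polynomial.X := by
    have h3 : Polynomial.derivative (h.poly b - Polynomial.C (h.deriv b) * Polynomial.X) = 0 := by
      simp [h1]
    have h4 := Polynomial.eq_C_of_derivative_eq_zero h3
    rw [sub_eq_iff_eq_add] at h4
    simpa [poly_coeff_zero] using h4
  rw [← h.eval_poly, h2, Polynomial.eval_add, Polynomial.eval_mul, Polynomial.eval_C,
    Polynomial.eval_C, Polynomial.eval_X, mul_comm]

end IsPolynomialFlow

/-! ### Dimension and transcendence -/

/-- The fraction field of a finitely generated domain of Krull dimension `n` over a field contains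
at most `n` algebraically independent elements. -/
theorem card_le_of_algebraicIndependent {k A L : Type*} [Field k] [CommRing A] [IsDomain A]
    [Algebra k A] [Algebra.FiniteType k A] [Field L] [Algebra A L] [IsFractionRing A L]
    [Algebra k L] [IsScalarTower k A L] {n : ℕ} (hdim : ringKrullDim A = n)
    {ι : Type*} [Fintype ι] {x : ι → L} (hx : AlgebraicIndependent k x) : Fintype.card ι ≤ n := by
  -- By Noether normalization, `A` is integral over a polynomial ring in `s` variables, so that `s`
  -- is both at most the Krull dimension and equal to the transcendence degree.
  obtain ⟨s, g, hg, hint⟩ := exists_integral_inj_algHom_of_fg k A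
  let _ := g.toRingHom.toAlgebra
  have halg : algebraMap (MvPolynomial (Fin s) k) A = g.toRingHom := rfl
  have : IsScalarTower k (MvPolynomial (Fin s) k) A := .of_algHom g
  have : Algebra.IsIntegral (MvPolynomial (Fin s) k) A := ⟨hint⟩
  have hs : s ≤ n := by
    have h1 : ringKrullDim (MvPolynomial (Fin s) k) = s := by
      rw [MvPolynomial.ringKrullDim_of_isNoetherianRing, ringKrullDim_eq_zero_of_field]
      simp
    have h2 : ringKrullDim (MvPolynomial (Fin s) k) ≤ ringKrullDim A := by
      have hsurj : ∀ p : Ideal (MvPolynomial (Fin s) k), p.IsPrime →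
          ∃ P : Ideal A, P.IsPrime ∧ P.LiesOver p := by
        intro p hp
        obtain ⟨Q, -, hQ, hQ'⟩ := Ideal.exists_ideal_over_prime_of_isIntegral p (⊥ : Ideal A) (by
          intro z hz
          rw [Ideal.mem_comap, Ideal.mem_bot, halg] at hz
          rw [hg (hz.trans (map_zero g).symm)]
          exact zero_mem p)
        exact ⟨Q, hQ, ⟨hQ'.symm⟩⟩
      refine iSup_le fun l => ?_
      obtain ⟨P, hP, hPl⟩ := hsurj l.head.asIdeal l.head.2
      obtain ⟨L, hL, -⟩ := Ideal.exists_ltSeries_of_hasGoingUp l P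
      rw [← hL]
      exact Order.LTSeries.length_le_krullDim L
    rw [h1, hdim] at h2
    exact_mod_cast h2
  have : FaithfulSMul (MvPolynomial (Fin s) k) A :=
    (faithfulSMul_iff_algebraMap_injective _ _).2 hg
  have : Algebra.IsAlgebraic A L := IsLocalization.isAlgebraic L (nonZeroDivisors A)
  have hbasis : IsTranscendenceBasis k (fun i : Fin s =>
      algebraMap A L (algebraMap (MvPolynomial (Fin s) k) A (X i))) :=
    (IsTranscendenceBasis.mvPolynomial (Fin s) k).algebraMap_comp.algebraMap_comp
  have h1 := hbasis.lift_cardinalMk_eq_trdeg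
  have h2 := hx.lift_cardinalMk_le_trdeg
  rw [Cardinal.mk_fin, Cardinal.lift_natCast, eq_comm, Cardinal.lift_id'.{0}] at h1
  rw [h1, Cardinal.mk_fintype, Cardinal.lift_natCast, Cardinal.lift_natCast, Nat.cast_le] at h2
  exact h2.trans hs

/-- An element of a domain with infinitely many images under ring endomorphisms that fix the
elements of a subalgebra `S` is transcendental over `S`. -/
theorem transcendental_of_infinite_orbit {k A ι : Type*} [CommRing k] [CommRing A] [IsDomain A]
    [Algebra k A] (S : Subalgebra k A) (σ : ι → A →+* A)
    (hσ : ∀ i, ∀ s ∈ S, σ i s = s) (x : A) (hx : (Set.range fun i => σ i x).Infinite) :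
    Transcendental S x := by
  rintro ⟨p, hp, hpx⟩
  have hp' : p.map (algebraMap S A) ≠ 0 :=
    (Polynomial.map_ne_zero_iff Subtype.val_injective).2 hp
  refine hx ((p.map (algebraMap S A)).rootSet_finite A |>.subset ?_)
  rintro _ ⟨i, rfl⟩
  rw [Polynomial.mem_rootSet']
  refine ⟨by simpa using hp', ?_⟩
  have hc : (σ i).comp (algebraMap S A) = algebraMap S A := RingHom.ext fun s => hσ i s s.2
  have := congrArg (σ i) hpx
  rw [Polynomial.aeval_def, Polynomial.hom_eval₂, hc, map_zero] at this
  simpa [Polynomial.aeval_def, Polynomial.eval₂_map] using this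

/-! ### Locally finite representations of `𝔰𝔩₂` -/

/-- Operators `E`, `F` and subspaces `W n` (the weight spaces) of a complex vector space `V` that
make `V` a locally finite representation of `𝔰𝔩₂` with integral weights. Only the spanning of `V` by
the weight spaces is required; their independence is not needed. -/
structure IsSl2Module {V : Type*} [AddCommGroup V] [Module ℂ V] (E F : V →ₗ[ℂ] V)
    (W : ℤ → Submodule ℂ V) : Prop where
  raise_mem : ∀ n, ∀ x ∈ W n, E x ∈ W (n + 2)
  lower_mem : ∀ n, ∀ x ∈ W n, F x ∈ W (n - 2)
  bracket : ∀ n, ∀ x ∈ W n, E (F x) - F (E x) = (n : ℂ) • x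
  raise_nilpotent : ∀ x, ∃ k, E^[k] x = 0
  lower_nilpotent : ∀ x, ∃ k, F^[k] x = 0
  iSup_eq_top : ⨆ n, W n = ⊤

namespace IsSl2Module

variable {V : Type*} [AddCommGroup V] [Module ℂ V] {E F : V →ₗ[ℂ] V} {W : ℤ → Submodule ℂ V}

/-- Exchanging the raising and the lowering operator negates the weights. -/
theorem symm (h : IsSl2Module E F W) : IsSl2Module F E fun n => W (-n) where
  raise_mem n x hx := by
    have := h.lower_mem _ x hx
    rwa [← neg_add'] at this
  lower_mem n x hx := by
    have := h.raise_mem _ x hx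
    rwa [neg_add_eq_sub, ← neg_sub] at this
  bracket n x hx := by
    have := h.bracket _ x hx
    rw [← neg_sub, this]
    simp
  raise_nilpotent := h.lower_nilpotent
  lower_nilpotent := h.raise_nilpotent
  iSup_eq_top := by
    rw [← h.iSup_eq_top]
    exact (Equiv.neg ℤ).iSup_congr fun n => rfl

variable (h : IsSl2Module E F W)

include h

theorem raise_iterate_mem {n : ℤ} {x : V} (hx : x ∈ W n) (k : ℕ) :
    E^[k] x ∈ W (n + 2 * k) := by
  induction k with
  | zero => simpa using hx
  | succ k ih =>
    rw [Function.iterate_succ_apply']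
    convert! h.raise_mem _ _ ih using 2
    push_cast
    ring

theorem lower_iterate_mem {n : ℤ} {x : V} (hx : x ∈ W n) (k : ℕ) :
    F^[k] x ∈ W (n - 2 * k) := by
  induction k with
  | zero => simpa using hx
  | succ k ih =>
    rw [Function.iterate_succ_apply']
    convert! h.lower_mem _ _ ih using 2
    push_cast
    ring

/-- The action of `E` on the string `F^k w` of a highest weight vector `w`. -/
theorem raise_lower_iterate {m : ℤ} {w : V} (hw : w ∈ W m) (hE : E w = 0) (k : ℕ) :
    E (F^[k + 1] w) = ((k + 1) * (m - k) : ℂ) • F^[k] w := by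
  induction k with
  | zero =>
    have := h.bracket _ _ hw
    rw [hE, map_zero, sub_zero] at this
    simpa using this
  | succ k ih =>
    have := h.bracket _ _ (h.lower_iterate_mem hw (k + 1))
    rw [ih, map_smul, ← Function.iterate_succ_apply' (f := F),
      ← Function.iterate_succ_apply' (f := F), sub_eq_iff_eq_add, ← add_smul] at this
    rw [this]
    congr 1
    push_cast
    ring

theorem raise_iterate_lower_iterate {m : ℤ} {w : V} (hw : w ∈ W m) (hE : E w = 0) (k : ℕ) :
    E^[k] (F^[k] w) = (∏ i ∈ Finset.range k, ((i + 1) * (m - i) : ℂ)) • w := by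
  induction k with
  | zero => simp
  | succ k ih =>
    rw [Function.iterate_succ_apply, h.raise_lower_iterate hw hE]
    have : ∀ (c : ℂ) (x : V), E^[k] (c • x) = c • E^[k] x := fun c x => by
      rw [← Module.End.pow_apply, map_smul, Module.End.pow_apply]
    rw [this, ih, smul_smul, Finset.prod_range_succ, mul_comm]

/-- The weight of a highest weight vector is nonnegative. -/
theorem weight_nonneg {m : ℤ} {w : V} (hw : w ∈ W m) (hE : E w = 0) (h0 : w ≠ 0) : 0 ≤ m := by
  classical
  have hk := h.lower_nilpotent w
  obtain ⟨k, hk⟩ : ∃ k, Nat.find hk = k + 1 :=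
    Nat.exists_eq_succ_of_ne_zero fun h1 => h0 (by simpa [h1] using Nat.find_spec hk)
  have h1 : F^[k + 1] w = 0 := hk ▸ Nat.find_spec (h.lower_nilpotent w)
  have h2 : F^[k] w ≠ 0 := Nat.find_min (h.lower_nilpotent w) (by omega)
  have h3 := h.raise_lower_iterate hw hE k
  rw [h1, map_zero, eq_comm, smul_eq_zero, or_iff_left h2, mul_eq_zero, sub_eq_zero] at h3
  rcases h3 with h3 | h3
  · exact absurd h3 (Nat.cast_add_one_ne_zero k)
  · have : m = k := by exact_mod_cast h3
    omega

theorem lower_iterate_eq_zero {m : ℕ} {w : V} (hw : w ∈ W m) (hE : E w = 0) :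
    F^[m + 1] w = 0 := by
  by_contra h0
  have h1 := h.raise_lower_iterate hw hE m
  rw [Int.cast_natCast, sub_self, mul_zero, zero_smul] at h1
  have := h.weight_nonneg (h.lower_iterate_mem hw (m + 1)) h1 h0
  push_cast at this
  omega

/-- A weight vector killed by `E` and of weight zero is invariant. -/
theorem lower_eq_zero {w : V} (hw : w ∈ W 0) (hE : E w = 0) : F w = 0 := by
  simpa using h.lower_iterate_eq_zero (m := 0) (by simpa using hw) hE

omit h in
/-- The subspace spanned by the strings of all highest weight vectors. -/
def stringSpan (E F : V →ₗ[ℂ] V) (W : ℤ → Submodule ℂ V) : Submodule ℂ V :=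
  Submodule.span ℂ {x | ∃ m : ℤ, ∃ w ∈ W m, E w = 0 ∧ ∃ j : ℕ, x = F^[j] w}

omit h in
theorem lower_mem_stringSpan {x : V} (hx : x ∈ stringSpan E F W) : F x ∈ stringSpan E F W := by
  suffices stringSpan E F W ≤ (stringSpan E F W).comap F from this hx
  refine Submodule.span_le.2 ?_
  rintro _ ⟨m, w, hw, hE, j, rfl⟩
  exact Submodule.subset_span ⟨m, w, hw, hE, j + 1, (Function.iterate_succ_apply' ..).symm⟩

theorem raise_mem_stringSpan {x : V} (hx : x ∈ stringSpan E F W) : E x ∈ stringSpan E F W := by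
  suffices stringSpan E F W ≤ (stringSpan E F W).comap E from this hx
  refine Submodule.span_le.2 ?_
  rintro _ ⟨m, w, hw, hE, j, rfl⟩
  rw [SetLike.mem_coe, Submodule.mem_comap]
  cases j with
  | zero => simpa using! (hE ▸ zero_mem _ : E w ∈ stringSpan E F W)
  | succ j =>
    rw [h.raise_lower_iterate hw hE]
    exact Submodule.smul_mem _ _ (Submodule.subset_span ⟨m, w, hw, hE, j, rfl⟩)

omit [AddCommGroup V] [Module ℂ V] h in
theorem prod_ne_zero {m : ℤ} {k : ℕ} (hk : (k : ℤ) ≤ m) :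
    (∏ i ∈ Finset.range k, ((i + 1) * (m - i) : ℂ)) ≠ 0 := by
  refine Finset.prod_ne_zero_iff.2 fun i hi => mul_ne_zero (Nat.cast_add_one_ne_zero i) ?_
  rw [sub_ne_zero]
  have := Finset.mem_range.1 hi
  norm_cast
  omega

/-- A vector `v` of nonnegative weight with `E^(k+1) v = 0` differs by a multiple of `F^k E^k v`
from one killed by `E^k`, because `E^k F^k` acts on the highest weight vector `E^k v` by a nonzero
scalar. -/
theorem mem_stringSpan_of_nonneg {n : ℤ} (hn : 0 ≤ n) {v : V} (hv : v ∈ W n) :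
    v ∈ stringSpan E F W := by
  obtain ⟨k, hk⟩ := h.raise_nilpotent v
  induction k generalizing v with
  | zero =>
    rw [show v = 0 from hk]
    exact zero_mem _
  | succ k ih =>
    set w := E^[k] v with hw
    have hwm : w ∈ W (n + 2 * k) := h.raise_iterate_mem hv k
    have hE : E w = 0 := by rw [hw, ← Function.iterate_succ_apply' (f := E), hk]
    have hc := prod_ne_zero (m := n + 2 * k) (k := k) (by omega)
    set c := ∏ i ∈ Finset.range k, ((i + 1) * ((n + 2 * k : ℤ) - i) : ℂ)
    have hs : F^[k] w ∈ stringSpan E F W := Submodule.subset_span ⟨_, w, hwm, hE, k, rfl⟩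
    have h1 : v - c⁻¹ • F^[k] w ∈ stringSpan E F W := by
      refine ih (sub_mem hv (Submodule.smul_mem _ _ ?_)) ?_
      · have := h.lower_iterate_mem hwm k
        rwa [add_sub_cancel_right] at this
      · rw [← Module.End.pow_apply, map_sub, map_smul, Module.End.pow_apply, Module.End.pow_apply,
          h.raise_iterate_lower_iterate hwm hE, smul_smul, inv_mul_cancel₀ hc, one_smul, sub_self]
    simpa using add_mem h1 (Submodule.smul_mem _ c⁻¹ hs)

/-- Complete reducibility: a locally finite representation is spanned by the strings of its
highest weight vectors. -/
theorem stringSpan_eq_top : stringSpan E F W = ⊤ := by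
  rw [eq_top_iff, ← h.iSup_eq_top]
  refine iSup_le fun n v hv => ?_
  rcases le_total 0 n with hn | hn
  · exact h.mem_stringSpan_of_nonneg hn hv
  -- A vector of negative weight is a sum of strings `E^j x` of lowest weight vectors `x`, and
  -- `x` is obtained by lowering `E^m x`, whose weight `m` is nonnegative.
  have h1 := h.symm.mem_stringSpan_of_nonneg (n := -n) (v := v) (by omega) (by simpa using hv)
  refine (Submodule.span_le (p := stringSpan E F W)).2 ?_ h1
  rintro _ ⟨m, x, hx, hF, j, rfl⟩
  have hraise : ∀ (i : ℕ) (y : V), y ∈ stringSpan E F W → E^[i] y ∈ stringSpan E F W := by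
    intro i y hy
    induction i with
    | zero => exact hy
    | succ i ih =>
      rw [Function.iterate_succ_apply']
      exact h.raise_mem_stringSpan ih
  have hlower : ∀ (i : ℕ) (y : V), y ∈ stringSpan E F W → F^[i] y ∈ stringSpan E F W := by
    intro i y hy
    induction i with
    | zero => exact hy
    | succ i ih =>
      rw [Function.iterate_succ_apply']
      exact lower_mem_stringSpan ih
  refine hraise j x ?_
  by_cases hx0 : x = 0
  · rw [hx0]
    exact zero_mem _
  obtain ⟨m, rfl⟩ := Int.eq_ofNat_of_zero_le (h.symm.weight_nonneg hx hF hx0)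
  have h2 : E^[m] x ∈ W m := by
    have := h.symm.lower_iterate_mem hx m
    convert! this using 2
    ring
  have h3 := hlower m _ (h.mem_stringSpan_of_nonneg (by omega) h2)
  rw [h.symm.raise_iterate_lower_iterate hx hF m] at h3
  have hc := prod_ne_zero (m := m) (k := m) le_rfl
  rw [← one_smul ℂ x, ← inv_mul_cancel₀ hc, mul_smul]
  exact Submodule.smul_mem _ _ h3

omit h in
/-- The Casimir operator `4FE + H² + 2H` with `H = EF - FE`. -/
def casimir (E F : V →ₗ[ℂ] V) : V →ₗ[ℂ] V :=
  (4 : ℂ) • (F ∘ₗ E) + (E ∘ₗ F - F ∘ₗ E) ∘ₗ (E ∘ₗ F - F ∘ₗ E) + (2 : ℂ) • (E ∘ₗ F - F ∘ₗ E)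

theorem casimir_lower_iterate {m : ℤ} {w : V} (hw : w ∈ W m) (hE : E w = 0) (j : ℕ) :
    casimir E F (F^[j] w) = (m * (m + 2) : ℂ) • F^[j] w := by
  have h1 := h.bracket _ _ (h.lower_iterate_mem hw j)
  have h2 : F (E (F^[j] w)) = (j * (m - j + 1) : ℂ) • F^[j] w := by
    cases j with
    | zero => simp [hE]
    | succ j =>
      rw [h.raise_lower_iterate hw hE, map_smul, ← Function.iterate_succ_apply' (f := F)]
      congr 1
      push_cast
      ring
  set D := E ∘ₗ F - F ∘ₗ E
  have h3 : D (F^[j] w) = ((m - 2 * j : ℤ) : ℂ) • F^[j] w := h1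
  change (4 : ℂ) • F (E (F^[j] w)) + D (D (F^[j] w)) + (2 : ℂ) • D (F^[j] w) = _
  rw [h2, h3, map_smul, h3, smul_smul, smul_smul, smul_smul, ← add_smul, ← add_smul]
  congr 1
  push_cast
  ring

/-- The invariants and the image of the Casimir operator span the representation. -/
theorem exists_eq_add_casimir (x : V) : ∃ r y, E r = 0 ∧ F r = 0 ∧ x = r + casimir E F y := by
  have hx : x ∈ stringSpan E F W := h.stringSpan_eq_top ▸ Submodule.mem_top
  induction hx using Submodule.span_induction with
  | mem x hx =>
    obtain ⟨m, w, hw, hE, j, rfl⟩ := hx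
    by_cases hw0 : w = 0
    · refine ⟨0, 0, map_zero _, map_zero _, ?_⟩
      rw [hw0, ← Module.End.pow_apply, map_zero, map_zero, add_zero]
    have hm := h.weight_nonneg hw hE hw0
    rcases hm.eq_or_lt with rfl | hm
    · cases j with
      | zero => exact ⟨w, 0, hE, h.lower_eq_zero hw hE, by simp⟩
      | succ j =>
        refine ⟨0, 0, map_zero _, map_zero _, ?_⟩
        rw [Function.iterate_succ_apply, h.lower_eq_zero hw hE, ← Module.End.pow_apply, map_zero,
          map_zero, add_zero]
    · have hc : (m * (m + 2) : ℂ) ≠ 0 := by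
        have : m * (m + 2) ≠ 0 := by positivity
        exact_mod_cast this
      refine ⟨0, (m * (m + 2) : ℂ)⁻¹ • F^[j] w, map_zero _, map_zero _, ?_⟩
      rw [map_smul, h.casimir_lower_iterate hw hE, smul_smul, inv_mul_cancel₀ hc, one_smul,
        zero_add]
  | zero => exact ⟨0, 0, map_zero _, map_zero _, by simp⟩
  | add x y _ _ hx hy =>
    obtain ⟨r, u, hr, hr', rfl⟩ := hx
    obtain ⟨s, v, hs, hs', rfl⟩ := hy
    exact ⟨r + s, u + v, by simp [hr, hs], by simp [hr', hs'], by rw [map_add]; abel⟩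
  | smul c x _ hx =>
    obtain ⟨r, u, hr, hr', rfl⟩ := hx
    exact ⟨c • r, c • u, by simp [hr], by simp [hr'], by simp⟩

/-- An invariant in the image of the Casimir operator vanishes. -/
theorem eq_zero_of_eq_casimir {r y : V} (hE : E r = 0) (hF : F r = 0) (hr : r = casimir E F y) :
    r = 0 := by
  -- The Casimir operator is diagonalizable, so every `y` is killed by `C g(C)`
  -- for some polynomial `g` with `g(0) ≠ 0`.
  have key : ∃ g : Polynomial ℂ, g.coeff 0 ≠ 0 ∧
      Polynomial.aeval (casimir E F) g (casimir E F y) = 0 := by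
    clear hr
    have hy : y ∈ stringSpan E F W := h.stringSpan_eq_top ▸ Submodule.mem_top
    induction hy using Submodule.span_induction with
    | mem x hx =>
      obtain ⟨m, w, hw, hE, j, rfl⟩ := hx
      by_cases hc : (m * (m + 2) : ℂ) = 0
      · exact ⟨1, by simp, by rw [h.casimir_lower_iterate hw hE, hc]; simp⟩
      · refine ⟨Polynomial.X - Polynomial.C (m * (m + 2) : ℂ), by simpa using hc, ?_⟩
        simp [h.casimir_lower_iterate hw hE, -map_mul, -map_add]
    | zero => exact ⟨1, by simp, by simp⟩
    | add x y _ _ hx hy =>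
      obtain ⟨g, hg, hg'⟩ := hx
      obtain ⟨g₂, hg₂, hg₂'⟩ := hy
      refine ⟨g * g₂, by simp [Polynomial.mul_coeff_zero, hg, hg₂], ?_⟩
      have hx' : Polynomial.aeval (casimir E F) (g * g₂) (casimir E F x) = 0 := by
        rw [mul_comm, map_mul, Module.End.mul_apply, hg', map_zero]
      rw [map_add, map_add, hx', map_mul, Module.End.mul_apply, hg₂', map_zero, add_zero]
    | smul c x _ hx =>
      obtain ⟨g, hg, hg'⟩ := hx
      exact ⟨g, hg, by rw [map_smul, map_smul, hg', smul_zero]⟩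
  obtain ⟨g, hg, hg'⟩ := key
  have hr0 : casimir E F r = 0 := by simp [casimir, hE, hF]
  rw [← hr, ← Polynomial.divX_mul_X_add g, map_add, map_mul, LinearMap.add_apply,
    Module.End.mul_apply, Polynomial.aeval_X, hr0, map_zero, zero_add, Polynomial.aeval_C,
    Module.algebraMap_end_apply, smul_eq_zero] at hg'
  exact hg'.resolve_left hg

end IsSl2Module

/-! ### One-parameter subgroups of `SL₂` -/

/-- The unipotent upper triangular matrix `(1, c; 0, 1)`. -/
def upper (c : ℂ) : SL(2, ℂ) := ⟨!![1, c; 0, 1], by simp [Matrix.det_fin_two]⟩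

/-- The unipotent lower triangular matrix `(1, 0; c, 1)`. -/
def lower (c : ℂ) : SL(2, ℂ) := ⟨!![1, 0; c, 1], by simp [Matrix.det_fin_two]⟩

/-- The diagonal matrix `(z, 0; 0, z⁻¹)`. -/
def torus (z : ℂˣ) : SL(2, ℂ) := ⟨!![(z : ℂ), 0; 0, ((z⁻¹ : ℂˣ) : ℂ)], by
  simp [Matrix.det_fin_two]⟩

theorem upper_zero : upper 0 = 1 :=
  Subtype.ext Matrix.one_fin_two.symm

theorem lower_zero : lower 0 = 1 :=
  Subtype.ext Matrix.one_fin_two.symm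

theorem torus_one : torus 1 = 1 :=
  Subtype.ext (by simp [torus, Matrix.one_fin_two])

theorem upper_add (c c' : ℂ) : upper (c + c') = upper c * upper c' := by
  refine Subtype.ext ?_
  change _ = (upper c).1 * (upper c').1
  simp [upper, add_comm]

theorem lower_add (c c' : ℂ) : lower (c + c') = lower c * lower c' := by
  refine Subtype.ext ?_
  change _ = (lower c).1 * (lower c').1
  simp [lower]

theorem upper_inv (c : ℂ) : (upper c)⁻¹ = upper (-c) := by
  rw [inv_eq_iff_mul_eq_one, ← upper_add, add_neg_cancel, upper_zero]

theorem lower_inv (c : ℂ) : (lower c)⁻¹ = lower (-c) := by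
  rw [inv_eq_iff_mul_eq_one, ← lower_add, add_neg_cancel, lower_zero]

theorem torus_mul_upper (z : ℂˣ) (c : ℂ) :
    torus z * upper c = upper ((z : ℂ) ^ 2 * c) * torus z := by
  have hz : (z : ℂ) ≠ 0 := z.ne_zero
  refine Subtype.ext ?_
  change (torus z).1 * (upper c).1 = (upper _).1 * (torus z).1
  ext i j
  fin_cases i <;> fin_cases j <;>
    simp [upper, torus]
  field_simp

theorem torus_mul_lower (z : ℂˣ) (c : ℂ) :
    torus z * lower c = lower (((z : ℂ)⁻¹) ^ 2 * c) * torus z := by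
  have hz : (z : ℂ) ≠ 0 := z.ne_zero
  refine Subtype.ext ?_
  change (torus z).1 * (lower c).1 = (lower _).1 * (torus z).1
  ext i j
  fin_cases i <;> fin_cases j <;>
    simp [lower, torus]
  field_simp

theorem torus_mul (z w : ℂˣ) : torus (z * w) = torus z * torus w := by
  refine Subtype.ext ?_
  change _ = (torus z).1 * (torus w).1
  simp [torus, mul_comm]

theorem upper_mul_lower (c e : ℂ) : (upper c * lower e).1 = !![1 + c * e, c; e, 1] := by
  change (upper c).1 * (lower e).1 = _
  simp [upper, lower]

theorem lower_mul_upper (c e : ℂ) : (lower e * upper c).1 = !![1, c; e, 1 + c * e] := by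
  change (lower e).1 * (upper c).1 = _
  simp [upper, lower, mul_comm, add_comm]

theorem eq_upper_mul_lower_mul_upper (g : SL(2, ℂ)) (hg : g.1 1 0 ≠ 0) :
    g = upper ((g.1 0 0 - 1) / g.1 1 0) * lower (g.1 1 0) *
      upper ((g.1 1 1 - 1) / g.1 1 0) := by
  have hdet := g.2
  rw [Matrix.det_fin_two] at hdet
  refine Subtype.ext ?_
  change _ = (upper _).1 * (lower _).1 * (upper _).1
  simp only [upper, lower, Matrix.mul_fin_two]
  ext i j
  fin_cases i <;> fin_cases j <;> simp <;> field_simp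
  · ring
  · linear_combination -hdet
  · ring

/-- The group `SL₂(ℂ)` is generated by unipotent triangular matrices. -/
theorem induction_upper_lower {p : SL(2, ℂ) → Prop} (hu : ∀ c, p (upper c))
    (hl : ∀ c, p (lower c)) (hmul : ∀ g h, p g → p h → p (g * h)) (g : SL(2, ℂ)) : p g := by
  have key : ∀ g : SL(2, ℂ), g.1 1 0 ≠ 0 → p g := fun g hg => by
    rw [eq_upper_mul_lower_mul_upper g hg]
    exact hmul _ _ (hmul _ _ (hu _) (hl _)) (hu _)
  by_cases hg : g.1 1 0 = 0
  · have hdet := g.2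
    rw [Matrix.det_fin_two, hg, mul_zero, sub_zero] at hdet
    have h1 : g = g * lower 1 * lower (-1) := by
      rw [mul_assoc, ← lower_add, add_neg_cancel, lower_zero, mul_one]
    rw [h1]
    refine hmul _ _ (key _ ?_) (hl _)
    change (g.1 * (lower 1).1) 1 0 ≠ 0
    simpa [lower, Matrix.mul_apply, Fin.sum_univ_two, hg] using right_ne_zero_of_mul_eq_one hdet
  · exact key g hg

/-! ### Derivatives of polynomial functions at the identity -/

/-- The polynomial function `p` on `2 × 2` matrices satisfies the bracket relation at the identity:
its mixed second derivatives along `upper c * lower e` and along `lower e * upper c` differ by the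
derivative along the diagonal torus. Here `P` and `Q` are the pullbacks of `p` along the two
products, and the derivative along the torus is read off from the polynomial
`z^N p(z, 0, 0, z⁻¹)`. -/
def HasBracket (p : MvPolynomial (Fin 2 × Fin 2) ℂ) : Prop :=
  ∃ P Q : Polynomial (Polynomial ℂ),
    (∀ c e : ℂ, P.evalEval c e = eval (fun k => !![1 + c * e, c; e, 1] k.1 k.2) p) ∧
    (∀ c e : ℂ, Q.evalEval e c = eval (fun k => !![1, c; e, 1 + c * e] k.1 k.2) p) ∧
    (P.coeff 0).coeff 0 = eval (fun k => !![1, 0; 0, 1] k.1 k.2) p ∧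
    (Q.coeff 0).coeff 0 = eval (fun k => !![1, 0; 0, 1] k.1 k.2) p ∧
    (P.coeff 0).coeff 1 = (Q.coeff 1).coeff 0 ∧
    (P.coeff 1).coeff 0 = (Q.coeff 0).coeff 1 ∧
    ∃ N₀ : ℕ, ∀ N, N₀ ≤ N → ∃ q : Polynomial ℂ,
      (∀ z : ℂ, z ≠ 0 → z ^ N * eval (fun k => !![z, 0; 0, z⁻¹] k.1 k.2) p = q.eval z) ∧
      q.derivative.eval 1 = N * eval (fun k => !![1, 0; 0, 1] k.1 k.2) p
        + (P.coeff 1).coeff 1 - (Q.coeff 1).coeff 1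

/-- All the conditions are Leibniz rules, once the values at the identity and the first derivatives
of the two pullbacks are known to agree. -/
theorem HasBracket.mul {p q : MvPolynomial (Fin 2 × Fin 2) ℂ} (hp : HasBracket p)
    (hq : HasBracket q) : HasBracket (p * q) := by
  obtain ⟨P, Q, h1, h2, h3, h4, h5, h6, N₀, h7⟩ := hp
  obtain ⟨P', Q', h1', h2', h3', h4', h5', h6', N₀', h7'⟩ := hq
  refine ⟨P * P', Q * Q', ?_, ?_, ?_, ?_, ?_, ?_, N₀ + N₀', fun N hN => ?_⟩
  · simp [Polynomial.evalEval_mul, h1, h1']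
  · simp [Polynomial.evalEval_mul, h2, h2']
  · simp only [Polynomial.mul_coeff_zero, h3, h3', map_mul]
  · simp only [Polynomial.mul_coeff_zero, h4, h4', map_mul]
  · simp only [Polynomial.mul_coeff_zero, Polynomial.mul_coeff_one, Polynomial.coeff_add,
      h3, h3', h4, h4', h5, h5']
  · simp only [Polynomial.mul_coeff_zero, Polynomial.mul_coeff_one, Polynomial.coeff_add,
      h3, h3', h4, h4', h6, h6']
  · obtain ⟨N, rfl⟩ := Nat.exists_eq_add_of_le hN
    obtain ⟨r, hr, hr'⟩ := h7 (N₀ + N) (Nat.le_add_right ..)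
    obtain ⟨s, hs, hs'⟩ := h7' N₀' le_rfl
    refine ⟨r * s, fun z hz => ?_, ?_⟩
    · rw [Polynomial.eval_mul, ← hr z hz, ← hs z hz, map_mul]
      ring
    · have hr1 := hr 1 one_ne_zero
      have hs1 := hs 1 one_ne_zero
      rw [one_pow, one_mul, inv_one] at hr1 hs1
      rw [Polynomial.derivative_mul, Polynomial.eval_add, Polynomial.eval_mul, Polynomial.eval_mul,
        hr', hs', ← hr1, ← hs1, map_mul]
      simp only [Polynomial.mul_coeff_one, Polynomial.coeff_add,
        h3, h3', h4, h4', h5, h5', h6, h6']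
      push_cast
      ring

theorem HasBracket.add {p q : MvPolynomial (Fin 2 × Fin 2) ℂ} (hp : HasBracket p)
    (hq : HasBracket q) : HasBracket (p + q) := by
  obtain ⟨P, Q, h1, h2, h3, h4, h5, h6, N₀, h7⟩ := hp
  obtain ⟨P', Q', h1', h2', h3', h4', h5', h6', N₀', h7'⟩ := hq
  refine ⟨P + P', Q + Q', ?_, ?_, ?_, ?_, ?_, ?_, max N₀ N₀', fun N hN => ?_⟩
  · simp [Polynomial.evalEval_add, h1, h1']
  · simp [Polynomial.evalEval_add, h2, h2']
  · simp [h3, h3']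
  · simp [h4, h4']
  · simp [h5, h5']
  · simp [h6, h6']
  · obtain ⟨r, hr, hr'⟩ := h7 N (le_trans (le_max_left ..) hN)
    obtain ⟨s, hs, hs'⟩ := h7' N (le_trans (le_max_right ..) hN)
    refine ⟨r + s, fun z hz => ?_, ?_⟩
    · rw [map_add, mul_add, hr z hz, hs z hz, Polynomial.eval_add]
    · rw [map_add, Polynomial.eval_add, hr', hs']
      simp only [map_add, Polynomial.coeff_add]
      ring

theorem hasBracket_C (a : ℂ) : HasBracket (C a) := by
  refine ⟨Polynomial.C (Polynomial.C a), Polynomial.C (Polynomial.C a), ?_, ?_, ?_, ?_, ?_, ?_,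
    0, fun N _ => ⟨Polynomial.C a * Polynomial.X ^ N, ?_, ?_⟩⟩
  · simp
  · simp
  · simp
  · simp
  · simp
  · simp
  · intro z _
    rw [eval_C, Polynomial.eval_mul, Polynomial.eval_C, Polynomial.eval_pow, Polynomial.eval_X,
      mul_comm]
  · rw [Polynomial.derivative_C_mul, Polynomial.derivative_X_pow, eval_C]
    simp
    ring

theorem hasBracket_X (k : Fin 2 × Fin 2) : HasBracket (X k) := by
  obtain ⟨i, j⟩ := k
  fin_cases i <;> fin_cases j
  · refine ⟨1 + Polynomial.C Polynomial.X * Polynomial.X, 1, ?_, ?_, ?_, ?_, ?_, ?_,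
      0, fun N _ => ⟨Polynomial.X ^ (N + 1), ?_, ?_⟩⟩
    any_goals simp [Polynomial.evalEval, Polynomial.coeff_one]
    · intros
      ring
    · intro z _
      ring
  · refine ⟨Polynomial.C Polynomial.X, Polynomial.X, ?_, ?_, ?_, ?_, ?_, ?_,
      0, fun N _ => ⟨0, ?_, ?_⟩⟩ <;>
      simp [Polynomial.evalEval, Polynomial.coeff_one]
  · refine ⟨Polynomial.X, Polynomial.C Polynomial.X, ?_, ?_, ?_, ?_, ?_, ?_,
      0, fun N _ => ⟨0, ?_, ?_⟩⟩ <;>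
      simp [Polynomial.evalEval, Polynomial.coeff_one]
  · refine ⟨1, 1 + Polynomial.C Polynomial.X * Polynomial.X, ?_, ?_, ?_, ?_, ?_, ?_,
      1, fun N hN => ?_⟩
    any_goals simp [Polynomial.evalEval, Polynomial.coeff_one]
    obtain ⟨N, rfl⟩ := Nat.exists_eq_add_of_le' hN
    refine ⟨Polynomial.X ^ N, fun z hz => ?_, ?_⟩
    · simp [pow_succ, hz]
    · simp [Polynomial.derivative_X_pow]

theorem hasBracket (p : MvPolynomial (Fin 2 × Fin 2) ℂ) : HasBracket p := by
  induction p using MvPolynomial.induction_on with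
  | C a => exact hasBracket_C a
  | add p q hp hq => exact hp.add hq
  | mul_X p k hp => exact hp.mul (hasBracket_X k)

/-- The composite of the infinitesimal generators of two flows is the mixed second derivative at
`0` of their composite. -/
theorem IsPolynomialFlow.deriv_deriv_eq {B ι : Type*} [CommRing B] [IsDomain B] [Algebra ℂ B]
    [Fintype ι] {θ τ : ℂ → B →ₐ[ℂ] B} (hθ : IsPolynomialFlow θ) (hτ : IsPolynomialFlow τ) (b : B)
    (P : ι → Polynomial (Polynomial ℂ)) (x : ι → B)
    (h : ∀ c e, θ c (τ e b) = ∑ i, (P i).evalEval c e • x i) :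
    hθ.deriv (hτ.deriv b) = ∑ i, ((P i).coeff 1).coeff 1 • x i := by
  have h1 : ∀ c, θ c (hτ.deriv b) = ∑ i, ((P i).coeff 1).eval c • x i := by
    intro c
    have h2 : (hτ.poly b).map (θ c).toRingHom = ∑ i,
        ((P i).map (Polynomial.evalRingHom c)).map (algebraMap ℂ B) * Polynomial.C (x i) := by
      refine polynomial_ext_of_eval_complex fun e _ => ?_
      have he : algebraMap ℂ B e = (θ c).toRingHom (algebraMap ℂ B e) := by simp
      conv_lhs => rw [he, Polynomial.eval_map_apply, hτ.eval_poly]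
      refine (h c e).trans ?_
      rw [Polynomial.eval_finsetSum]
      refine Finset.sum_congr rfl fun i _ => ?_
      rw [Polynomial.eval_mul, Polynomial.eval_C, Polynomial.eval_map_apply,
        Polynomial.map_evalRingHom_eval, Algebra.smul_def]
    have h3 := congrArg (Polynomial.coeff · 1) h2
    simp only [Polynomial.coeff_map, Polynomial.finsetSum_coeff, Polynomial.coeff_mul_C] at h3
    rw [IsPolynomialFlow.deriv_apply]
    refine h3.trans (Finset.sum_congr rfl fun i _ => ?_)
    rw [Algebra.smul_def]
    rfl
  rw [hθ.deriv_eq (P := ∑ i, ((P i).coeff 1).map (algebraMap ℂ B) * Polynomial.C (x i))]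
  · rw [Polynomial.finsetSum_coeff]
    refine Finset.sum_congr rfl fun i _ => ?_
    rw [Polynomial.coeff_mul_C, Polynomial.coeff_map, Algebra.smul_def]
  · intro c
    rw [h1, Polynomial.eval_finsetSum]
    refine Finset.sum_congr rfl fun i _ => ?_
    rw [Polynomial.eval_mul, Polynomial.eval_C, Polynomial.eval_map_apply, Algebra.smul_def]

/-! ### The Lie algebra action on an affine `SL₂`-variety -/

section Action

variable {A : Type*} [CommRing A] [Algebra ℂ A] [MulSemiringAction SL(2, ℂ) A]
  [SMulCommClass SL(2, ℂ) ℂ A]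

/-- Orbit maps are polynomial along a curve in `SL₂(ℂ)` whose matrix entries are polynomials. -/
theorem exists_poly_of_entries (hact : IsAlgebraicAction A)
    (N : Matrix (Fin 2) (Fin 2) (Polynomial ℂ)) (γ : ℂ → SL(2, ℂ))
    (hγ : ∀ c i j, (γ c).1 i j = (N i j).eval c) (a : A) :
    ∃ P : Polynomial A, ∀ c, P.eval (algebraMap ℂ A c) = γ c • a := by
  obtain ⟨m, p, b, h⟩ := hact a
  refine ⟨∑ i, (aeval (fun k : Fin 2 × Fin 2 => N k.1 k.2) (p i)).map (algebraMap ℂ A) *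
    Polynomial.C (b i), fun c => ?_⟩
  rw [h, Polynomial.eval_finsetSum]
  refine Finset.sum_congr rfl fun i _ => ?_
  rw [Polynomial.eval_mul, Polynomial.eval_C, Polynomial.eval_map_apply, Algebra.smul_def]
  congr 2
  have : ((Polynomial.aeval c).comp (aeval fun k : Fin 2 × Fin 2 => N k.1 k.2)) =
      aeval (fun k : Fin 2 × Fin 2 => (γ c).1 k.1 k.2) := by
    ext k
    simp [hγ, ← Polynomial.coe_aeval_eq_eval]
  rw [← Polynomial.coe_aeval_eq_eval, ← MvPolynomial.coe_aeval_eq_eval]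
  exact DFunLike.congr_fun this (p i)

theorem isPolynomialFlow_upper (hact : IsAlgebraicAction A) :
    IsPolynomialFlow fun c => MulSemiringAction.toAlgHom ℂ A (upper c) where
  zero := by
    ext a
    simp [upper_zero]
  add c c' := by
    ext a
    simp [upper_add, mul_smul]
  exists_poly a := exists_poly_of_entries hact !![1, Polynomial.X; 0, 1] upper
    (fun c i j => by fin_cases i <;> fin_cases j <;> simp [upper]) a

theorem isPolynomialFlow_lower (hact : IsAlgebraicAction A) :
    IsPolynomialFlow fun c => MulSemiringAction.toAlgHom ℂ A (lower c) where
  zero := by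
    ext a
    simp [lower_zero]
  add c c' := by
    ext a
    simp [lower_add, mul_smul]
  exists_poly a := exists_poly_of_entries hact !![1, 0; Polynomial.X, 1] lower
    (fun c i j => by fin_cases i <;> fin_cases j <;> simp [lower]) a

variable (A) in
/-- The space of functions of weight `n` for the diagonal torus. -/
def weightSpace (n : ℤ) : Submodule ℂ A where
  carrier := {a | ∀ z : ℂˣ, torus z • a = ((z : ℂ) ^ n) • a}
  add_mem' ha hb z := by rw [smul_add, ha z, hb z, smul_add]
  zero_mem' z := by simp
  smul_mem' c a ha z := by rw [smul_comm, ha z, smul_comm]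

theorem mem_weightSpace {n : ℤ} {a : A} :
    a ∈ weightSpace A n ↔ ∀ z : ℂˣ, torus z • a = ((z : ℂ) ^ n) • a := Iff.rfl

theorem mul_mem_weightSpace {n m : ℤ} {a b : A} (ha : a ∈ weightSpace A n)
    (hb : b ∈ weightSpace A m) : a * b ∈ weightSpace A (n + m) := fun z => by
  rw [smul_mul', ha z, hb z, smul_mul_smul_comm, zpow_add₀ z.ne_zero]

theorem pow_mem_weightSpace {n : ℤ} {a : A} (ha : a ∈ weightSpace A n) (k : ℕ) :
    a ^ k ∈ weightSpace A (k * n) := fun z => by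
  rw [smul_pow', ha z, smul_pow, ← zpow_natCast, ← zpow_mul, mul_comm]

variable [IsDomain A]

/-- The action of the raising operator of `𝔰𝔩₂` on functions. -/
noncomputable def raise (hact : IsAlgebraicAction A) : Derivation ℂ A A :=
  (isPolynomialFlow_upper hact).deriv

/-- The action of the lowering operator of `𝔰𝔩₂` on functions. -/
noncomputable def lowerOp (hact : IsAlgebraicAction A) : Derivation ℂ A A :=
  (isPolynomialFlow_lower hact).deriv

/-- If the torus rescales the time of a flow by `w`, then it rescales its infinitesimal generator
by `w`. -/
theorem torus_smul_deriv {θ : ℂ → A →ₐ[ℂ] A} (hθ : IsPolynomialFlow θ) (z : ℂˣ) (w : ℂ)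
    (h : ∀ c a, torus z • θ c a = θ (w * c) (torus z • a)) (a : A) :
    torus z • hθ.deriv a = w • hθ.deriv (torus z • a) := by
  have h1 : (hθ.poly a).map (MulSemiringAction.toAlgHom ℂ A (torus z)).toRingHom =
      (hθ.poly (torus z • a)).comp (Polynomial.C (algebraMap ℂ A w) * Polynomial.X) := by
    refine polynomial_ext_of_eval_complex fun c _ => ?_
    have hc : algebraMap ℂ A c =
        (MulSemiringAction.toAlgHom ℂ A (torus z)).toRingHom (algebraMap ℂ A c) :=
      (AlgHom.commutes (MulSemiringAction.toAlgHom ℂ A (torus z)) c).symm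
    conv_lhs => rw [hc, Polynomial.eval_map_apply, hθ.eval_poly]
    rw [Polynomial.eval_comp, Polynomial.eval_mul, Polynomial.eval_C, Polynomial.eval_X,
      ← map_mul, hθ.eval_poly]
    exact h c a
  have h2 := congrArg (Polynomial.coeff · 1) h1
  simp only [Polynomial.coeff_map, Polynomial.comp_C_mul_X_coeff, pow_one] at h2
  rw [IsPolynomialFlow.deriv_apply, IsPolynomialFlow.deriv_apply, Algebra.smul_def, mul_comm]
  exact h2

theorem raise_mem_weightSpace (hact : IsAlgebraicAction A) (n : ℤ) (a : A)
    (ha : a ∈ weightSpace A n) : raise hact a ∈ weightSpace A (n + 2) := fun z => by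
  have h := torus_smul_deriv (isPolynomialFlow_upper hact) z ((z : ℂ) ^ 2) (fun c a => by
    simp [← mul_smul, torus_mul_upper]) a
  rw [raise, h, ha z, Derivation.map_smul, smul_smul, zpow_add₀ z.ne_zero, mul_comm]
  rfl

theorem lowerOp_mem_weightSpace (hact : IsAlgebraicAction A) (n : ℤ) (a : A)
    (ha : a ∈ weightSpace A n) : lowerOp hact a ∈ weightSpace A (n - 2) := fun z => by
  have h := torus_smul_deriv (isPolynomialFlow_lower hact) z (((z : ℂ)⁻¹) ^ 2) (fun c a => by
    simp only [MulSemiringAction.toAlgHom_apply, ← mul_smul, torus_mul_lower]) a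
  rw [lowerOp, h, ha z, Derivation.map_smul, smul_smul, zpow_sub₀ z.ne_zero, mul_comm, inv_pow,
    div_eq_mul_inv]
  rfl

omit [SMulCommClass SL(2, ℂ) ℂ A] [IsDomain A] in
/-- For every function `a`, some `z^N (torus z • a)` is polynomial in `z`. -/
theorem exists_torus_poly (hact : IsAlgebraicAction A) (a : A) : ∃ (N : ℕ) (P : Polynomial A),
    ∀ z : ℂˣ, ((z : ℂ) ^ N) • torus z • a = P.eval (algebraMap ℂ A z) := by
  obtain ⟨m, p, b, h⟩ := hact a
  choose P Q _ _ _ _ _ _ N₀ hN using fun i => hasBracket (p i)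
  choose q hq _ using fun i => hN i (∑ j, N₀ j) (Finset.single_le_sum (fun _ _ => Nat.zero_le _)
    (Finset.mem_univ i))
  refine ⟨∑ j, N₀ j, ∑ i, (q i).map (algebraMap ℂ A) * Polynomial.C (b i), fun z => ?_⟩
  rw [h, Finset.smul_sum, Polynomial.eval_finsetSum]
  refine Finset.sum_congr rfl fun i _ => ?_
  rw [Polynomial.eval_mul, Polynomial.eval_C, Polynomial.eval_map_apply, ← hq i z z.ne_zero,
    smul_smul, Algebra.smul_def]
  simp [torus]

/-- The coefficients of the Laurent polynomial `z ↦ torus z • a` are weight vectors, and `a` is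
their sum by evaluation at `z = 1`. -/
theorem iSup_weightSpace (hact : IsAlgebraicAction A) : ⨆ n, weightSpace A n = ⊤ := by
  refine eq_top_iff.2 fun a _ => ?_
  obtain ⟨N, P, h⟩ := exists_torus_poly hact a
  have hcoeff : ∀ k : ℕ, P.coeff k ∈ weightSpace A ((k : ℤ) - N) := by
    intro k w
    have h1 : P.map (MulSemiringAction.toAlgHom ℂ A (torus w)).toRingHom =
        Polynomial.C (algebraMap ℂ A (((w : ℂ) ^ N)⁻¹)) *
          P.comp (Polynomial.C (algebraMap ℂ A w) * Polynomial.X) := by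
      refine polynomial_ext_of_eval_complex fun c hc => ?_
      have hc' : algebraMap ℂ A c =
          (MulSemiringAction.toAlgHom ℂ A (torus w)).toRingHom (algebraMap ℂ A c) :=
        (AlgHom.commutes (MulSemiringAction.toAlgHom ℂ A (torus w)) c).symm
      conv_lhs => rw [hc', Polynomial.eval_map_apply]
      have h2 := h (Units.mk0 c hc)
      have h3 := h (w * Units.mk0 c hc)
      rw [Units.val_mul] at h3
      rw [Polynomial.eval_mul, Polynomial.eval_comp, Polynomial.eval_mul, Polynomial.eval_C,
        Polynomial.eval_C, Polynomial.eval_X, ← map_mul]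
      rw [Units.val_mk0] at h2 h3
      rw [← h2, ← h3, torus_mul, mul_smul, ← Algebra.smul_def, smul_smul, mul_pow,
        inv_mul_cancel_left₀ (pow_ne_zero _ w.ne_zero)]
      exact map_smul (MulSemiringAction.toAlgHom ℂ A (torus w)) _ _
    have h2 := congrArg (Polynomial.coeff · k) h1
    simp only [Polynomial.coeff_map, Polynomial.comp_C_mul_X_coeff, Polynomial.coeff_C_mul] at h2
    refine Eq.trans h2 ?_
    rw [zpow_sub₀ w.ne_zero, zpow_natCast, zpow_natCast, div_eq_mul_inv, Algebra.smul_def, map_mul,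
      map_pow]
    ring
  have ha : a = ∑ k ∈ Finset.range (P.natDegree + 1), P.coeff k := by
    have h1 := h 1
    rw [torus_one, one_smul, Units.val_one, one_pow, one_smul, map_one,
      Polynomial.eval_eq_sum_range] at h1
    simpa using h1
  rw [ha]
  exact sum_mem fun k _ => (le_iSup (weightSpace A) _ : weightSpace A ((k : ℤ) - N) ≤ _) (hcoeff k)

/-- The relation `[E, F] = H` of `𝔰𝔩₂`: the orbit map of `a` is given by polynomials in the matrix
entries, and each of them satisfies the bracket relation at the identity. -/
theorem raise_lowerOp_sub (hact : IsAlgebraicAction A) (n : ℤ) (a : A)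
    (ha : a ∈ weightSpace A n) :
    raise hact (lowerOp hact a) - lowerOp hact (raise hact a) = (n : ℂ) • a := by
  obtain ⟨m, p, b, h⟩ := hact a
  choose P Q h1 h2 h3 h4 h5 h6 N₀ hN using fun i => hasBracket (p i)
  have hEF : raise hact (lowerOp hact a) = ∑ i, ((P i).coeff 1).coeff 1 • b i := by
    refine (isPolynomialFlow_upper hact).deriv_deriv_eq (isPolynomialFlow_lower hact) a P b
      fun c e => ?_
    change upper c • lower e • a = _
    rw [← mul_smul, h]
    simp only [h1, upper_mul_lower]
  have hFE : lowerOp hact (raise hact a) = ∑ i, ((Q i).coeff 1).coeff 1 • b i := by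
    refine (isPolynomialFlow_lower hact).deriv_deriv_eq (isPolynomialFlow_upper hact) a Q b
      fun e c => ?_
    change lower e • upper c • a = _
    rw [← mul_smul, h]
    simp only [h2, lower_mul_upper]
  set N := ∑ j, N₀ j + n.natAbs
  have hle : ∀ i, N₀ i ≤ N := fun i =>
    (Finset.single_le_sum (fun _ _ => Nat.zero_le _) (Finset.mem_univ i)).trans
      (Nat.le_add_right ..)
  choose q hq hq' using fun i => hN i N (hle i)
  obtain ⟨M, hM⟩ : ∃ M : ℕ, (M : ℤ) = N + n := ⟨(N + n).toNat, by
    rw [Int.toNat_of_nonneg]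
    simp only [N]
    push_cast
    have : 0 ≤ ∑ j, (N₀ j : ℤ) := Finset.sum_nonneg fun _ _ => by positivity
    linarith [neg_abs_le n]⟩
  -- Both sides describe the orbit of `a` under the torus, scaled by `z ^ N`.
  have key : Polynomial.X ^ M * Polynomial.C a =
      ∑ i, (q i).map (algebraMap ℂ A) * Polynomial.C (b i) := by
    refine polynomial_ext_of_eval_complex fun c hc => ?_
    have h7 := ha (Units.mk0 c hc)
    rw [h, Units.val_mk0] at h7
    rw [Polynomial.eval_mul, Polynomial.eval_C, Polynomial.eval_pow, Polynomial.eval_X,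
      ← map_pow, ← Algebra.smul_def, ← zpow_natCast, hM, zpow_add₀ hc, mul_smul, ← h7,
      Polynomial.eval_finsetSum, zpow_natCast, Finset.smul_sum]
    refine Finset.sum_congr rfl fun i _ => ?_
    rw [Polynomial.eval_mul, Polynomial.eval_C, Polynomial.eval_map_apply, ← hq i c hc,
      smul_smul, Algebra.smul_def]
    simp [torus]
  have h8 := congrArg (fun P => (Polynomial.derivative P).eval 1) key
  have h9 : a = ∑ i, eval (fun k => !![1, 0; 0, 1] k.1 k.2) (p i) • b i := by
    have := h 1
    rw [one_smul, show (1 : SL(2, ℂ)).1 = !![1, 0; 0, 1] from Matrix.one_fin_two] at this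
    exact this
  have h10 : ((M : ℂ)) • a = ∑ i, (q i).derivative.eval 1 • b i := by
    rw [Polynomial.derivative_mul, Polynomial.derivative_C, mul_zero, add_zero,
      Polynomial.derivative_X_pow, Polynomial.derivative_sum, Polynomial.eval_finsetSum] at h8
    refine Eq.trans ?_ (h8.trans (Finset.sum_congr rfl fun i _ => ?_))
    · simp [Algebra.smul_def]
    · rw [Polynomial.derivative_mul, Polynomial.derivative_C, mul_zero, add_zero,
        Polynomial.eval_mul, Polynomial.eval_C, Polynomial.derivative_map,
        ← map_one (algebraMap ℂ A), Polynomial.eval_map_apply, Algebra.smul_def]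
  simp only [hq', add_sub_assoc, add_smul, sub_smul, Finset.sum_add_distrib, mul_smul,
    ← Finset.smul_sum, ← h9, Finset.sum_sub_distrib] at h10
  rw [hEF, hFE, ← sub_eq_iff_eq_add'.2 h10, ← sub_smul]
  congr 1
  have : (M : ℂ) = N + n := by exact_mod_cast hM
  rw [this]
  ring

theorem isSl2Module (hact : IsAlgebraicAction A) :
    IsSl2Module (raise hact : A →ₗ[ℂ] A) (lowerOp hact : A →ₗ[ℂ] A) (weightSpace A) where
  raise_mem := raise_mem_weightSpace hact
  lower_mem := lowerOp_mem_weightSpace hact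
  bracket := raise_lowerOp_sub hact
  raise_nilpotent := (isPolynomialFlow_upper hact).exists_iterate_deriv_eq_zero
  lower_nilpotent := (isPolynomialFlow_lower hact).exists_iterate_deriv_eq_zero
  iSup_eq_top := iSup_weightSpace hact

theorem mem_invariants_iff (hact : IsAlgebraicAction A) {a : A} :
    a ∈ Invariants A ↔ raise hact a = 0 ∧ lowerOp hact a = 0 := by
  constructor
  · intro h
    exact ⟨(isPolynomialFlow_upper hact).deriv_eq_zero_of_forall fun c => h (upper c),
      (isPolynomialFlow_lower hact).deriv_eq_zero_of_forall fun c => h (lower c)⟩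
  · rintro ⟨h1, h2⟩ g
    induction g using induction_upper_lower with
    | hu c => exact (isPolynomialFlow_upper hact).apply_eq_self_of_deriv_eq_zero h1 c
    | hl c => exact (isPolynomialFlow_lower hact).apply_eq_self_of_deriv_eq_zero h2 c
    | hmul g h hg hh => rw [mul_smul, hh, hg]

/-- A function of weight zero that is killed by the raising operator is invariant. -/
theorem mem_invariants_of_weight_zero (hact : IsAlgebraicAction A) {a : A}
    (ha : a ∈ weightSpace A 0) (hE : raise hact a = 0) : a ∈ Invariants A :=
  (mem_invariants_iff hact).2 ⟨hE, (isSl2Module hact).lower_eq_zero ha hE⟩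

end Action

section Invariants

variable {A : Type*} [CommRing A] [Algebra ℂ A] [MulSemiringAction SL(2, ℂ) A]
  [SMulCommClass SL(2, ℂ) ℂ A]

/-! ### The ring of invariants -/

theorem smul_invariant (g : SL(2, ℂ)) (r : Invariants A) : g • (r : A) = r := r.2 g

theorem raise_invariant [IsDomain A] (hact : IsAlgebraicAction A) (r : Invariants A) :
    raise hact (r : A) = 0 := ((mem_invariants_iff hact).1 r.2).1

theorem lowerOp_invariant [IsDomain A] (hact : IsAlgebraicAction A) (r : Invariants A) :
    lowerOp hact (r : A) = 0 := ((mem_invariants_iff hact).1 r.2).2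

theorem raise_invariant_mul [IsDomain A] (hact : IsAlgebraicAction A) (r : Invariants A) (a : A) :
    raise hact (r * a) = r * raise hact a := by
  rw [Derivation.leibniz, raise_invariant, smul_zero, add_zero, smul_eq_mul]

theorem lowerOp_invariant_mul [IsDomain A] (hact : IsAlgebraicAction A) (r : Invariants A)
    (a : A) : lowerOp hact (r * a) = r * lowerOp hact a := by
  rw [Derivation.leibniz, lowerOp_invariant, smul_zero, add_zero, smul_eq_mul]

theorem invariant_mem_weightSpace (r : Invariants A) : (r : A) ∈ weightSpace A 0 := fun z => by
  rw [smul_invariant, zpow_zero, one_smul]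

theorem invariant_mul_mem_weightSpace (r : Invariants A) {n : ℤ} {a : A}
    (ha : a ∈ weightSpace A n) : r * a ∈ weightSpace A n := by
  simpa using mul_mem_weightSpace (invariant_mem_weightSpace r) ha

instance smulCommClass_invariants : SMulCommClass SL(2, ℂ) (Invariants A) A where
  smul_comm g r a := by
    rw [Algebra.smul_def, Algebra.smul_def, smul_mul']
    congr 1
    exact smul_invariant g r

variable [IsDomain A]

/-- Since the Casimir operator is linear over the invariants, an ideal of the ring of invariants is
the contraction of its extension. -/
theorem mem_of_algebraMap_mem_map (hact : IsAlgebraicAction A) (I : Ideal (Invariants A))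
    (r : Invariants A) (hr : algebraMap (Invariants A) A r ∈ I.map (algebraMap (Invariants A) A)) :
    r ∈ I := by
  set E : A →ₗ[ℂ] A := (raise hact).toLinearMap
  set F : A →ₗ[ℂ] A := (lowerOp hact).toLinearMap
  have hsl := isSl2Module hact
  have hC : ∀ (r : Invariants A) (y : A),
      IsSl2Module.casimir E F (r * y) = r * IsSl2Module.casimir E F y := by
    intro r y
    have hE : ∀ a, E (r * a) = r * E a := raise_invariant_mul hact r
    have hF : ∀ a, F (r * a) = r * F a := lowerOp_invariant_mul hact r
    simp only [IsSl2Module.casimir, LinearMap.add_apply, LinearMap.smul_apply,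
      LinearMap.comp_apply, LinearMap.sub_apply, hE, hF, ← mul_sub, ← mul_smul_comm, ← mul_add]
  have key : ∀ x ∈ I.map (algebraMap (Invariants A) A), ∃ i ∈ I, ∃ y,
      x = algebraMap (Invariants A) A i + IsSl2Module.casimir E F y := by
    intro x hx
    induction hx using Submodule.closure_induction with
    | zero => exact ⟨0, zero_mem _, 0, by simp⟩
    | add x y _ _ hx hy =>
      obtain ⟨i, hi, u, rfl⟩ := hx
      obtain ⟨j, hj, v, rfl⟩ := hy
      exact ⟨i + j, add_mem hi hj, u + v, by rw [map_add, map_add]; ring⟩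
    | smul_mem a x hx =>
      obtain ⟨i, hi, rfl⟩ := hx
      obtain ⟨s, y, hs, hs', rfl⟩ := hsl.exists_eq_add_casimir a
      refine ⟨i * ⟨s, (mem_invariants_iff hact).2 ⟨hs, hs'⟩⟩, I.mul_mem_right _ hi, i * y, ?_⟩
      rw [hC, smul_eq_mul, add_mul, map_mul]
      change s * (i : A) + _ * (i : A) = (i : A) * s + _
      ring
  obtain ⟨i, hi, y, h⟩ := key _ hr
  have h0 : ((r - i : Invariants A) : A) = 0 :=
    hsl.eq_zero_of_eq_casimir (raise_invariant hact _) (lowerOp_invariant hact _)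
      (sub_eq_iff_eq_add'.2 h)
  rw [← sub_add_cancel r i, Subtype.ext (a1 := r - i) (a2 := 0) h0, zero_add]
  exact hi

theorem comap_map_eq (hact : IsAlgebraicAction A) (I : Ideal (Invariants A)) :
    (I.map (algebraMap (Invariants A) A)).comap (algebraMap (Invariants A) A) = I :=
  le_antisymm (fun r hr => mem_of_algebraMap_mem_map hact I r hr) Ideal.le_comap_map

/-- Hilbert's theorem: the ring of invariants is Noetherian. -/
theorem isNoetherianRing_invariants [IsNoetherianRing A] (hact : IsAlgebraicAction A) :
    IsNoetherianRing (Invariants A) := by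
  refine isNoetherian_iff'.2 (StrictMono.wellFoundedGT
    (f := Ideal.map (algebraMap (Invariants A) A)) (Monotone.strictMono_of_injective
      (fun _ _ => Ideal.map_mono) fun I J h => ?_))
  rw [← comap_map_eq hact I, h, comap_map_eq hact J]

/-- A fraction of invariants that is integral over the ring of invariants lies in `A`, and it is
invariant there. -/
theorem isIntegrallyClosed_invariants [IsIntegrallyClosed A] :
    IsIntegrallyClosed (Invariants A) := by
  refine (isIntegrallyClosed_iff (FractionRing (Invariants A))).2 fun {x} hx => ?_
  obtain ⟨a, b, hb, rfl⟩ := IsFractionRing.div_surjective (Invariants A) x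
  have hb0 : (b : A) ≠ 0 := fun h => nonZeroDivisors.ne_zero hb (Subtype.ext h)
  have hinj : Function.Injective
      ((algebraMap A (FractionRing A)).comp (algebraMap (Invariants A) A)) :=
    (IsFractionRing.injective A (FractionRing A)).comp Subtype.val_injective
  have h1 := hx.map_of_comp_eq (algebraMap (Invariants A) A)
    (IsFractionRing.lift (K := FractionRing (Invariants A)) hinj) (by
      ext r
      simp)
  rw [map_div₀, IsFractionRing.lift_algebraMap, IsFractionRing.lift_algebraMap] at h1
  obtain ⟨c, hc⟩ := IsIntegrallyClosed.isIntegral_iff.1 h1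
  have hb1 : algebraMap A (FractionRing A) b ≠ 0 :=
    (map_ne_zero_iff _ (IsFractionRing.injective A (FractionRing A))).2 hb0
  have hcb : c * b = a := by
    apply IsFractionRing.injective A (FractionRing A)
    rw [map_mul, hc]
    exact div_mul_cancel₀ _ hb1
  have hcinv : c ∈ Invariants A := fun g => by
    apply mul_right_cancel₀ hb0
    conv_lhs => rw [← smul_invariant g b]
    rw [← smul_mul', hcb, smul_invariant]
  refine ⟨⟨c, hcinv⟩, ?_⟩
  rw [eq_div_iff ((map_ne_zero_iff _ (IsFractionRing.injective _ _)).2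
    (nonZeroDivisors.ne_zero hb)), ← map_mul]
  exact congrArg _ (Subtype.ext hcb)

theorem isDedekindDomain_invariants [IsIntegrallyClosed A] [IsNoetherianRing A]
    (hact : IsAlgebraicAction A) (hdim : ringKrullDim (Invariants A) = 1) :
    IsDedekindDomain (Invariants A) := by
  have := isNoetherianRing_invariants hact
  have := isIntegrallyClosed_invariants (A := A)
  have h1 : Ring.KrullDimLE 1 (Invariants A) := Ring.krullDimLE_iff.2 (by simp [hdim])
  have : Ring.DimensionLEOne (Invariants A) := ⟨fun hp hp' =>
    Ring.krullDimLE_one_iff_of_noZeroDivisors.1 h1 _ hp hp'⟩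
  exact { }

/-- The ring of invariants of positive dimension contains an element transcendental over `ℂ`. -/
theorem exists_transcendental_invariant (m : Ideal (Invariants A)) (hm : m ≠ ⊤) (hm0 : m ≠ ⊥) :
    ∃ t : Invariants A, Transcendental ℂ t := by
  obtain ⟨t, ht, ht0⟩ := Submodule.exists_mem_ne_zero_of_ne_bot hm0
  refine ⟨t, fun halg => ?_⟩
  obtain ⟨c, hc, hdvd⟩ := halg.exists_nonzero_dvd (mem_nonZeroDivisors_of_ne_zero ht0)
  exact hm (m.eq_top_of_isUnit_mem ht (isUnit_of_dvd_unit hdvd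
    ((isUnit_iff_ne_zero.2 hc).map (algebraMap ℂ (Invariants A)))))

end Invariants

/-! ### Functions that are invariant under the unipotent group -/

/-- An element with infinitely many images under endomorphisms that fix an algebraically independent
family can be adjoined to the family. -/
theorem algebraicIndependent_option_of_infinite_orbit {k L ι κ : Type*} [CommRing k] [CommRing L]
    [IsDomain L] [Algebra k L] {x : ι → L} (hx : AlgebraicIndependent k x) (σ : κ → L →ₐ[k] L)
    (hσ : ∀ i j, σ i (x j) = x j) (a : L) (ha : (Set.range fun i => σ i a).Infinite) :
    AlgebraicIndependent k (fun o : Option ι => o.elim a x) := by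
  refine (hx.option_iff_transcendental a).2
    (transcendental_of_infinite_orbit _ (fun i => (σ i).toRingHom) (fun i s hs => ?_) a ha)
  have : Algebra.adjoin k (Set.range x) ≤ AlgHom.equalizer (σ i) (AlgHom.id k L) :=
    Algebra.adjoin_le (by rintro _ ⟨j, rfl⟩; exact hσ i j)
  exact this hs

section Highest

variable {A : Type*} [CommRing A] [Algebra ℂ A] [MulSemiringAction SL(2, ℂ) A]
  [SMulCommClass SL(2, ℂ) ℂ A] [IsDomain A]

omit [IsDomain A] in
theorem infinite_range_torus_smul {n : ℕ} (hn : n ≠ 0) {f : A} (hf : f ∈ weightSpace A n)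
    (hf0 : f ≠ 0) : (Set.range fun z : ℂˣ => torus z • f).Infinite := by
  have h : Function.Injective fun k : ℕ => torus (Units.mk0 (2 : ℂ) two_ne_zero ^ k) • f := by
    intro k l hkl
    simp only [mem_weightSpace.1 hf] at hkl
    have h1 := smul_left_injective ℂ hf0 hkl
    simp only [Units.val_pow_eq_pow_val, Units.val_mk0, zpow_natCast, ← pow_mul] at h1
    have h2 : 2 ^ (k * n) = 2 ^ (l * n) := by exact_mod_cast h1
    exact Nat.eq_of_mul_eq_mul_right (Nat.pos_of_ne_zero hn) (Nat.pow_right_injective le_rfl h2)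
  refine (Set.infinite_range_of_injective h).mono ?_
  rintro _ ⟨k, rfl⟩
  exact ⟨_, rfl⟩

theorem raise_lowerOp_highest (hact : IsAlgebraicAction A) {n : ℤ} {f : A}
    (hf : f ∈ weightSpace A n) (hE : raise hact f = 0) :
    raise hact (lowerOp hact f) = (n : ℂ) • f := by
  have := raise_lowerOp_sub hact n f hf
  rwa [hE, map_zero, sub_zero] at this

theorem upper_smul_of_raise_eq_zero (hact : IsAlgebraicAction A) {a : A} (ha : raise hact a = 0)
    (c : ℂ) : upper c • a = a :=
  (isPolynomialFlow_upper hact).apply_eq_self_of_deriv_eq_zero ha c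

/-- The orbit of `F f` under the unipotent group is the line of all `F f + c n f`. -/
theorem infinite_range_upper_smul (hact : IsAlgebraicAction A) {n : ℕ} (hn : n ≠ 0) {f : A}
    (hf : f ∈ weightSpace A n) (hE : raise hact f = 0) (hf0 : f ≠ 0) :
    (Set.range fun c : ℂ => upper c • lowerOp hact f).Infinite := by
  have hEF := raise_lowerOp_highest hact hf hE
  have h0 : raise hact (lowerOp hact f) ≠ 0 := by
    rw [hEF]
    exact smul_ne_zero (by simpa using hn) hf0
  have horb := (isPolynomialFlow_upper hact).apply_of_deriv_deriv_eq_zero (b := lowerOp hact f) (by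
    change raise hact (raise hact (lowerOp hact f)) = 0
    rw [hEF, Derivation.map_smul, hE, smul_zero])
  refine Set.infinite_range_of_injective fun c c' h => ?_
  have h1 : lowerOp hact f + algebraMap ℂ A c * raise hact (lowerOp hact f) =
      lowerOp hact f + algebraMap ℂ A c' * raise hact (lowerOp hact f) :=
    (horb c).symm.trans (h.trans (horb c'))
  exact (algebraMap ℂ A).injective (mul_right_cancel₀ h0 (add_left_cancel h1))

/-- A highest weight vector `f` of positive weight is independent of the functions that are fixed
by the torus and by the upper triangular unipotent group, and `F f` is independent of those and
of `f`, because the orbits of `f` under the torus and of `F f` under the unipotent group are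
infinite. -/
theorem algebraicIndependent_of_highest (hact : IsAlgebraicAction A) {L S ι : Type*} [Field L]
    [CommRing S] [Algebra A L] [IsFractionRing A L] [Algebra S L] (σ : SL(2, ℂ) → L →ₐ[S] L)
    (hσ : ∀ g a, σ g (algebraMap A L a) = algebraMap A L (g • a)) {x : ι → L}
    (hx : AlgebraicIndependent S x) (hxt : ∀ z i, σ (torus z) (x i) = x i)
    (hxu : ∀ c i, σ (upper c) (x i) = x i) {n : ℕ} (hn : n ≠ 0) {f : A}
    (hf : f ∈ weightSpace A n) (hE : raise hact f = 0) (hf0 : f ≠ 0) :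
    AlgebraicIndependent S (fun o : Option (Option ι) =>
      o.elim (algebraMap A L (lowerOp hact f)) fun o => o.elim (algebraMap A L f) x) := by
  have hinj := IsFractionRing.injective A L
  refine algebraicIndependent_option_of_infinite_orbit
    (algebraicIndependent_option_of_infinite_orbit hx (fun z => σ (torus z)) hxt _ ?_)
    (fun c => σ (upper c)) ?_ _ ?_
  · refine ((infinite_range_torus_smul hn hf hf0).image hinj.injOn).mono ?_
    rintro _ ⟨_, ⟨z, rfl⟩, rfl⟩
    exact ⟨z, hσ _ _⟩
  · rintro c (_ | j)
    · exact (hσ _ _).trans (congrArg _ (upper_smul_of_raise_eq_zero hact hE c))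
    · exact hxu c j
  · refine ((infinite_range_upper_smul hact hn hf hE hf0).image hinj.injOn).mono ?_
    rintro _ ⟨_, ⟨z, rfl⟩, rfl⟩
    exact ⟨z, hσ _ _⟩

variable (A) in
/-- The action of `SL₂(ℂ)` on the field of rational functions. -/
noncomputable def fracAct (g : SL(2, ℂ)) :
    FractionRing A →ₐ[Invariants A] FractionRing A :=
  (IsFractionRing.algEquivOfAlgEquiv (K := FractionRing A) (L := FractionRing A)
    (MulSemiringAction.toAlgEquiv (Invariants A) A g)).toAlgHom

omit [IsDomain A] in
theorem fracAct_algebraMap (g : SL(2, ℂ)) (a : A) :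
    fracAct A g (algebraMap A (FractionRing A) a) = algebraMap A (FractionRing A) (g • a) :=
  IsFractionRing.algEquivOfAlgEquiv_algebraMap _ a

theorem raise_eq_zero_of_mul (hact : IsAlgebraicAction A) {c g f : A} (hg0 : g ≠ 0)
    (hg : raise hact g = 0) (hf : raise hact f = 0) (h : c * g = f) : raise hact c = 0 := by
  have := congrArg (raise hact) h
  rw [Derivation.leibniz, hg, hf, smul_zero, zero_add, smul_eq_mul] at this
  exact (mul_eq_zero.1 this).resolve_left hg0

theorem mem_weightSpace_of_mul {c g f : A} {n m : ℤ} (hg0 : g ≠ 0) (hg : g ∈ weightSpace A n)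
    (hf : f ∈ weightSpace A m) (h : c * g = f) : c ∈ weightSpace A (m - n) := fun z => by
  have h1 : (torus z • c) * (torus z • g) = torus z • f := by rw [← smul_mul', h]
  rw [hg z, hf z, ← h] at h1
  have hz := zpow_ne_zero n z.ne_zero
  apply mul_right_cancel₀ (smul_ne_zero hz hg0)
  rw [h1, zpow_sub₀ z.ne_zero, smul_mul_smul_comm, div_mul_cancel₀ _ hz]

/-- Two highest weight vectors of the same positive weight on a threefold with one-dimensional
quotient are proportional over the ring of invariants. -/
theorem exists_invariant_mul_eq [IsIntegrallyClosed A] [Algebra.FiniteType ℂ A]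
    (hact : IsAlgebraicAction A) (hdim : ringKrullDim A = 3) {t : Invariants A}
    (ht : Transcendental ℂ t) {n : ℕ} (hn : n ≠ 0) {f g : A} (hf : f ∈ weightSpace A n)
    (hfE : raise hact f = 0) (hg : g ∈ weightSpace A n) (hgE : raise hact g = 0)
    (hg0 : g ≠ 0) : ∃ r s : Invariants A, r ≠ 0 ∧ (r : A) * f = s * g := by
  set L := FractionRing A
  have hinj := IsFractionRing.injective A L
  have hgL : algebraMap A L g ≠ 0 := (map_ne_zero_iff _ hinj).2 hg0
  -- If `f / g` is algebraic over the invariants, then some invariant multiple of it is integral,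
  -- hence lies in `A`; it has weight zero and is killed by `E`.
  by_cases halg : IsAlgebraic (Invariants A) (algebraMap A L f / algebraMap A L g)
  · obtain ⟨r, hr, hint⟩ := halg.exists_integral_multiple
    have hint' : IsIntegral A (r • (algebraMap A L f / algebraMap A L g)) := hint.tower_top
    obtain ⟨c, hc⟩ := IsIntegrallyClosed.isIntegral_iff.1 hint'
    have hcg : c * g = r * f := by
      apply hinj
      rw [map_mul, hc, Algebra.smul_def, IsScalarTower.algebraMap_apply (Invariants A) A L,
        mul_assoc, div_mul_cancel₀ _ hgL, map_mul]
      rfl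
    have hcE : raise hact c = 0 := raise_eq_zero_of_mul hact hg0 hgE
      (by rw [raise_invariant_mul, hfE, mul_zero]) hcg
    have hcW := mem_weightSpace_of_mul hg0 hg (invariant_mul_mem_weightSpace r hf) hcg
    rw [sub_self] at hcW
    exact ⟨r, ⟨c, mem_invariants_of_weight_zero hact hcW hcE⟩, hr, hcg.symm⟩
  -- Otherwise `t`, `f / g`, `g` and `F g` are algebraically independent over `ℂ`.
  · exfalso
    have hx : AlgebraicIndependent (Invariants A)
        (fun _ : Unit => algebraMap A L f / algebraMap A L g) :=
      (algebraicIndependent_unique_type_iff).2 halg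
    have h3 := algebraicIndependent_of_highest hact (fracAct A) fracAct_algebraMap hx
      (fun z _ => by
        rw [map_div₀, fracAct_algebraMap, fracAct_algebraMap, hf z, hg z, Algebra.smul_def,
          Algebra.smul_def, map_mul, map_mul]
        refine mul_div_mul_left _ _ ?_
        rw [← IsScalarTower.algebraMap_apply]
        exact (map_ne_zero _).2 (zpow_ne_zero _ z.ne_zero))
      (fun c _ => by
        rw [map_div₀, fracAct_algebraMap, fracAct_algebraMap,
          upper_smul_of_raise_eq_zero hact hfE, upper_smul_of_raise_eq_zero hact hgE])
      hn hg hgE hg0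
    have h1 : AlgebraicIndependent ℂ (fun _ : Unit => t) :=
      (algebraicIndependent_unique_type_iff).2 ht
    have h4 := h1.sumElim_comp h3
    have := card_le_of_algebraicIndependent (n := 3) (A := A) (by exact_mod_cast hdim) h4
    simp at this

/-- A threefold with one-dimensional quotient has highest weight vectors of positive weight. -/
theorem exists_highest_pos (hact : IsAlgebraicAction A) (hdim : ringKrullDim A = 3)
    (hdimR : ringKrullDim (Invariants A) = 1) :
    ∃ n : ℕ, 0 < n ∧ ∃ f ∈ weightSpace A n, raise hact f = 0 ∧ f ≠ 0 := by
  by_contra! hcon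
  -- Otherwise the group would act trivially, and `A` would have the dimension of the invariants.
  have hall : ∀ a : A, a ∈ Invariants A := by
    intro a
    have hsl := isSl2Module hact
    have ha : a ∈ IsSl2Module.stringSpan _ _ (weightSpace A) :=
      hsl.stringSpan_eq_top ▸ Submodule.mem_top
    induction ha using Submodule.span_induction with
    | mem x hx =>
      obtain ⟨m, w, hw, hE, j, rfl⟩ := hx
      suffices w ∈ Invariants A by
        cases j with
        | zero => exact this
        | succ j =>
          rw [Function.iterate_succ_apply, ← Module.End.pow_apply]
          have : (lowerOp hact : A →ₗ[ℂ] A) w = 0 := ((mem_invariants_iff hact).1 this).2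
          rw [this, map_zero]
          exact zero_mem _
      by_cases hw0 : w = 0
      · rw [hw0]
        exact zero_mem _
      obtain ⟨n, rfl⟩ := Int.eq_ofNat_of_zero_le (hsl.weight_nonneg hw hE hw0)
      rcases Nat.eq_zero_or_pos n with rfl | hn
      · exact mem_invariants_of_weight_zero hact hw hE
      · exact absurd (hcon n hn w hw hE) hw0
    | zero => exact zero_mem _
    | add x y _ _ hx hy => exact add_mem hx hy
    | smul c x _ hx => exact (Invariants A).smul_mem hx c
  have e : Invariants A ≃+* A := RingEquiv.ofBijective (algebraMap (Invariants A) A)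
    ⟨Subtype.val_injective, fun a => ⟨⟨a, hall a⟩, rfl⟩⟩
  rw [ringKrullDim_eq_of_ringEquiv e, hdim] at hdimR
  exact absurd hdimR (by norm_num)

/-- The weights of highest weight vectors are the multiples of the smallest positive one, `d`, and
every highest weight vector is proportional to a power of a fixed one of weight `d`. -/
theorem exists_minimal_highest [IsIntegrallyClosed A] [Algebra.FiniteType ℂ A]
    (hact : IsAlgebraicAction A) (hdim : ringKrullDim A = 3)
    (hdimR : ringKrullDim (Invariants A) = 1) {t : Invariants A} (ht : Transcendental ℂ t) :
    ∃ d : ℕ, 0 < d ∧ (∃ f ∈ weightSpace A d, raise hact f = 0 ∧ f ≠ 0) ∧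
      ∀ f ∈ weightSpace A d, raise hact f = 0 → f ≠ 0 →
        ∀ n : ℤ, ∀ g ∈ weightSpace A n, raise hact g = 0 → g ≠ 0 →
          ∃ k : ℕ, n = k * d ∧ ∃ r s : Invariants A, r ≠ 0 ∧ (r : A) * g = s * f ^ k := by
  classical
  have hex := exists_highest_pos hact hdim hdimR
  obtain ⟨hd0, hfex⟩ := Nat.find_spec hex
  have hmin := fun n => Nat.find_min hex (m := n)
  set d := Nat.find hex
  refine ⟨d, hd0, hfex, fun f hf hfE hf0 n g hg hgE hg0 => ?_⟩
  obtain ⟨n, rfl⟩ := Int.eq_ofNat_of_zero_le ((isSl2Module hact).weight_nonneg hg hgE hg0)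
  have hpowE : ∀ {a : A} (k : ℕ), raise hact a = 0 → raise hact (a ^ k) = 0 := fun k ha => by
    rw [Derivation.leibniz_pow, ha, smul_zero, smul_zero]
  have hdvd : n % d = 0 := by
    by_contra hrem
    -- Otherwise `g / f ^ (n / d)`, up to an invariant factor, would have weight `n % d < d`.
    have hn0 : n ≠ 0 := fun h => hrem (by rw [h, Nat.zero_mod])
    -- The vectors `g ^ d` and `f ^ n` of the same weight `d n` are proportional, so that the `d`-th
    -- power of this quotient lies in `A`.
    obtain ⟨r, s, hr, hrs⟩ := exists_invariant_mul_eq hact hdim ht (n := d * n)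
      (Nat.mul_ne_zero hd0.ne' hn0) (f := g ^ d) (g := f ^ n)
      (by simpa using pow_mem_weightSpace hg d) (hpowE d hgE)
      (by simpa [mul_comm] using pow_mem_weightSpace hf n) (hpowE n hfE) (pow_ne_zero _ hf0)
    set L := FractionRing A
    have hinj := IsFractionRing.injective A L
    have hfL : algebraMap A L f ≠ 0 := (map_ne_zero_iff _ hinj).2 hf0
    have hint : IsIntegral A (algebraMap A L (r * g) / algebraMap A L (f ^ (n / d))) := by
      refine IsIntegral.of_pow hd0 ?_
      have : (algebraMap A L (r * g) / algebraMap A L (f ^ (n / d))) ^ d =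
          algebraMap A L (r ^ (d - 1) * s * f ^ (n % d)) := by
        rw [div_pow, div_eq_iff (pow_ne_zero _ (by rw [map_pow]; exact pow_ne_zero _ hfL)),
          ← map_pow, ← map_pow, ← map_mul]
        congr 1
        obtain ⟨e, he⟩ := Nat.exists_eq_succ_of_ne_zero hd0.ne'
        have h1 : n % d + n / d * d = n := Nat.mod_add_div' n d
        rw [mul_assoc, ← pow_mul, ← pow_add, h1, mul_pow, mul_assoc, ← hrs, he,
          Nat.succ_sub_one, ← mul_assoc, ← pow_succ]
      rw [this]
      exact isIntegral_algebraMap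
    obtain ⟨b, hb⟩ := IsIntegrallyClosed.isIntegral_iff.1 hint
    have hbf : b * f ^ (n / d) = r * g := by
      apply hinj
      rw [map_mul, hb, div_mul_cancel₀]
      rw [map_pow]
      exact pow_ne_zero _ hfL
    have hr' : (r : A) ≠ 0 := fun h => hr (Subtype.ext h)
    have hb0 : b ≠ 0 := by
      rintro rfl
      rw [zero_mul, eq_comm, mul_eq_zero] at hbf
      exact hbf.elim hr' hg0
    have hbE := raise_eq_zero_of_mul hact (pow_ne_zero _ hf0) (hpowE _ hfE)
      (by rw [raise_invariant_mul, hgE, mul_zero]) hbf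
    have hbW := mem_weightSpace_of_mul (pow_ne_zero _ hf0) (pow_mem_weightSpace hf _)
      (invariant_mul_mem_weightSpace r hg) hbf
    have hw : (n : ℤ) - ((n / d : ℕ) : ℤ) * d = (n % d : ℕ) := by
      have h1 : n % d + n / d * d = n := Nat.mod_add_div' n d
      have h2 : ((n % d + n / d * d : ℕ) : ℤ) = n := by rw [h1]
      push_cast at h2 ⊢
      linarith
    rw [hw] at hbW
    exact hmin _ (Nat.mod_lt n hd0) ⟨Nat.pos_of_ne_zero hrem, b, hbW, hbE, hb0⟩
  obtain ⟨k, rfl⟩ := Nat.dvd_of_mod_eq_zero hdvd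
  refine ⟨k, by push_cast; ring, ?_⟩
  rcases Nat.eq_zero_or_pos k with rfl | hk
  · exact ⟨1, ⟨g, mem_invariants_of_weight_zero hact (by simpa using hg) hgE⟩, one_ne_zero,
      by simp⟩
  · exact exists_invariant_mul_eq hact hdim ht (Nat.mul_ne_zero hd0.ne' hk.ne') hg hgE
      (by simpa [mul_comm] using pow_mem_weightSpace hf k) (hpowE k hfE) (pow_ne_zero _ hf0)

end Highest

/-! ### Highest weight vectors near a point with reduced fibre -/

section Dedekind

variable {R : Type*} [CommRing R] [IsDedekindDomain R] (m : Ideal R) [m.IsMaximal]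

/-- A local parameter `t` at `m`: the ideal `m` is generated by `t` after inverting some `s ∉ m`. -/
theorem exists_local_parameter (hm0 : m ≠ ⊥) :
    ∃ t ∈ m, t ≠ 0 ∧ ∃ s ∉ m, ∀ x ∈ m, ∃ y, s * x = t * y := by
  obtain ⟨t, ht, ht2⟩ : ∃ t ∈ m, t ∉ m ^ 2 :=
    SetLike.exists_of_lt ((Ideal.pow_right_strictAnti m hm0 Ideal.IsPrime.ne_top'
      one_lt_two).trans_eq (pow_one m))
  obtain ⟨J, hJ⟩ := Ideal.dvd_iff_le.2 ((Ideal.span_singleton_le_iff_mem m).2 ht)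
  obtain ⟨s, hs, hsm⟩ : ∃ s ∈ J, s ∉ m := by
    refine SetLike.not_le_iff_exists.1 fun hle => ht2 ?_
    rw [pow_two, ← Ideal.span_singleton_le_iff_mem, hJ]
    exact Ideal.mul_mono_right hle
  refine ⟨t, ht, fun h => ht2 (h ▸ zero_mem _), s, hsm, fun x hx => ?_⟩
  have : s * x ∈ Ideal.span {t} := by
    rw [hJ, mul_comm s]
    exact Ideal.mul_mem_mul hx hs
  exact (Ideal.mem_span_singleton.1 this)

/-- The localization of a Dedekind domain at `m` is a valuation ring. -/
theorem exists_mul_eq_or_of_isDedekindDomain (hm0 : m ≠ ⊥) (r s : R) :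
    (∃ u ∉ m, ∃ v, u * s = v * r) ∨ ∃ u ∉ m, ∃ v ∈ m, u * r = v * s := by
  have hdvr := IsLocalization.AtPrime.isDiscreteValuationRing_of_dedekind_domain R hm0
    (Localization.AtPrime m)
  have key : ∀ r s : R, algebraMap R (Localization.AtPrime m) r ∣ algebraMap R _ s →
      ∃ u ∉ m, ∃ v, u * s = v * r := by
    rintro r s ⟨c, hc⟩
    obtain ⟨a, b, rfl⟩ := IsLocalization.exists_mk'_eq m.primeCompl c
    refine ⟨b, b.2, a, ?_⟩
    apply IsLocalization.injective (Localization.AtPrime m) m.primeCompl_le_nonZeroDivisors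
    rw [map_mul, map_mul, hc, mul_left_comm, IsLocalization.mk'_spec'_mk, mul_comm]
  rcases ValuationRing.dvd_total (algebraMap R (Localization.AtPrime m) r) (algebraMap R _ s)
    with h | h
  · exact Or.inl (key r s h)
  · obtain ⟨u, hu, v, huv⟩ := key s r h
    by_cases hv : v ∈ m
    · exact Or.inr ⟨u, hu, v, hv, huv⟩
    · exact Or.inl ⟨v, hv, u, huv.symm⟩

end Dedekind

/-- The powers of a maximal ideal `m` are primary, hence so are their extensions with respect to the
elements of the base ring. -/
theorem mem_of_mul_mem_map_pow {R A : Type*} [CommRing R] [CommRing A] [Algebra R A]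
    {m : Ideal R} [hm : m.IsMaximal] {s : R} (hs : s ∉ m) {a : A} {k n : ℕ}
    (h : algebraMap R A (s ^ k) * a ∈ (m ^ n).map (algebraMap R A)) :
    a ∈ (m ^ n).map (algebraMap R A) := by
  obtain ⟨c, b, hb, hc⟩ := Ideal.IsMaximal.exists_inv_pow m (n := n) (x := s ^ k)
    (fun h => hs (hm.isPrime.mem_of_pow_mem k h))
  have h2 : a = algebraMap R A c * (algebraMap R A (s ^ k) * a) + algebraMap R A b * a := by
    rw [← mul_assoc, ← add_mul, ← map_mul, ← map_add, hc, map_one, one_mul]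
  rw [h2]
  exact add_mem (Ideal.mul_mem_left _ _ h) (Ideal.mul_mem_right _ _ (Ideal.mem_map_of_mem _ hb))

section Local

variable {A : Type*} [CommRing A] [Algebra ℂ A] [MulSemiringAction SL(2, ℂ) A]
  [SMulCommClass SL(2, ℂ) ℂ A] [IsDomain A]

/-- By Krull's intersection theorem, a highest weight vector can be divided only finitely often by a
local parameter at `m`; the last quotient does not vanish on the fibre over `m`. -/
theorem exists_highest_not_mem [IsNoetherianRing A] [IsDedekindDomain (Invariants A)]
    (hact : IsAlgebraicAction A) {m : Ideal (Invariants A)} [hm : m.IsMaximal] (hm0 : m ≠ ⊥)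
    {n : ℤ} {f : A} (hf : f ∈ weightSpace A n) (hfE : raise hact f = 0) (hf0 : f ≠ 0) :
    ∃ g ∈ weightSpace A n, raise hact g = 0 ∧ g ∉ m.map (algebraMap (Invariants A) A) := by
  by_contra! hcon
  obtain ⟨t, htm, ht0, s, hs, hst⟩ := exists_local_parameter m hm0
  have ht0' : (t : A) ≠ 0 := fun h => ht0 (Subtype.ext h)
  have hst' : ∀ x ∈ m.map (algebraMap (Invariants A) A), ∃ y, (s : A) * x = t * y := by
    intro x hx
    induction hx using Submodule.closure_induction with
    | zero => exact ⟨0, by simp⟩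
    | add x y _ _ hx hy =>
      obtain ⟨x', hx⟩ := hx
      obtain ⟨y', hy⟩ := hy
      exact ⟨x' + y', by rw [mul_add, hx, hy, mul_add]⟩
    | smul_mem a x hx =>
      obtain ⟨x, hx, rfl⟩ := hx
      obtain ⟨y, hy⟩ := hst x hx
      refine ⟨a * y, ?_⟩
      have hy' : (s : A) * x = t * y := congrArg Subtype.val hy
      rw [smul_eq_mul]
      change (s : A) * (a * (x : A)) = _
      rw [mul_left_comm, hy', mul_left_comm]
  -- If no such `g` existed, then `f` would be divisible by all powers of `t`, up to units at `m`.
  have key : ∀ k : ℕ, ∃ g ∈ weightSpace A n, raise hact g = 0 ∧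
      (s : A) ^ k * f = (t : A) ^ k * g := by
    intro k
    induction k with
    | zero => exact ⟨f, hf, hfE, by simp⟩
    | succ k ih =>
      obtain ⟨g, hg, hgE, hgk⟩ := ih
      obtain ⟨g', hg'⟩ := hst' g (hcon g hg hgE)
      rw [mul_comm (t : A)] at hg'
      refine ⟨g', ?_, ?_, ?_⟩
      · simpa using mem_weightSpace_of_mul ht0' (invariant_mem_weightSpace t)
          (invariant_mul_mem_weightSpace s hg) hg'.symm
      · exact raise_eq_zero_of_mul hact ht0' (raise_invariant hact t)
          (by rw [raise_invariant_mul, hgE, mul_zero]) hg'.symm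
      · rw [pow_succ', mul_assoc, hgk, mul_left_comm, hg', pow_succ]
        ring
  have htop : m.map (algebraMap (Invariants A) A) ≠ ⊤ := fun h => hm.ne_top (by
    rw [← comap_map_eq hact m, h, Ideal.comap_top])
  have hbot := Ideal.iInf_pow_eq_bot_of_isDomain _ htop
  refine hf0 ((Submodule.mem_bot A).1 (hbot ▸ Submodule.mem_iInf _ |>.2 fun k => ?_))
  obtain ⟨g, -, -, hg⟩ := key k
  rw [← Ideal.map_pow]
  refine mem_of_mul_mem_map_pow hs (k := k) ?_
  rw [map_pow]
  change (s : A) ^ k * f ∈ _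
  rw [hg, Ideal.map_pow]
  exact Ideal.mul_mem_right _ _ (Ideal.pow_mem_pow (Ideal.mem_map_of_mem _ htm) k)

/-- If the fibre over `m` is reduced and `f` does not vanish on it, then the highest weight vectors
that are rationally proportional to a power of `f` are multiples of it near `m`. -/
theorem exists_mul_eq_pow_of_reduced [IsDedekindDomain (Invariants A)]
    {m : Ideal (Invariants A)} [hm : m.IsMaximal] (hm0 : m ≠ ⊥)
    (hred : ∀ (a : A) (k : ℕ), a ^ k ∈ m.map (algebraMap (Invariants A) A) →
      a ∈ m.map (algebraMap (Invariants A) A)) {f : A}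
    (hf : f ∉ m.map (algebraMap (Invariants A) A)) {g : A} (hg0 : g ≠ 0) {k : ℕ}
    {r s : Invariants A} (hr : r ≠ 0) (h : (r : A) * g = s * f ^ k) :
    ∃ u ∉ m, ∃ v : Invariants A, (u : A) * g = v * f ^ k := by
  have hr' : (r : A) ≠ 0 := fun h => hr (Subtype.ext h)
  have hs' : (s : A) ≠ 0 := fun hs => by
    rw [hs, zero_mul, mul_eq_zero] at h
    exact h.elim hr' hg0
  rcases exists_mul_eq_or_of_isDedekindDomain m hm0 r s with ⟨u, hu, v, huv⟩ | ⟨u, hu, v, hv, huv⟩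
  · refine ⟨u, hu, v, mul_left_cancel₀ hr' ?_⟩
    have huv' : (u : A) * s = v * r := congrArg Subtype.val huv
    linear_combination (u : A) * h + f ^ k * huv'
  -- If the factor `s / r` had a pole at `m`, then `f ^ k` would vanish on the fibre.
  · exfalso
    have huv' : (u : A) * r = v * s := congrArg Subtype.val huv
    have h1 : (u : A) * f ^ k = v * g := mul_left_cancel₀ hs' (by
      linear_combination -(u : A) * h + g * huv')
    refine hf (hred f k ?_)
    have := mem_of_mul_mem_map_pow (A := A) (n := 1) (k := 1) (a := f ^ k) hu (by
      rw [pow_one, pow_one]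
      change (u : A) * f ^ k ∈ _
      rw [h1]
      exact Ideal.mul_mem_right _ _ (Ideal.mem_map_of_mem _ hv))
    rwa [pow_one] at this

variable (hact : IsAlgebraicAction A)

/-- The algebra over the invariants generated by the representation generated by `f`. -/
noncomputable def stringAlgebra (f : A) : Subalgebra (Invariants A) A :=
  Algebra.adjoin (Invariants A) (Set.range fun j : ℕ => (lowerOp hact)^[j] f)

theorem iterate_mem_stringAlgebra (f : A) (j : ℕ) :
    (lowerOp hact)^[j] f ∈ stringAlgebra hact f := Algebra.subset_adjoin ⟨j, rfl⟩

theorem lowerOp_mem_stringAlgebra {f a : A} (ha : a ∈ stringAlgebra hact f) :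
    lowerOp hact a ∈ stringAlgebra hact f := by
  induction ha using Algebra.adjoin_induction with
  | mem x hx =>
    obtain ⟨j, rfl⟩ := hx
    change lowerOp hact ((lowerOp hact)^[j] f) ∈ _
    rw [← Function.iterate_succ_apply' (lowerOp hact)]
    exact iterate_mem_stringAlgebra hact f _
  | algebraMap r =>
    rw [show lowerOp hact (algebraMap _ A r) = 0 from lowerOp_invariant hact r]
    exact zero_mem _
  | add x y _ _ hx hy =>
    rw [map_add]
    exact add_mem hx hy
  | mul x y hx hy hx' hy' =>
    rw [Derivation.leibniz]
    exact add_mem (mul_mem hx hy') (mul_mem hy hx')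

theorem lowerOp_iterate_mem_stringAlgebra {f a : A} (ha : a ∈ stringAlgebra hact f) (j : ℕ) :
    (lowerOp hact)^[j] a ∈ stringAlgebra hact f := by
  induction j with
  | zero => exact ha
  | succ j ih =>
    rw [Function.iterate_succ_apply']
    exact lowerOp_mem_stringAlgebra hact ih

theorem lowerOp_iterate_invariant_mul (r : Invariants A) (a : A) (j : ℕ) :
    (lowerOp hact)^[j] (r * a) = r * (lowerOp hact)^[j] a := by
  induction j with
  | zero => rfl
  | succ j ih => rw [Function.iterate_succ_apply', Function.iterate_succ_apply', ih,
      lowerOp_invariant_mul]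

/-- If all highest weight vectors are multiples of powers of `f` near `m`, then every function lies
in the algebra generated by the `Fʲ f` after multiplication by some invariant `u ∉ m`. -/
theorem exists_mul_mem_stringAlgebra {m : Ideal (Invariants A)} [hm : m.IsPrime] {f : A}
    (h : ∀ n : ℤ, ∀ g ∈ weightSpace A n, raise hact g = 0 → g ≠ 0 →
      ∃ k : ℕ, ∃ u ∉ m, ∃ v : Invariants A, (u : A) * g = v * f ^ k) (a : A) :
    ∃ u ∉ m, (u : A) * a ∈ stringAlgebra hact f := by
  have hone : (1 : Invariants A) ∉ m := hm.one_notMem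
  have ha : a ∈ IsSl2Module.stringSpan _ _ (weightSpace A) :=
    (isSl2Module hact).stringSpan_eq_top ▸ Submodule.mem_top (R := ℂ)
  induction ha using Submodule.span_induction with
  | mem x hx =>
    obtain ⟨n, w, hw, hE, j, rfl⟩ := hx
    by_cases hw0 : w = 0
    · refine ⟨1, hone, ?_⟩
      rw [hw0, ← Module.End.pow_apply, map_zero, mul_zero]
      exact zero_mem _
    obtain ⟨k, u, hu, v, huv⟩ := h n w hw hE hw0
    refine ⟨u, hu, ?_⟩
    have := lowerOp_iterate_invariant_mul hact u w j
    rw [huv, lowerOp_iterate_invariant_mul] at this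
    refine (this ▸ mul_mem ((stringAlgebra hact f).algebraMap_mem v)
      (lowerOp_iterate_mem_stringAlgebra hact
        (pow_mem (iterate_mem_stringAlgebra hact f 0) k) j) :)
  | zero =>
    refine ⟨1, hone, ?_⟩
    rw [mul_zero]
    exact zero_mem _
  | add x y _ _ hx hy =>
    obtain ⟨u, hu, hux⟩ := hx
    obtain ⟨v, hv, hvy⟩ := hy
    refine ⟨u * v, fun h => (hm.mem_or_mem h).elim hu hv, ?_⟩
    have e : ((u * v : Invariants A) : A) * (x + y) = v * (u * x) + u * (v * y) := by
      push_cast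
      ring
    rw [e]
    exact add_mem (mul_mem ((stringAlgebra hact f).algebraMap_mem v) hux)
      (mul_mem ((stringAlgebra hact f).algebraMap_mem u) hvy)
  | smul c x _ hx =>
    obtain ⟨u, hu, hux⟩ := hx
    refine ⟨u, hu, ?_⟩
    rw [mul_smul_comm]
    rw [Algebra.smul_def]
    exact mul_mem ((stringAlgebra hact f).algebraMap_mem (algebraMap ℂ (Invariants A) c)) hux

omit [IsDomain A] in
/-- Since `A` is finitely generated, the denominator `u` can be taken to be a power of a fixed
invariant. -/
theorem exists_pow_mul_mem [Algebra.FiniteType ℂ A] {m : Ideal (Invariants A)} [hm : m.IsPrime]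
    (D : Subalgebra (Invariants A) A) (h : ∀ a : A, ∃ u ∉ m, (u : A) * a ∈ D) :
    ∃ u ∉ m, ∀ a : A, ∃ N : ℕ, (u : A) ^ N * a ∈ D := by
  classical
  obtain ⟨S, hS⟩ := (inferInstance : Algebra.FiniteType ℂ A).out
  choose u hu hua using h
  refine ⟨∏ a ∈ S, u a, fun hmem => ?_, fun a => ?_⟩
  · obtain ⟨a, -, ha⟩ := hm.prod_mem_iff.1 hmem
    exact hu a ha
  have ha : a ∈ Algebra.adjoin ℂ (S : Set A) := hS ▸ Algebra.mem_top
  have hD : ∀ N : ℕ, ((∏ a ∈ S, u a : Invariants A) : A) ^ N ∈ D := fun N =>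
    pow_mem (D.algebraMap_mem _) N
  induction ha using Algebra.adjoin_induction with
  | mem x hx =>
    refine ⟨1, ?_⟩
    rw [pow_one, ← Finset.prod_erase_mul S u hx]
    change ((∏ a ∈ S.erase x, u a : Invariants A) : A) * (u x : A) * x ∈ D
    rw [mul_assoc]
    exact mul_mem (D.algebraMap_mem _) (hua x)
  | algebraMap c => exact ⟨0, by
      rw [pow_zero, one_mul]
      exact D.algebraMap_mem (algebraMap ℂ _ c)⟩
  | add x y _ _ hx hy =>
    obtain ⟨N, hx⟩ := hx
    obtain ⟨M, hy⟩ := hy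
    refine ⟨N + M, ?_⟩
    rw [mul_add]
    refine add_mem ?_ ?_
    · rw [pow_add, mul_comm (_ ^ N), mul_assoc]
      exact mul_mem (hD M) hx
    · rw [pow_add, mul_assoc]
      exact mul_mem (hD N) hy
  | mul x y _ _ hx hy =>
    obtain ⟨N, hx⟩ := hx
    obtain ⟨M, hy⟩ := hy
    refine ⟨N + M, ?_⟩
    rw [pow_add, mul_mul_mul_comm]
    exact mul_mem hx hy

end Local

/-! ### The Hessian of a highest weight vector of minimal weight -/

section Hessian

variable {A : Type*} [CommRing A] [Algebra ℂ A] [MulSemiringAction SL(2, ℂ) A]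
  [SMulCommClass SL(2, ℂ) ℂ A] [IsDomain A] (hact : IsAlgebraicAction A)

theorem raise_lowerOp_iterate {d : ℕ} {f : A} (hf : f ∈ weightSpace A d) (hE : raise hact f = 0)
    (k : ℕ) : raise hact ((lowerOp hact)^[k + 1] f) =
      ((k + 1) * (d - k) : A) * (lowerOp hact)^[k] f := by
  refine ((isSl2Module hact).raise_lower_iterate hf hE k).trans ?_
  rw [Algebra.smul_def]
  simp

theorem lowerOp_iterate_eq_zero {d : ℕ} {f : A} (hf : f ∈ weightSpace A d)
    (hE : raise hact f = 0) {k : ℕ} (hk : d < k) : (lowerOp hact)^[k] f = 0 := by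
  obtain ⟨j, rfl⟩ := Nat.exists_eq_add_of_lt hk
  rw [add_assoc, add_comm, add_assoc, add_comm 1, Function.iterate_add_apply,
    show (lowerOp hact)^[d + 1] f = 0 from (isSl2Module hact).lower_iterate_eq_zero hf hE,
    iterate_map_zero]

/-- Up to a scalar, the highest weight vector of the Hessian of the binary form of degree `d` that
corresponds to the highest weight vector `f` of weight `d`. -/
noncomputable def hessian (d : ℕ) (f : A) : A :=
  d * f * lowerOp hact (lowerOp hact f) - (d - 1) * lowerOp hact f ^ 2

theorem raise_hessian {d : ℕ} {f : A} (hf : f ∈ weightSpace A d) (hE : raise hact f = 0) :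
    raise hact (hessian hact d f) = 0 := by
  have h1 : raise hact (lowerOp hact f) = _ := raise_lowerOp_iterate hact hf hE 0
  have h2 : raise hact (lowerOp hact (lowerOp hact f)) = _ := raise_lowerOp_iterate hact hf hE 1
  simp only [Function.iterate_zero, Function.iterate_one, id_eq, Nat.cast_zero, Nat.cast_one,
    sub_zero, zero_add, one_mul] at h1 h2
  simp only [hessian, map_sub, Derivation.leibniz, Derivation.leibniz_pow, h1, h2, hE,
    smul_eq_mul, Derivation.map_natCast, Derivation.map_one_eq_zero]
  ring

theorem hessian_mem_weightSpace {d : ℕ} {f : A} (hf : f ∈ weightSpace A d) :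
    hessian hact d f ∈ weightSpace A (2 * d - 4) := by
  have h1 := lowerOp_mem_weightSpace hact _ _ hf
  have h2 := lowerOp_mem_weightSpace hact _ _ h1
  have h3 := mul_mem_weightSpace hf h2
  have h4 := pow_mem_weightSpace h1 2
  have e1 : (d : ℤ) + (d - 2 - 2) = 2 * d - 4 := by ring
  have e2 : ((2 : ℕ) : ℤ) * (d - 2) = 2 * d - 4 := by push_cast; ring
  rw [e1] at h3
  rw [e2] at h4
  have e3 : hessian hact d f = (d : ℂ) • (f * lowerOp hact (lowerOp hact f)) -
      (d - 1 : ℂ) • lowerOp hact f ^ 2 := by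
    simp only [hessian, Algebra.smul_def, map_sub, map_natCast, map_one]
    ring
  rw [e3]
  exact sub_mem (Submodule.smul_mem _ _ h3) (Submodule.smul_mem _ _ h4)

/-- Rescaling a highest weight vector by an invariant rescales its Hessian by the square. -/
theorem hessian_invariant_mul (d : ℕ) (u : Invariants A) (f : A) :
    hessian hact d (u * f) = u ^ 2 * hessian hact d f := by
  simp only [hessian, lowerOp_invariant_mul]
  ring

/-- If the Hessian vanishes, then `F` acts on `f` as if `f` were the `d`-th power of an element `w`
with `F (F w) = 0`: in terms of `s = F f / (d f) = F w / w`, the equation reads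
`Fᵏ f = d (d - 1) ⋯ (d - k + 1) sᵏ f`. -/
theorem pow_mul_lowerOp_iterate_of_hessian_eq_zero {d : ℕ} {f : A}
    (h : hessian hact d f = 0) {k : ℕ} (hk : k ≤ d) :
    d ^ k * f ^ k * (lowerOp hact)^[k] f = d.descFactorial k * lowerOp hact f ^ k * f := by
  induction k with
  | zero => simp
  | succ k ih =>
    have ih := ih (by omega)
    have hpow : ∀ (a : A) (k : ℕ),
        a * lowerOp hact (a ^ k) = k * a ^ k * lowerOp hact a := by
      intro a k
      rw [Derivation.leibniz_pow]
      rcases k with _ | k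
      · simp
      · simp only [Nat.add_sub_cancel, smul_eq_mul, nsmul_eq_mul]
        ring
    have h2 := congrArg (lowerOp hact) ih
    rw [show ((d : A) ^ k) = ((d ^ k : ℕ) : A) by push_cast; rfl] at h2
    simp only [Derivation.leibniz, Derivation.map_natCast, smul_eq_mul] at h2
    push_cast at h2
    rw [← Function.iterate_succ_apply' (lowerOp hact)] at h2
    have hff := hpow f k
    have hdesc : ((d.descFactorial (k + 1) : ℕ) : A) = (d - k) * d.descFactorial k := by
      rw [Nat.descFactorial_succ, Nat.cast_mul, Nat.cast_sub (by omega)]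
    have hN : d * f * lowerOp hact (lowerOp hact f) = (d - 1) * lowerOp hact f ^ 2 :=
      sub_eq_zero.1 h
    have hG : d * f * lowerOp hact (lowerOp hact f ^ k) =
        k * (d - 1) * lowerOp hact f ^ (k + 1) := by
      rw [Derivation.leibniz_pow]
      rcases k with _ | k
      · simp
      · simp only [Nat.add_sub_cancel, smul_eq_mul, nsmul_eq_mul]
        linear_combination ((k + 1 : ℕ) : A) * lowerOp hact f ^ k * hN
    linear_combination (d : A) * f * h2 - (d : A) ^ (k + 1) * (lowerOp hact)^[k] f * hff
      - (d : A) * k * lowerOp hact f * ih + (d.descFactorial k : A) * f * hG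
      - lowerOp hact f ^ (k + 1) * f * hdesc

/-- Near a point with reduced fibre, the algebra is generated over the invariants by the irreducible
representation of a highest weight vector `f` whose Hessian is zero or a multiple of `f ^ k` with
`k ≤ 1`; then the weight of `f` is `2` or `4`. -/
theorem exists_local_generators [IsIntegrallyClosed A] [Algebra.FiniteType ℂ A]
    (hdim : ringKrullDim A = 3) (hdimR : ringKrullDim (Invariants A) = 1)
    {m : Ideal (Invariants A)} [hm : m.IsMaximal]
    (hred : ∀ (a : A) (k : ℕ), a ^ k ∈ m.map (algebraMap (Invariants A) A) →
      a ∈ m.map (algebraMap (Invariants A) A)) :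
    ∃ d : ℕ, 0 < d ∧ ∃ f ∈ weightSpace A d, raise hact f = 0 ∧ f ≠ 0 ∧ ∃ u ∉ m,
      (∀ a : A, ∃ N : ℕ, (u : A) ^ N * a ∈ stringAlgebra hact f) ∧
      (hessian hact d f = 0 ∨ ∃ P : Invariants A,
        (∀ p : Ideal (Invariants A), p.IsPrime → u ∉ p → P ∈ p → p = m) ∧
        (d = 2 ∧ hessian hact d f = P ∨ d = 4 ∧ hessian hact d f = P * f)) := by
  have : IsNoetherianRing A := Algebra.FiniteType.isNoetherianRing ℂ A
  have := isDedekindDomain_invariants hact hdimR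
  have hm0 : m ≠ ⊥ := by
    rintro rfl
    have : IsField (Invariants A) := Ring.isField_iff_maximal_bot.2 hm
    rw [ringKrullDim_eq_zero_of_isField this] at hdimR
    exact zero_ne_one hdimR
  obtain ⟨t, ht⟩ := exists_transcendental_invariant m hm.ne_top hm0
  obtain ⟨d, hd, ⟨f₀, hf₀, hf₀E, hf₀0⟩, hmin⟩ := exists_minimal_highest hact hdim hdimR ht
  obtain ⟨f₁, hf₁, hf₁E, hf₁m⟩ := exists_highest_not_mem hact hm0 hf₀ hf₀E hf₀0
  have hf₁0 : f₁ ≠ 0 := fun h => hf₁m (h ▸ zero_mem _)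
  have hprop : ∀ f ∈ weightSpace A d, raise hact f = 0 →
      f ∉ m.map (algebraMap (Invariants A) A) → ∀ n : ℤ, ∀ g ∈ weightSpace A n,
      raise hact g = 0 → g ≠ 0 → ∃ k : ℕ, n = k * d ∧ ∃ u ∉ m, ∃ v : Invariants A,
        (u : A) * g = v * f ^ k := by
    intro f hf hfE hfm n g hg hgE hg0
    obtain ⟨k, hk, r, s, hr, hrs⟩ := hmin f hf hfE (fun h => hfm (h ▸ zero_mem _)) n g hg hgE hg0
    exact ⟨k, hk, exists_mul_eq_pow_of_reduced hm0 hred hfm hg0 hr hrs⟩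
  have hgen : ∀ f ∈ weightSpace A d, raise hact f = 0 →
      f ∉ m.map (algebraMap (Invariants A) A) → ∃ u ∉ m,
      ∀ a : A, ∃ N : ℕ, (u : A) ^ N * a ∈ stringAlgebra hact f := by
    intro f hf hfE hfm
    refine exists_pow_mul_mem _ (exists_mul_mem_stringAlgebra hact (m := m) ?_)
    intro n g hg hgE hg0
    obtain ⟨k, -, h⟩ := hprop f hf hfE hfm n g hg hgE hg0
    exact ⟨k, h⟩
  by_cases hN : hessian hact d f₁ = 0
  · obtain ⟨u, hu, hua⟩ := hgen f₁ hf₁ hf₁E hf₁m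
    exact ⟨d, hd, f₁, hf₁, hf₁E, hf₁0, u, hu, hua, Or.inl hN⟩
  obtain ⟨k, hk, w, hw, v, hwv⟩ := hprop f₁ hf₁ hf₁E hf₁m _ _ (hessian_mem_weightSpace hact hf₁)
    (raise_hessian hact hf₁ hf₁E) hN
  have hw0 : (w : A) ≠ 0 := fun h => hw ((Subtype.ext h : w = 0) ▸ zero_mem _)
  -- Rescaling `f₁` by `w` turns `w * N = v * f₁ ^ k` into an equation without denominator.
  have hf : (w : A) * f₁ ∈ weightSpace A d := invariant_mul_mem_weightSpace w hf₁
  have hfE : raise hact (w * f₁) = 0 := by rw [raise_invariant_mul, hf₁E, mul_zero]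
  have hf0 : (w : A) * f₁ ≠ 0 := mul_ne_zero hw0 hf₁0
  have hfm : (w : A) * f₁ ∉ m.map (algebraMap (Invariants A) A) := fun h => hf₁m (by
    have := mem_of_mul_mem_map_pow (A := A) (n := 1) (k := 1) (a := f₁) hw (by
      rw [pow_one, pow_one]
      exact h)
    rwa [pow_one] at this)
  obtain ⟨u, hu, hua⟩ := hgen _ hf hfE hfm
  obtain ⟨P, hP0, hP⟩ : ∃ P : Invariants A, P ≠ 0 ∧
      (d = 2 ∧ hessian hact d (w * f₁) = P ∨
        d = 4 ∧ hessian hact d (w * f₁) = P * (w * f₁)) := by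
    have hN' : hessian hact d (w * f₁) ≠ 0 := by
      rw [hessian_invariant_mul]
      exact mul_ne_zero (pow_ne_zero 2 hw0) hN
    -- The weights give `2 d - 4 = k d`.
    have hcase : (k = 0 ∧ d = 2) ∨ (k = 1 ∧ d = 4) := by
      have h2 : k < 2 := by
        by_contra! h2
        have h3 : (2 : ℤ) * d ≤ k * d := by
          have : 2 * d ≤ k * d := Nat.mul_le_mul_right d h2
          exact_mod_cast this
        omega
      interval_cases k
      · left
        exact ⟨rfl, by omega⟩
      · right
        exact ⟨rfl, by omega⟩
    obtain ⟨rfl, rfl⟩ | ⟨rfl, rfl⟩ := hcase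
    · have h : hessian hact 2 (w * f₁) = ((w * v : Invariants A) : A) := by
        rw [hessian_invariant_mul, pow_two, mul_assoc, hwv]
        push_cast
        ring
      refine ⟨w * v, fun h0 => hN' ?_, Or.inl ⟨rfl, h⟩⟩
      rw [h, h0]
      rfl
    · have h : hessian hact 4 (w * f₁) = (v : A) * (w * f₁) := by
        rw [hessian_invariant_mul, pow_two, mul_assoc, hwv]
        ring
      refine ⟨v, fun h0 => hN' ?_, Or.inr ⟨rfl, h⟩⟩
      rw [h, h0]
      exact zero_mul _
  -- Remove from the neighbourhood the zeros of `P` other than `m`.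
  obtain ⟨k, J, hJ, hPJ⟩ := WfDvdMonoid.max_power_factor
    (a₀ := Ideal.span {P}) (x := m) (by simpa using hP0)
    ((Ideal.prime_of_isPrime hm0 hm.isPrime).irreducible)
  obtain ⟨z, hzJ, hzm⟩ : ∃ z ∈ J, z ∉ m :=
    SetLike.not_le_iff_exists.1 fun h => hJ (Ideal.dvd_iff_le.2 h)
  refine ⟨d, hd, _, hf, hfE, hf0, u * z, fun h => (hm.isPrime.mem_or_mem h).elim hu hzm,
    fun a => ?_, Or.inr ⟨P, fun p hp hup hPp => ?_, hP⟩⟩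
  · obtain ⟨N, hN⟩ := hua a
    refine ⟨N, ?_⟩
    have e : ((u * z : Invariants A) : A) ^ N * a = (z : A) ^ N * ((u : A) ^ N * a) := by
      push_cast
      ring
    rw [e]
    exact mul_mem (pow_mem ((stringAlgebra hact _).algebraMap_mem z) N) hN
  · have hle : m ^ k * J ≤ p := by
      rw [← hPJ]
      exact (Ideal.span_singleton_le_iff_mem p).2 hPp
    rcases (Ideal.IsPrime.mul_le hp).1 hle with h | h
    · exact (hm.eq_of_le hp.ne_top (hp.le_of_pow_le h)).symm
    · exact absurd (p.mul_mem_left u (h hzJ)) hup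

end Hessian

/-! ### Recognition of a model from its generators -/

/-- Elements generating an algebra that contains at least as many algebraically independent elements
are algebraically independent. -/
theorem algebraicIndependent_of_mem_adjoin {R L ι κ : Type*} [CommRing R] [IsDomain R] [CommRing L]
    [IsDomain L] [Algebra R L] [Fintype ι] [Fintype κ] {x : ι → L} {y : κ → L}
    (hy : AlgebraicIndependent R y) (hmem : ∀ k, y k ∈ Algebra.adjoin R (Set.range x))
    (hcard : Fintype.card ι ≤ Fintype.card κ) : AlgebraicIndependent R x := by
  set C := Algebra.adjoin R (Set.range x)
  let x' : ι → C := fun i => ⟨x i, Algebra.subset_adjoin ⟨i, rfl⟩⟩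
  let y' : κ → C := fun k => ⟨y k, hmem k⟩
  have hy' : AlgebraicIndependent R y' := AlgebraicIndependent.of_comp C.val hy
  have htop : Algebra.adjoin R (Set.range x') = ⊤ := by
    apply Subalgebra.map_injective (f := C.val) Subtype.val_injective
    rw [AlgHom.map_adjoin, ← Set.range_comp, Algebra.map_top, Subalgebra.range_val]
    rfl
  have : FaithfulSMul R C := (faithfulSMul_iff_algebraMap_injective R C).2 hy'.algebraMap_injective
  have : Algebra.IsAlgebraic (Algebra.adjoin R (Set.range x')) C := ⟨fun c =>
    isAlgebraic_algebraMap (A := C)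
      (⟨c, htop ▸ Algebra.mem_top⟩ : Algebra.adjoin R (Set.range x'))⟩
  have hle : (Fintype.card ι : Cardinal) ≤ Algebra.trdeg R C := by
    have := hy'.lift_cardinalMk_le_trdeg
    rw [Cardinal.mk_fintype, Cardinal.lift_natCast, Cardinal.nat_le_lift_iff] at this
    exact le_trans (by exact_mod_cast hcard) this
  have hx' := (Algebra.IsAlgebraic.isTranscendenceBasis_of_lift_le_trdeg_of_finite R x' (by
    rwa [Cardinal.mk_fintype, Cardinal.lift_natCast, Cardinal.nat_le_lift_iff])).1
  exact hx'.map' (f := C.val) Subtype.val_injective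

/-- An action of a one-parameter subgroup is polynomial if it is so on generators. -/
theorem isPolynomialFlow_of_generators {S B : Type*} [CommRing S] [CommRing B] [Algebra S B]
    [Algebra ℂ S] [Algebra ℂ B] [IsScalarTower ℂ S B] (ρ : SL(2, ℂ) →* (B →ₐ[S] B))
    {γ : ℂ → SL(2, ℂ)} (h0 : γ 0 = 1) (hadd : ∀ c c', γ (c + c') = γ c * γ c') {s : Set B}
    (hs : Algebra.adjoin S s = ⊤)
    (hpoly : ∀ b ∈ s, ∃ P : Polynomial B, ∀ c, P.eval (algebraMap ℂ B c) = ρ (γ c) b) :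
    IsPolynomialFlow fun c => (ρ (γ c)).restrictScalars ℂ where
  zero := by
    ext b
    simp [h0]
  add c c' := by
    ext b
    simp [hadd]
  exists_poly b := by
    have hb : b ∈ Algebra.adjoin S s := hs ▸ Algebra.mem_top
    induction hb using Algebra.adjoin_induction with
    | mem x hx => exact hpoly x hx
    | algebraMap r => exact ⟨Polynomial.C (algebraMap S B r), fun c => by simp⟩
    | add x y _ _ hx hy =>
      obtain ⟨P, hP⟩ := hx
      obtain ⟨Q, hQ⟩ := hy
      exact ⟨P + Q, fun c => by rw [Polynomial.eval_add, hP, hQ, map_add]⟩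
    | mul x y _ _ hx hy =>
      obtain ⟨P, hP⟩ := hx
      obtain ⟨Q, hQ⟩ := hy
      exact ⟨P * Q, fun c => by rw [Polynomial.eval_mul, hP, hQ, map_mul]⟩

section Model

variable {A : Type*} [CommRing A] [Algebra ℂ A] [MulSemiringAction SL(2, ℂ) A]
  [SMulCommClass SL(2, ℂ) ℂ A]

/-- The `SL₂`-algebra `M` over the localization `S` of the ring of invariants is the localization of
`A` away from the invariant `u`. -/
def IsLocalModel (u : Invariants A) {S M : Type*} [CommRing S] [Algebra (Invariants A) S]
    [CommRing M] [Algebra S M] (ρ : SL(2, ℂ) →* (M →ₐ[S] M)) : Prop :=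
  ∃ j : A →+* M, (∀ r : Invariants A, j r = algebraMap S M (algebraMap _ S r)) ∧
    (∀ g a, ρ g (j a) = j (g • a)) ∧ Function.Injective j ∧
    ∀ x : M, ∃ (N : ℕ) (a : A), algebraMap S M (algebraMap _ S u) ^ N * x = j a

variable [IsDomain A] (hact : IsAlgebraicAction A)

/-- Let `f` generate `A` over the invariants after inverting `u`, and let `ψ` embed an `SL₂`-algebra
`B` over `S = R[1/u]` into a field containing `A`, taking some generators `b k` of a subalgebra `M`
to `Fᵏ f`. If the operators of `𝔰𝔩₂` act on the `b k` as they do on the `Fᵏ f`, then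
`M` is the localization of `A`, as an algebra with action. -/
theorem isLocalModel_of_generators {d : ℕ} {f : A} (hf : f ∈ weightSpace A d)
    (hfE : raise hact f = 0) {u : Invariants A}
    (hloc : ∀ a : A, ∃ N : ℕ, (u : A) ^ N * a ∈ stringAlgebra hact f)
    {S B M L : Type*} [CommRing S] [Algebra ℂ S] [Algebra (Invariants A) S]
    [IsScalarTower ℂ (Invariants A) S] [IsLocalization.Away u S]
    [Field L] [Algebra A L] [FaithfulSMul A L] [Algebra S L] [IsScalarTower (Invariants A) S L]
    [CommRing B] [IsDomain B] [Algebra S B] [Algebra ℂ B] [IsScalarTower ℂ S B]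
    (ψ : B →ₐ[S] L) (hψ : Function.Injective ψ) [CommRing M] [Algebra S M]
    (ι : M →ₐ[S] B) (hι : Function.Injective ι) (b : ℕ → B)
    (hrange : ι.range = Algebra.adjoin S (Set.range b))
    (hψb : ∀ k, ψ (b k) = algebraMap A L ((lowerOp hact)^[k] f))
    (ρM : SL(2, ℂ) →* (M →ₐ[S] M)) (ρB : SL(2, ℂ) →* (B →ₐ[S] B))
    (hρ : ∀ g x, ι (ρM g x) = ρB g (ι x))
    (hU : IsPolynomialFlow fun c => (ρB (upper c)).restrictScalars ℂ)
    (hL : IsPolynomialFlow fun c => (ρB (lower c)).restrictScalars ℂ)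
    (hU0 : hU.deriv (b 0) = 0)
    (hUs : ∀ k, hU.deriv (b (k + 1)) = ((k + 1) * (d - k) : B) * b k)
    (hLb : ∀ k, hL.deriv (b k) = b (k + 1)) : IsLocalModel u ρM := by
  have hψι : Function.Injective (ψ.comp ι) := hψ.comp hι
  have hAL := FaithfulSMul.algebraMap_injective A L
  have hunit : IsUnit (algebraMap (Invariants A) S u) := IsLocalization.Away.algebraMap_isUnit u
  have hcompat : ∀ r : Invariants A,
      algebraMap S L (algebraMap (Invariants A) S r) = algebraMap A L r := fun r => by
    rw [← IsScalarTower.algebraMap_apply, IsScalarTower.algebraMap_apply (Invariants A) A L]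
    rfl
  -- The images of `A` and `M` in `L` are compared: that of `M` contains the `Fᵏ f` and `1 / u`,
  -- hence all of `A`.
  have hex : ∀ a : A, ∃ x : M, ψ (ι x) = algebraMap A L a := by
    have h1 : ∀ a ∈ stringAlgebra hact f, ∃ x : M, ψ (ι x) = algebraMap A L a := by
      intro a ha
      induction ha using Algebra.adjoin_induction with
      | mem x hx =>
        obtain ⟨k, rfl⟩ := hx
        have : b k ∈ ι.range := hrange ▸ Algebra.subset_adjoin ⟨k, rfl⟩
        obtain ⟨x, hx⟩ := this
        exact ⟨x, (congrArg ψ hx).trans (hψb k)⟩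
      | algebraMap r => exact ⟨algebraMap S M (algebraMap _ S r), by
          rw [AlgHom.commutes, AlgHom.commutes, hcompat]
          rfl⟩
      | add x y _ _ hx hy =>
        obtain ⟨x, hx⟩ := hx
        obtain ⟨y, hy⟩ := hy
        exact ⟨x + y, by simp only [map_add, hx, hy]⟩
      | mul x y _ _ hx hy =>
        obtain ⟨x, hx⟩ := hx
        obtain ⟨y, hy⟩ := hy
        exact ⟨x * y, by simp only [map_mul, hx, hy]⟩
    intro a
    obtain ⟨N, hN⟩ := hloc a
    obtain ⟨x, hx⟩ := h1 _ hN
    obtain ⟨v, hv⟩ := (hunit.pow N).exists_left_inv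
    refine ⟨algebraMap S M v * x, ?_⟩
    rw [map_mul, map_mul, hx, AlgHom.commutes, AlgHom.commutes, map_mul, map_pow, ← hcompat,
      ← map_pow, ← mul_assoc, ← map_mul, hv, map_one, one_mul]
  choose j hj using hex
  let J : A →+* M :=
    { toFun := j
      map_one' := hψι (by simp [hj])
      map_zero' := hψι (by simp [hj])
      map_add' := fun a a' => hψι (by simp [hj])
      map_mul' := fun a a' => hψι (by simp [hj]) }
  have hJ : ∀ a, ψ (ι (J a)) = algebraMap A L a := hj
  have hJr : ∀ r : Invariants A, J r = algebraMap S M (algebraMap _ S r) := fun r => hψι (by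
    simp [hJ, hcompat])
  have hJb : ∀ k, ι (J ((lowerOp hact)^[k] f)) = b k := fun k => hψ (by rw [hJ, hψb])
  have hSB : ∀ c : ℂ, algebraMap ℂ B c = algebraMap S B
      (algebraMap (Invariants A) S (algebraMap ℂ (Invariants A) c)) := fun c => by
    rw [IsScalarTower.algebraMap_apply ℂ S B, IsScalarTower.algebraMap_apply ℂ (Invariants A) S]
  let φ : A →ₐ[ℂ] B :=
    { (ι : M →+* B).comp J with
      commutes' := fun c => by
        change ι (J (algebraMap ℂ A c)) = _
        rw [hSB, ← AlgHom.commutes ι, ← hJr]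
        rfl }
  have hφ : ∀ a, φ a = ι (J a) := fun _ => rfl
  -- A derivation of `A` over the invariants is determined by its values on the `Fᵏ f`.
  have hder : ∀ (D : Derivation ℂ A A) (D' : Derivation ℂ B B),
      (∀ r : Invariants A, D r = 0) → (∀ s : S, D' (algebraMap S B s) = 0) →
      (∀ k, φ (D ((lowerOp hact)^[k] f)) = D' (b k)) → ∀ a, φ (D a) = D' (φ a) := by
    intro D D' hD hD' hk a
    have hφr : ∀ r : Invariants A, φ r = algebraMap S B (algebraMap _ S r) := fun r => by
      rw [hφ, hJr, AlgHom.commutes]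
    have h1 : ∀ a ∈ stringAlgebra hact f, φ (D a) = D' (φ a) := by
      intro a ha
      induction ha using Algebra.adjoin_induction with
      | mem x hx =>
        obtain ⟨k, rfl⟩ := hx
        change φ (D ((lowerOp hact)^[k] f)) = D' (φ ((lowerOp hact)^[k] f))
        rw [hk, hφ, hJb]
      | algebraMap r =>
        change φ (D (r : A)) = D' (φ (r : A))
        rw [hD, map_zero, hφr, hD']
      | add x y _ _ hx hy => simp only [map_add, hx, hy]
      | mul x y _ _ hx hy => simp only [Derivation.leibniz, map_add, map_mul, smul_eq_mul, hx, hy]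
    obtain ⟨N, hN⟩ := hloc a
    have h2 := h1 _ hN
    have h3 : (u : A) ^ N = ((u ^ N : Invariants A) : A) := by push_cast; rfl
    rw [h3, Derivation.leibniz, hD, smul_zero, add_zero, smul_eq_mul, map_mul, map_mul,
      Derivation.leibniz, hφr, hD', smul_zero, add_zero, smul_eq_mul] at h2
    refine mul_left_cancel₀ (IsUnit.ne_zero ?_) h2
    rw [map_pow]
    exact (hunit.pow N).map (algebraMap S B)
  have hflow : ∀ {γ : ℂ → SL(2, ℂ)}
      (hγ : IsPolynomialFlow fun c => (ρB (γ c)).restrictScalars ℂ) (s : S),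
      hγ.deriv (algebraMap S B s) = 0 := fun hγ s =>
    hγ.deriv_eq_zero_of_forall fun c => AlgHom.commutes _ _
  have hUφ : ∀ a, φ (raise hact a) = hU.deriv (φ a) := by
    refine hder _ _ (raise_invariant hact) (hflow hU) fun k => ?_
    rcases k with _ | k
    · rw [hU0, Function.iterate_zero, id_eq, hfE, map_zero]
    · rw [raise_lowerOp_iterate hact hf hfE, hUs, map_mul, hφ (_^[k] f), hJb]
      simp
  have hLφ : ∀ a, φ (lowerOp hact a) = hL.deriv (φ a) := by
    refine hder _ _ (lowerOp_invariant hact) (hflow hL) fun k => ?_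
    rw [hLb, ← Function.iterate_succ_apply' (lowerOp hact), hφ, hJb]
  -- Since `J` intertwines `E` and `F`, it intertwines the unipotent subgroups, which generate.
  refine ⟨J, hJr, fun g => ?_, fun a a' h => hAL ?_, ?_⟩
  · induction g using induction_upper_lower with
    | hu c => exact fun a => hι ((hρ _ _).trans
        ((isPolynomialFlow_upper hact).map_comm hU φ hUφ c a).symm)
    | hl c => exact fun a => hι ((hρ _ _).trans
        ((isPolynomialFlow_lower hact).map_comm hL φ hLφ c a).symm)
    | hmul g h hg hh =>
      intro a
      rw [map_mul, AlgHom.mul_apply, hh, hg, mul_smul]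
  · rw [← hJ, ← hJ, h]
  · intro x
    have key : ∀ y ∈ Algebra.adjoin S (Set.range b), ∃ (N : ℕ) (a : A),
        algebraMap S B (algebraMap _ S u) ^ N * y = φ a := by
      have hφu : φ u = algebraMap S B (algebraMap _ S u) := by rw [hφ, hJr, AlgHom.commutes]
      intro y hy
      induction hy using Algebra.adjoin_induction with
      | mem x hx =>
        obtain ⟨k, rfl⟩ := hx
        exact ⟨0, _, by rw [pow_zero, one_mul, ← hJb]; rfl⟩
      | algebraMap s =>
        obtain ⟨N, r, hr⟩ := IsLocalization.Away.surj u s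
        refine ⟨N, r, ?_⟩
        rw [← map_pow, ← map_mul, mul_comm, hr, hφ, hJr, AlgHom.commutes]
      | add x y _ _ hx hy =>
        obtain ⟨N, a, ha⟩ := hx
        obtain ⟨K, c, hc⟩ := hy
        refine ⟨N + K, u ^ K * a + u ^ N * c, ?_⟩
        simp only [map_add, map_mul, map_pow, hφu, ← ha, ← hc]
        ring
      | mul x y _ _ hx hy =>
        obtain ⟨N, a, ha⟩ := hx
        obtain ⟨K, c, hc⟩ := hy
        refine ⟨N + K, a * c, ?_⟩
        simp only [map_mul, ← ha, ← hc]
        ring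
    obtain ⟨N, a, h⟩ := key (ι x) (hrange ▸ ⟨x, rfl⟩)
    refine ⟨N, a, hι ?_⟩
    rw [map_mul, map_pow, AlgHom.commutes, h]
    rfl

end Model

/-! ### The cone -/

theorem isAlgebraic_of_isLocalization_away {R S : Type*} [CommRing R] [IsDomain R] [CommRing S]
    [Algebra R S] {u : R} (hu : u ≠ 0) [IsLocalization.Away u S] : Algebra.IsAlgebraic R S := by
  refine ⟨fun z => ?_⟩
  obtain ⟨n, r, hr⟩ := IsLocalization.Away.surj u z
  refine ⟨Polynomial.C (u ^ n) * Polynomial.X - Polynomial.C r, fun h => ?_, ?_⟩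
  · have := congrArg (Polynomial.coeff · 1) h
    rw [Polynomial.coeff_sub, Polynomial.coeff_C_mul, Polynomial.coeff_X_one, Polynomial.coeff_C,
      if_neg one_ne_zero, sub_zero, mul_one, Polynomial.coeff_zero] at this
    exact pow_ne_zero n hu this
  · simp [← hr, mul_comm]

section Independence

variable {A : Type*} [CommRing A] [Algebra ℂ A] [MulSemiringAction SL(2, ℂ) A]
  [SMulCommClass SL(2, ℂ) ℂ A] [IsDomain A]

/-- Two elements of an overfield generating an algebra that contains `f` and `F f` are algebraically
independent over the invariants, and also over a localization of the ring of invariants. -/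
theorem algebraicIndependent_of_highest_mem_adjoin (hact : IsAlgebraicAction A) {d : ℕ}
    (hd : d ≠ 0) {f : A} (hf : f ∈ weightSpace A d) (hfE : raise hact f = 0) (hf0 : f ≠ 0)
    {L : Type*} [Field L] [Algebra A L] [FaithfulSMul A L] {x : Fin 2 → L}
    (h1 : algebraMap A L f ∈ Algebra.adjoin (Invariants A) (Set.range x))
    (h2 : algebraMap A L (lowerOp hact f) ∈ Algebra.adjoin (Invariants A) (Set.range x))
    {u : Invariants A} (hu : u ≠ 0) (S : Type*) [CommRing S] [IsDomain S]
    [Algebra (Invariants A) S] [IsLocalization.Away u S] [Algebra S L]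
    [IsScalarTower (Invariants A) S L] : AlgebraicIndependent S x := by
  have := isAlgebraic_of_isLocalization_away (S := S) hu
  refine AlgebraicIndependent.extendScalars (R := Invariants A) S ?_
  let K := FractionRing A
  have hind : AlgebraicIndependent (Invariants A)
      (fun o : Option (Option Empty) => o.elim (lowerOp hact f) fun o => o.elim f Empty.elim) := by
    have := algebraicIndependent_of_highest hact (L := K) (x := (Empty.elim : Empty → K))
      (fracAct A) fracAct_algebraMap (algebraicIndependent_empty_type_iff.2
        ((IsFractionRing.injective A K).comp Subtype.val_injective)) (fun _ i => i.elim)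
      (fun _ i => i.elim) hd hf hfE hf0
    refine AlgebraicIndependent.of_comp (IsScalarTower.toAlgHom (Invariants A) A K) ?_
    have h : (IsScalarTower.toAlgHom (Invariants A) A K) ∘ (fun o : Option (Option Empty) =>
        o.elim (lowerOp hact f) fun o => o.elim f Empty.elim) =
        fun o => o.elim (algebraMap A K (lowerOp hact f)) fun o =>
          o.elim (algebraMap A K f) Empty.elim := by
      funext o
      rcases o with _ | _ | o
      · rfl
      · rfl
      · exact o.elim
    rw [h]
    exact this
  have hind' := hind.map' (f := IsScalarTower.toAlgHom (Invariants A) A L)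
    (FaithfulSMul.algebraMap_injective A L)
  refine algebraicIndependent_of_mem_adjoin hind' ?_ (by simp)
  rintro (_ | _ | o)
  · exact h2
  · exact h1
  · exact o.elim

end Independence

section PlaneAction

variable (S : Type*) [CommRing S] [Algebra ℂ S]

/-- The substitution `f ↦ f ∘ N` on polynomial functions on the plane with coefficients in `S`. -/
noncomputable def planeSubstOver (N : Matrix (Fin 2) (Fin 2) ℂ) :
    MvPolynomial (Fin 2) S →ₐ[S] MvPolynomial (Fin 2) S :=
  aeval fun i => C (algebraMap ℂ S (N i 0)) * X 0 + C (algebraMap ℂ S (N i 1)) * X 1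

/-- The standard action of `SL₂(ℂ)` on the functions on the plane over `S`. -/
noncomputable def planeAction :
    SL(2, ℂ) →* (MvPolynomial (Fin 2) S →ₐ[S] MvPolynomial (Fin 2) S) where
  toFun g := planeSubstOver S (g⁻¹).1
  map_one' := by
    ext1 i
    fin_cases i <;> simp [planeSubstOver]
  map_mul' g h := by
    ext1 i
    simp only [planeSubstOver, mul_inv_rev, aeval_X, AlgHom.mul_apply, map_add, map_mul, algHom_C,
      Matrix.mul_apply, Fin.sum_univ_two, algebraMap_eq, Matrix.SpecialLinearGroup.coe_mul]
    ring

theorem planeAction_upper (c : ℂ) (i : Fin 2) : planeAction S (upper c) (X i) =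
    ![X 0 - X 1 * algebraMap ℂ _ c, X 1] i := by
  change planeSubstOver S ((upper c)⁻¹).1 (X i) = _
  rw [upper_inv, planeSubstOver, aeval_X]
  fin_cases i <;>
    simp [upper, sub_eq_add_neg, mul_comm, IsScalarTower.algebraMap_eq ℂ S (MvPolynomial _ S)]

theorem planeAction_lower (c : ℂ) (i : Fin 2) : planeAction S (lower c) (X i) =
    ![X 0, X 1 - X 0 * algebraMap ℂ _ c] i := by
  change planeSubstOver S ((lower c)⁻¹).1 (X i) = _
  rw [lower_inv, planeSubstOver, aeval_X]
  fin_cases i <;> simp [lower, sub_eq_add_neg, add_comm, mul_comm,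
    IsScalarTower.algebraMap_eq ℂ S (MvPolynomial _ S)]

theorem isPolynomialFlow_planeAction_upper :
    IsPolynomialFlow fun c => (planeAction S (upper c)).restrictScalars ℂ := by
  refine isPolynomialFlow_of_generators _ upper_zero upper_add (adjoin_range_X (R := S)) ?_
  rintro _ ⟨i, rfl⟩
  refine ⟨![Polynomial.C (X 0) - Polynomial.X * Polynomial.C (X 1), Polynomial.C (X 1)] i,
    fun c => ?_⟩
  rw [planeAction_upper]
  fin_cases i <;> simp

theorem isPolynomialFlow_planeAction_lower :
    IsPolynomialFlow fun c => (planeAction S (lower c)).restrictScalars ℂ := by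
  refine isPolynomialFlow_of_generators _ lower_zero lower_add (adjoin_range_X (R := S)) ?_
  rintro _ ⟨i, rfl⟩
  refine ⟨![Polynomial.C (X 0), Polynomial.C (X 1) - Polynomial.X * Polynomial.C (X 0)] i,
    fun c => ?_⟩
  rw [planeAction_lower]
  fin_cases i <;> simp

variable [IsDomain S]

theorem deriv_planeAction_upper (i : Fin 2) :
    (isPolynomialFlow_planeAction_upper S).deriv (X i) = ![-X 1, 0] i := by
  rw [IsPolynomialFlow.deriv_eq _ (P := ![Polynomial.C (X 0) - Polynomial.X * Polynomial.C (X 1),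
    Polynomial.C (X 1)] i) (fun c => ?_)]
  · fin_cases i <;> simp [Polynomial.coeff_C]
  · rw [AlgHom.restrictScalars_apply, planeAction_upper]
    fin_cases i <;> simp

theorem deriv_planeAction_lower (i : Fin 2) :
    (isPolynomialFlow_planeAction_lower S).deriv (X i) = ![0, -X 0] i := by
  rw [IsPolynomialFlow.deriv_eq _ (P := ![Polynomial.C (X 0),
    Polynomial.C (X 1) - Polynomial.X * Polynomial.C (X 0)] i) (fun c => ?_)]
  · fin_cases i <;> simp [Polynomial.coeff_C]
  · rw [AlgHom.restrictScalars_apply, planeAction_lower]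
    fin_cases i <;> simp

end PlaneAction

section Cone

variable (S : Type u) [CommRing S] [Algebra ℂ S]

/-- The functions on the product of the cone with `Spec S`, as polynomials with coefficients
in `S`. -/
noncomputable def coneEmbedding (n : ℕ) : (S ⊗[ℂ] coneRing n) →ₐ[S] MvPolynomial (Fin 2) S :=
  (algebraTensorAlgEquiv ℂ S).toAlgHom.comp
    (Algebra.TensorProduct.map (AlgHom.id S S) (coneRing n).val)

theorem coneEmbedding_tmul (n : ℕ) (s : S) (p : coneRing n) :
    coneEmbedding S n (s ⊗ₜ p) = s • map (algebraMap ℂ S) p.1 :=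
  algebraTensorAlgEquiv_tmul _ _ _ _

theorem coneEmbedding_injective (n : ℕ) : Function.Injective (coneEmbedding S n) := by
  refine (algebraTensorAlgEquiv ℂ S).injective.comp ?_
  exact Module.Flat.lTensor_preserves_injective_linearMap (M := S) (coneRing n).val.toLinearMap
    Subtype.val_injective

theorem coneEmbedding_productAction (n : ℕ) (g : SL(2, ℂ)) (x : S ⊗[ℂ] coneRing n) :
    coneEmbedding S n (productAction S n g x) = planeAction S g (coneEmbedding S n x) := by
  have h : ∀ p : MvPolynomial (Fin 2) ℂ, map (algebraMap ℂ S) (planeSubst (g⁻¹).1 p) =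
      planeSubstOver S (g⁻¹).1 (map (algebraMap ℂ S) p) := by
    intro p
    induction p using MvPolynomial.induction_on with
    | C c => simp [planeSubst, planeSubstOver]
    | add p q hp hq => simp only [map_add, hp, hq]
    | mul_X p i hp =>
      simp only [map_mul, hp]
      congr 1
      simp [planeSubst, planeSubstOver]
  induction x using TensorProduct.induction_on with
  | zero => simp only [map_zero]
  | add x y hx hy => simp only [map_add, hx, hy]
  | tmul s p =>
    change coneEmbedding S n (s ⊗ₜ coneAction n g p) = _
    rw [coneEmbedding_tmul, coneEmbedding_tmul, map_smul]
    exact congrArg _ (h p.1)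

/-- The standard basis of the binary forms of degree `n`, normalized such that the lowering operator
maps each form to the next. -/
noncomputable def coneBasis (n k : ℕ) : MvPolynomial (Fin 2) S :=
  (n.descFactorial k : MvPolynomial (Fin 2) S) * (X 1 ^ (n - k) * (-X 0) ^ k)

/-- The monomials of degree `n` are multiples of the `coneBasis` by nonzero rational numbers. -/
theorem range_coneEmbedding (n : ℕ) :
    (coneEmbedding S n).range = Algebra.adjoin S (Set.range (coneBasis S n)) := by
  apply le_antisymm
  · rintro _ ⟨x, rfl⟩
    change coneEmbedding S n x ∈ _
    induction x using TensorProduct.induction_on with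
    | zero =>
      rw [map_zero]
      exact zero_mem _
    | add x y hx hy =>
      rw [map_add]
      exact add_mem hx hy
    | tmul s p =>
      rw [coneEmbedding_tmul]
      refine Subalgebra.smul_mem _ ?_ s
      obtain ⟨p, hp⟩ := p
      change map (algebraMap ℂ S) p ∈ _
      induction hp using Algebra.adjoin_induction with
      | mem p hp =>
        rw [p.as_sum, map_sum]
        refine sum_mem fun e he => ?_
        have hdeg : e 0 + e 1 = n := by
          have := hp (mem_support_iff.1 he)
          rwa [Finsupp.weight_apply, Finsupp.sum_fintype _ _ (by simp), Fin.sum_univ_two,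
            Pi.one_apply, Pi.one_apply, smul_eq_mul, smul_eq_mul, mul_one, mul_one] at this
        have hne : ((n.descFactorial (e 0) : ℕ) : ℂ) ≠ 0 :=
          Nat.cast_ne_zero.2 (by rw [Ne, Nat.descFactorial_eq_zero_iff_lt]; omega)
        have : map (algebraMap ℂ S) (monomial e (coeff e p)) =
            algebraMap ℂ S (coeff e p * (-1) ^ e 0 / (n.descFactorial (e 0) : ℕ)) •
              coneBasis S n (e 0) := by
          have h1 : coneBasis S n (e 0) =
              C (algebraMap ℂ S ((n.descFactorial (e 0) : ℕ) * (-1) ^ e 0)) *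
                (X 1 ^ e 1 * X 0 ^ e 0) := by
            rw [coneBasis, show n - e 0 = e 1 by omega, neg_pow]
            simp only [map_mul, map_pow, map_natCast, map_neg, map_one]
            ring
          have h2 : (-1 : ℂ) ^ e 0 * (-1) ^ e 0 = 1 := by
            rw [← mul_pow, neg_one_mul, neg_neg, one_pow]
          have h3 : coeff e p * (-1) ^ e 0 / (n.descFactorial (e 0) : ℕ) *
              ((n.descFactorial (e 0) : ℕ) * (-1) ^ e 0) = coeff e p := by
            rw [← mul_assoc, div_mul_cancel₀ _ hne, mul_assoc, h2, mul_one]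
          rw [h1, smul_eq_C_mul, ← mul_assoc, ← map_mul, ← map_mul, h3, map_monomial,
            monomial_eq, Finsupp.prod_fintype _ _ (by simp), Fin.prod_univ_two,
            mul_comm (X 1 ^ e 1)]
        rw [this]
        exact Subalgebra.smul_mem _ (Algebra.subset_adjoin (Set.mem_range_self _)) _
      | algebraMap c =>
        rw [algebraMap_eq, map_C]
        exact (Algebra.adjoin S _).algebraMap_mem _
      | add p q _ _ hp hq =>
        rw [map_add]
        exact add_mem hp hq
      | mul p q _ _ hp hq =>
        rw [map_mul]
        exact mul_mem hp hq
  · refine Algebra.adjoin_le ?_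
    rintro _ ⟨k, rfl⟩
    by_cases hk : k ≤ n
    · have hhom : (((n.descFactorial k : ℕ) : MvPolynomial (Fin 2) ℂ) *
          (X 1 ^ (n - k) * (-X 0) ^ k)).IsHomogeneous n := by
        have h1 : (((n.descFactorial k : ℕ) : MvPolynomial (Fin 2) ℂ)).IsHomogeneous 0 := by
          rw [← map_natCast (C (σ := Fin 2) (R := ℂ))]
          exact isHomogeneous_C _ _
        have h2 := h1.mul (((isHomogeneous_X ℂ (1 : Fin 2)).pow (n - k)).mul
          (((isHomogeneous_X ℂ (0 : Fin 2)).neg).pow k))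
        convert h2 using 1
        omega
      refine ⟨1 ⊗ₜ ⟨_, Algebra.subset_adjoin hhom⟩, ?_⟩
      change coneEmbedding S n _ = _
      rw [coneEmbedding_tmul, one_smul]
      simp [coneBasis]
    · rw [coneBasis, Nat.descFactorial_eq_zero_iff_lt.2 (by omega), Nat.cast_zero, zero_mul]
      exact zero_mem _

theorem deriv_planeAction_lower_coneBasis [IsDomain S] (n k : ℕ) :
    (isPolynomialFlow_planeAction_lower S).deriv (coneBasis S n k) = coneBasis S n (k + 1) := by
  have h0 := deriv_planeAction_lower S 0
  have h1 := deriv_planeAction_lower S 1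
  simp only [Matrix.cons_val_zero, Matrix.cons_val_one] at h0 h1
  by_cases hk : k < n
  · obtain ⟨e, rfl⟩ := Nat.exists_eq_add_of_lt hk
    rw [coneBasis, coneBasis, show k + e + 1 - k = e + 1 by omega,
      show k + e + 1 - (k + 1) = e by omega, Nat.descFactorial_succ,
      show k + e + 1 - k = e + 1 by omega]
    simp only [Derivation.leibniz, Derivation.leibniz_pow, Derivation.map_natCast, h0, h1, map_neg,
      neg_zero, Nat.add_sub_cancel, smul_eq_mul, nsmul_eq_mul]
    push_cast
    ring
  · rw [coneBasis, coneBasis, Nat.descFactorial_eq_zero_iff_lt.2 (show n < k + 1 by omega)]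
    rcases (not_lt.1 hk).eq_or_lt with rfl | hk
    · simp [Derivation.leibniz, Derivation.leibniz_pow, h0]
    · simp [Nat.descFactorial_eq_zero_iff_lt.2 hk]

theorem deriv_planeAction_upper_coneBasis_zero [IsDomain S] (n : ℕ) :
    (isPolynomialFlow_planeAction_upper S).deriv (coneBasis S n 0) = 0 := by
  have h1 := deriv_planeAction_upper S 1
  simp only [Matrix.cons_val_one] at h1
  simp [coneBasis, Derivation.leibniz_pow, h1]

theorem deriv_planeAction_upper_coneBasis_succ [IsDomain S] (n k : ℕ) :
    (isPolynomialFlow_planeAction_upper S).deriv (coneBasis S n (k + 1)) =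
      ((k + 1) * (n - k) : MvPolynomial (Fin 2) S) * coneBasis S n k := by
  have h0 := deriv_planeAction_upper S 0
  have h1 := deriv_planeAction_upper S 1
  simp only [Matrix.cons_val_zero, Matrix.cons_val_one] at h0 h1
  by_cases hk : k < n
  · obtain ⟨e, rfl⟩ := Nat.exists_eq_add_of_lt hk
    rw [coneBasis, coneBasis, show k + e + 1 - k = e + 1 by omega,
      show k + e + 1 - (k + 1) = e by omega, Nat.descFactorial_succ,
      show k + e + 1 - k = e + 1 by omega]
    simp only [Derivation.leibniz, Derivation.leibniz_pow, Derivation.map_natCast, h0, h1, map_neg,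
      neg_neg, Nat.add_sub_cancel, smul_eq_mul, nsmul_eq_mul]
    push_cast
    ring
  · rw [coneBasis, coneBasis, Nat.descFactorial_eq_zero_iff_lt.2 (show n < k + 1 by omega)]
    rcases (not_lt.1 hk).eq_or_lt with rfl | hk
    · simp
    · simp [Nat.descFactorial_eq_zero_iff_lt.2 hk]

variable {A : Type*} [CommRing A] [Algebra ℂ A] [MulSemiringAction SL(2, ℂ) A]
  [SMulCommClass SL(2, ℂ) ℂ A] [IsDomain A] (hact : IsAlgebraicAction A)

/-- If the Hessian of `f` vanishes, then `A` is a cone near the point in question. -/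
theorem isLocalModel_cone {d : ℕ} (hd : d ≠ 0) {f : A} (hf : f ∈ weightSpace A d)
    (hfE : raise hact f = 0) (hf0 : f ≠ 0) {u : Invariants A} (hu : u ≠ 0)
    (hloc : ∀ a : A, ∃ N : ℕ, (u : A) ^ N * a ∈ stringAlgebra hact f)
    (hN : hessian hact d f = 0) [IsDomain S] [Algebra (Invariants A) S]
    [IsScalarTower ℂ (Invariants A) S] [IsLocalization.Away u S] {L : Type*} [Field L]
    [IsAlgClosed L] [Algebra A L] [FaithfulSMul A L] [Algebra S L]
    [IsScalarTower (Invariants A) S L] : IsLocalModel u (productAction S d) := by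
  have hinj := FaithfulSMul.algebraMap_injective A L
  have : CharZero A := charZero_of_injective_algebraMap (algebraMap ℂ A).injective
  have : CharZero L := charZero_of_injective_algebraMap hinj
  set φ := algebraMap A L f with hφ
  have hφ0 : φ ≠ 0 := (map_ne_zero_iff _ hinj).2 hf0
  have hdL : (d : L) ≠ 0 := Nat.cast_ne_zero.2 hd
  -- In terms of the coordinates `w`, `w s` on the plane, `f = w ^ d` and `F f = d w ^ d s`.
  obtain ⟨w, hw⟩ := IsAlgClosed.exists_pow_nat_eq φ (Nat.pos_of_ne_zero hd)
  obtain ⟨s, hs⟩ : ∃ s, algebraMap A L (lowerOp hact f) = d * φ * s :=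
    ⟨_, (mul_div_cancel₀ _ (mul_ne_zero hdL hφ0)).symm⟩
  have hmem : ∀ i, (![-(w * s), w] : Fin 2 → L) i ∈
      Algebra.adjoin (Invariants A) (Set.range ![-(w * s), w]) :=
    fun i => Algebra.subset_adjoin ⟨i, rfl⟩
  have hind : AlgebraicIndependent S (![-(w * s), w] : Fin 2 → L) := by
    refine algebraicIndependent_of_highest_mem_adjoin hact hd hf hfE hf0 ?_ ?_ hu S
    · rw [← hφ, ← hw]
      exact pow_mem (hmem 1) d
    · obtain ⟨e, rfl⟩ := Nat.exists_eq_succ_of_ne_zero hd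
      have : algebraMap A L (lowerOp hact f) = ((e + 1 : ℕ) : L) * (w ^ e * (-(-(w * s)))) := by
        rw [hs, ← hw, Nat.succ_eq_add_one]
        ring
      rw [this]
      exact mul_mem (natCast_mem _ _) (mul_mem (pow_mem (hmem 1) e) (neg_mem (hmem 0)))
  refine isLocalModel_of_generators hact hf hfE hloc (aeval ![-(w * s), w]) hind
    (coneEmbedding S d) (coneEmbedding_injective S d) (coneBasis S d) (range_coneEmbedding S d) ?_
    (productAction S d) (planeAction S) (coneEmbedding_productAction S d)
    (isPolynomialFlow_planeAction_upper S) (isPolynomialFlow_planeAction_lower S)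
    (deriv_planeAction_upper_coneBasis_zero S d) (deriv_planeAction_upper_coneBasis_succ S d)
    (deriv_planeAction_lower_coneBasis S d)
  intro k
  by_cases hk : k ≤ d
  · have h1 := congrArg (algebraMap A L) (pow_mul_lowerOp_iterate_of_hessian_eq_zero hact hN hk)
    simp only [map_mul, map_pow, map_natCast, hs, ← hφ] at h1
    have h2 : (d : L) ^ k * φ ^ k ≠ 0 := mul_ne_zero (pow_ne_zero _ hdL) (pow_ne_zero _ hφ0)
    apply mul_left_cancel₀ h2
    rw [h1]
    obtain ⟨e, rfl⟩ := Nat.exists_eq_add_of_le hk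
    simp only [coneBasis, map_mul, map_natCast, map_pow, map_neg, aeval_X, Matrix.cons_val_zero,
      Matrix.cons_val_one, neg_neg, Nat.add_sub_cancel_left]
    rw [← hw]
    ring
  · rw [lowerOp_iterate_eq_zero hact hf hfE (not_le.1 hk), coneBasis,
      Nat.descFactorial_eq_zero_iff_lt.2 (not_le.1 hk)]
    simp

end Cone

/-! ### The family of quadrics -/

section QuadricCoord

variable {S : Type u} [CommRing S] (P : S)

/-- The coordinate functions on the family of quadrics `4 x z - y² = P`. -/
noncomputable def quadricCoord (i : Fin 3) : QuadricRing P := Ideal.Quotient.mk _ (X i)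

theorem quadricCoord_relation :
    4 * quadricCoord P 0 * quadricCoord P 2 - quadricCoord P 1 ^ 2 = algebraMap S _ P := by
  have h : Ideal.Quotient.mk (Ideal.span {quadricPoly P}) (quadricPoly P) = 0 :=
    Ideal.Quotient.eq_zero_iff_mem.2 (Ideal.mem_span_singleton_self _)
  exact sub_eq_zero.1 h

theorem adjoin_range_quadricCoord : Algebra.adjoin S (Set.range (quadricCoord P)) = ⊤ := by
  have h := congrArg (Subalgebra.map (Ideal.Quotient.mkₐ S (Ideal.span {quadricPoly P})))
    (adjoin_range_X (R := S) (σ := Fin 3))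
  rw [AlgHom.map_adjoin, ← Set.range_comp, Algebra.map_top,
    (AlgHom.range_eq_top _).2 (Ideal.Quotient.mkₐ_surjective S _)] at h
  exact h

theorem quadricNeg_quadricCoord (i : Fin 3) :
    quadricNeg P (quadricCoord P i) = -quadricCoord P i := by
  change Ideal.Quotient.mk _ (negSubst (X i)) = _
  rw [negSubst, aeval_X, map_neg]
  rfl

/-- The homomorphism from the functions on the family of quadrics given by a point of it. -/
noncomputable def quadricLift {L : Type*} [CommRing L] [Algebra S L] (x : Fin 3 → L)
    (hx : 4 * x 0 * x 2 - x 1 ^ 2 = algebraMap S L P) : QuadricRing P →ₐ[S] L :=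
  Ideal.Quotient.liftₐ _ (aeval x) fun a ha => by
    have hle : Ideal.span {quadricPoly P} ≤ RingHom.ker (aeval (R := S) x) := by
      rw [Ideal.span_singleton_le_iff_mem, RingHom.mem_ker, quadricPoly]
      simp [← hx, -coe_aeval_eq_eval]
    exact hle ha

theorem quadricLift_quadricCoord {L : Type*} [CommRing L] [Algebra S L] (x : Fin 3 → L)
    (hx : 4 * x 0 * x 2 - x 1 ^ 2 = algebraMap S L P) (i : Fin 3) :
    quadricLift P x hx (quadricCoord P i) = x i := by
  change aeval x (X i) = _
  rw [aeval_X]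

/-- The coordinate `z` is not a zero divisor: `z` is prime in the polynomial ring and does not
divide `4 x z - y² - P`. -/
theorem eq_zero_of_quadricCoord_two_mul [IsDomain S] {y : QuadricRing P}
    (h : quadricCoord P 2 * y = 0) : y = 0 := by
  obtain ⟨p, rfl⟩ := Ideal.Quotient.mk_surjective y
  rw [quadricCoord, ← map_mul, Ideal.Quotient.eq_zero_iff_mem, Ideal.mem_span_singleton] at h
  rw [Ideal.Quotient.eq_zero_iff_mem, Ideal.mem_span_singleton]
  obtain ⟨q, hq⟩ := h
  have hdvd : (X 2 : MvPolynomial (Fin 3) S) ∣ quadricPoly P * q := ⟨p, hq.symm⟩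
  rcases (X_prime (R := S) (i := (2 : Fin 3))).dvd_or_dvd hdvd with ⟨r, hr⟩ | ⟨r, rfl⟩
  · exfalso
    have h0 := congrArg (aeval (R := S) ![(0 : S), 0, 0]) hr
    have h1 := congrArg (aeval (R := S) ![(0 : S), 1, 0]) hr
    simp [quadricPoly, -coe_aeval_eq_eval] at h0 h1
    simp [h0] at h1
  · refine ⟨r, mul_left_cancel₀ (X_ne_zero (2 : Fin 3)) ?_⟩
    rw [hq]
    ring

variable [Algebra ℂ S]

theorem isUnit_natCast_of_complex (B : Type*) [CommRing B] [Algebra ℂ B] {n : ℕ} (hn : n ≠ 0) :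
    IsUnit (n : B) := by
  have := (isUnit_iff_ne_zero.2 (Nat.cast_ne_zero (R := ℂ).2 hn)).map (algebraMap ℂ B)
  rwa [map_natCast] at this

/-- Since `x` is a rational function of `y` and `z` on the family `4 x z - y² = P`, a homomorphism
is injective if the images of `y` and `z` are algebraically independent. -/
theorem injective_of_algebraicIndependent [IsDomain S] {L : Type*} [CommRing L] [Algebra S L]
    (ψ : QuadricRing P →ₐ[S] L)
    (h : AlgebraicIndependent S ![ψ (quadricCoord P 1), ψ (quadricCoord P 2)]) :
    Function.Injective ψ := by
  set x := quadricCoord P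
  -- After multiplication by a power of `4 z`, every function is a polynomial in `y` and `z`.
  have key : ∀ y : QuadricRing P, ∃ (N : ℕ) (p : MvPolynomial (Fin 2) S),
      (4 * x 2) ^ N * y = aeval ![x 1, x 2] p := by
    intro y
    have hy : y ∈ Algebra.adjoin S (Set.range x) :=
      (adjoin_range_quadricCoord P).symm ▸ Algebra.mem_top
    induction hy using Algebra.adjoin_induction with
    | mem y hy =>
      obtain ⟨i, rfl⟩ := hy
      fin_cases i
      · refine ⟨1, X 0 ^ 2 + C P, ?_⟩
        have := quadricCoord_relation P
        simp only [map_add, map_pow, aeval_X, aeval_C, Matrix.cons_val_zero, ← this]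
        simp only [x, Fin.zero_eta]
        ring
      · exact ⟨0, X 0, by simp [-coe_aeval_eq_eval]⟩
      · exact ⟨0, X 1, by simp [-coe_aeval_eq_eval]⟩
    | algebraMap r => exact ⟨0, C r, by simp [-coe_aeval_eq_eval]⟩
    | add y z _ _ hy hz =>
      obtain ⟨N, p, hp⟩ := hy
      obtain ⟨M, q, hq⟩ := hz
      refine ⟨N + M, (4 * X 1) ^ M * p + (4 * X 1) ^ N * q, ?_⟩
      simp only [map_add, map_mul, map_pow, aeval_X, ← hp, ← hq, map_ofNat, Matrix.cons_val]
      ring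
    | mul y z _ _ hy hz =>
      obtain ⟨N, p, hp⟩ := hy
      obtain ⟨M, q, hq⟩ := hz
      refine ⟨N + M, p * q, ?_⟩
      simp only [map_mul, ← hp, ← hq]
      ring
  refine (injective_iff_map_eq_zero ψ).2 fun y hy => ?_
  obtain ⟨N, p, hp⟩ := key y
  have h1 : aeval ![ψ (x 1), ψ (x 2)] p = 0 := by
    have h2 : (ψ.comp (aeval ![x 1, x 2])) p = 0 := by
      rw [AlgHom.comp_apply, ← hp, map_mul, hy, mul_zero]
    rw [← h2]
    congr 1
    ext i
    fin_cases i <;> simp [-coe_aeval_eq_eval]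
  have hp0 : p = 0 := h (by rw [h1, map_zero])
  rw [hp0, map_zero] at hp
  clear hp0 h1 hy
  induction N with
  | zero => simpa using hp
  | succ N ih =>
    refine ih (eq_zero_of_quadricCoord_two_mul P ?_)
    rw [pow_succ', mul_assoc, mul_assoc] at hp
    exact (isUnit_natCast_of_complex _ four_ne_zero).mul_right_eq_zero.1 hp

theorem algebraMap_quadricRing (c : ℂ) : algebraMap ℂ (QuadricRing P) c =
    Ideal.Quotient.mk _ (C (algebraMap ℂ S c)) := rfl

theorem quadricAction_upper (c : ℂ) (i : Fin 3) :
    quadricAction P (upper c) (quadricCoord P i) =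
      ![quadricCoord P 0 - algebraMap ℂ _ c * quadricCoord P 1
        + algebraMap ℂ _ c ^ 2 * quadricCoord P 2,
        quadricCoord P 1 - 2 * algebraMap ℂ _ c * quadricCoord P 2, quadricCoord P 2] i := by
  change Ideal.Quotient.mk _ (formSubst S ((upper c)⁻¹).1 (X i)) = _
  have h2 : Ideal.Quotient.mk (Ideal.span {quadricPoly P}) 2 = 2 := rfl
  rw [upper_inv, formSubst, aeval_X]
  fin_cases i <;> simp [upper, algebraMap_quadricRing, quadricCoord, sub_eq_add_neg, h2]

theorem quadricAction_lower (c : ℂ) (i : Fin 3) :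
    quadricAction P (lower c) (quadricCoord P i) =
      ![quadricCoord P 0, quadricCoord P 1 - 2 * algebraMap ℂ _ c * quadricCoord P 0,
        quadricCoord P 2 - algebraMap ℂ _ c * quadricCoord P 1
        + algebraMap ℂ _ c ^ 2 * quadricCoord P 0] i := by
  change Ideal.Quotient.mk _ (formSubst S ((lower c)⁻¹).1 (X i)) = _
  have h2 : Ideal.Quotient.mk (Ideal.span {quadricPoly P}) 2 = 2 := rfl
  rw [lower_inv, formSubst, aeval_X]
  fin_cases i <;> simp [lower, algebraMap_quadricRing, quadricCoord, sub_eq_add_neg, h2]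
  · ring
  · ring

/-- The orbit maps of the coordinates under the upper triangular unipotent group. -/
noncomputable def quadricUpperPoly (i : Fin 3) : Polynomial (QuadricRing P) :=
  ![Polynomial.C (quadricCoord P 0) - Polynomial.X * Polynomial.C (quadricCoord P 1)
      + Polynomial.X ^ 2 * Polynomial.C (quadricCoord P 2),
    Polynomial.C (quadricCoord P 1) - Polynomial.C 2 * Polynomial.X *
      Polynomial.C (quadricCoord P 2),
    Polynomial.C (quadricCoord P 2)] i

/-- The orbit maps of the coordinates under the lower triangular unipotent group. -/
noncomputable def quadricLowerPoly (i : Fin 3) : Polynomial (QuadricRing P) :=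
  ![Polynomial.C (quadricCoord P 0),
    Polynomial.C (quadricCoord P 1) - Polynomial.C 2 * Polynomial.X *
      Polynomial.C (quadricCoord P 0),
    Polynomial.C (quadricCoord P 2) - Polynomial.X * Polynomial.C (quadricCoord P 1)
      + Polynomial.X ^ 2 * Polynomial.C (quadricCoord P 0)] i

theorem eval_quadricUpperPoly (i : Fin 3) (c : ℂ) :
    (quadricUpperPoly P i).eval (algebraMap ℂ _ c) =
      quadricAction P (upper c) (quadricCoord P i) := by
  rw [quadricAction_upper]
  fin_cases i <;> simp only [quadricUpperPoly, Fin.zero_eta, Fin.mk_one, Fin.reduceFinMk,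
    Matrix.cons_val, Polynomial.eval_add, Polynomial.eval_sub, Polynomial.eval_mul,
    Polynomial.eval_C, Polynomial.eval_X, Polynomial.eval_pow]

theorem eval_quadricLowerPoly (i : Fin 3) (c : ℂ) :
    (quadricLowerPoly P i).eval (algebraMap ℂ _ c) =
      quadricAction P (lower c) (quadricCoord P i) := by
  rw [quadricAction_lower]
  fin_cases i <;> simp only [quadricLowerPoly, Fin.zero_eta, Fin.mk_one, Fin.reduceFinMk,
    Matrix.cons_val, Polynomial.eval_add, Polynomial.eval_sub, Polynomial.eval_mul,
    Polynomial.eval_C, Polynomial.eval_X, Polynomial.eval_pow]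

theorem isPolynomialFlow_quadricAction_upper :
    IsPolynomialFlow fun c => (quadricAction P (upper c)).restrictScalars ℂ := by
  refine isPolynomialFlow_of_generators _ upper_zero upper_add (adjoin_range_quadricCoord P) ?_
  rintro _ ⟨i, rfl⟩
  exact ⟨_, eval_quadricUpperPoly P i⟩

theorem isPolynomialFlow_quadricAction_lower :
    IsPolynomialFlow fun c => (quadricAction P (lower c)).restrictScalars ℂ := by
  refine isPolynomialFlow_of_generators _ lower_zero lower_add (adjoin_range_quadricCoord P) ?_
  rintro _ ⟨i, rfl⟩
  exact ⟨_, eval_quadricLowerPoly P i⟩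

theorem deriv_quadricAction_upper [IsDomain (QuadricRing P)] (i : Fin 3) :
    (isPolynomialFlow_quadricAction_upper P).deriv (quadricCoord P i) =
      ![-quadricCoord P 1, -(2 * quadricCoord P 2), 0] i := by
  rw [IsPolynomialFlow.deriv_eq _ (eval_quadricUpperPoly P i)]
  fin_cases i <;> simp [quadricUpperPoly, Polynomial.coeff_C, Polynomial.coeff_X_pow]

theorem deriv_quadricAction_lower [IsDomain (QuadricRing P)] (i : Fin 3) :
    (isPolynomialFlow_quadricAction_lower P).deriv (quadricCoord P i) =
      ![0, -(2 * quadricCoord P 0), -quadricCoord P 1] i := by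
  rw [IsPolynomialFlow.deriv_eq _ (eval_quadricLowerPoly P i)]
  fin_cases i <;> simp [quadricLowerPoly, Polynomial.coeff_C, Polynomial.coeff_X_pow]

end QuadricCoord

section Generators

variable {S : Type u} [CommRing S] [Algebra ℂ S] (P : S)

/-- The basis of the linear functions on the family of quadrics on which the lowering operator acts
as a shift, extended by zero. -/
noncomputable def quadricBasis : ℕ → QuadricRing P
  | 0 => quadricCoord P 2
  | 1 => -quadricCoord P 1
  | 2 => 2 * quadricCoord P 0
  | _ => 0

/-- The basis of the irreducible representation of dimension `5` in the quadratic functions on the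
family of quadrics on which the lowering operator acts as a shift, extended by zero. -/
noncomputable def halfQuadricBasis : ℕ → QuadricRing P
  | 0 => quadricCoord P 2 ^ 2
  | 1 => -2 * quadricCoord P 1 * quadricCoord P 2
  | 2 => 4 * quadricCoord P 0 * quadricCoord P 2 + 2 * quadricCoord P 1 ^ 2
  | 3 => -12 * quadricCoord P 0 * quadricCoord P 1
  | 4 => 24 * quadricCoord P 0 ^ 2
  | _ => 0

theorem adjoin_range_quadricBasis : Algebra.adjoin S (Set.range (quadricBasis P)) = ⊤ := by
  rw [← top_le_iff, ← adjoin_range_quadricCoord P]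
  refine Algebra.adjoin_le ?_
  have hb : ∀ k, quadricBasis P k ∈ Algebra.adjoin S (Set.range (quadricBasis P)) :=
    fun k => Algebra.subset_adjoin ⟨k, rfl⟩
  rintro _ ⟨i, rfl⟩
  fin_cases i
  · obtain ⟨c, hc⟩ := (isUnit_natCast_of_complex S two_ne_zero).exists_left_inv
    have h : quadricCoord P 0 = algebraMap S _ c * quadricBasis P 2 := by
      rw [quadricBasis, ← mul_assoc, ← Nat.cast_ofNat (R := QuadricRing P),
        ← map_natCast (algebraMap S (QuadricRing P)), ← map_mul, hc, map_one, one_mul]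
    change quadricCoord P 0 ∈ _
    rw [h]
    exact mul_mem (Subalgebra.algebraMap_mem _ c) (hb 2)
  · have := neg_mem (hb 1)
    rwa [quadricBasis, neg_neg] at this
  · exact hb 0

/-- The products of two coordinates span the sum of the irreducible representation of dimension `5`
and the line of `4 x z - y² = P`; the latter consists of constants. -/
theorem quadricCoord_mul_mem (i j : Fin 3) : quadricCoord P i * quadricCoord P j ∈
    Algebra.adjoin S (Set.range (halfQuadricBasis P)) := by
  set D := Algebra.adjoin S (Set.range (halfQuadricBasis P))
  have hb : ∀ k, halfQuadricBasis P k ∈ D := fun k => Algebra.subset_adjoin ⟨k, rfl⟩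
  have hdiv : ∀ (n : ℕ) (a : QuadricRing P), n ≠ 0 → n * a ∈ D → a ∈ D := by
    intro n a hn h
    obtain ⟨c, hc⟩ := (isUnit_natCast_of_complex S hn).exists_left_inv
    have h1 : a = algebraMap S _ c * (n * a) := by
      rw [← mul_assoc, ← map_natCast (algebraMap S (QuadricRing P)), ← map_mul, hc, map_one,
        one_mul]
    rw [h1]
    exact mul_mem (Subalgebra.algebraMap_mem _ c) h
  have hrel := quadricCoord_relation P
  have hP : algebraMap S (QuadricRing P) P ∈ D := D.algebraMap_mem P
  have h00 : quadricCoord P 0 * quadricCoord P 0 ∈ D := hdiv 24 _ (by norm_num) (by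
    have := hb 4
    rwa [halfQuadricBasis, pow_two] at this)
  have h01 : quadricCoord P 0 * quadricCoord P 1 ∈ D := hdiv 12 _ (by norm_num) (by
    convert neg_mem (hb 3) using 1
    rw [halfQuadricBasis]
    push_cast
    ring)
  have h11 : quadricCoord P 1 * quadricCoord P 1 ∈ D := hdiv 3 _ (by norm_num) (by
    convert sub_mem (hb 2) hP using 1
    rw [halfQuadricBasis, ← hrel]
    push_cast
    ring)
  have h02 : quadricCoord P 0 * quadricCoord P 2 ∈ D := hdiv 4 _ (by norm_num) (by
    convert add_mem h11 hP using 1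
    rw [← hrel]
    push_cast
    ring)
  have h12 : quadricCoord P 1 * quadricCoord P 2 ∈ D := hdiv 2 _ (by norm_num) (by
    convert neg_mem (hb 1) using 1
    rw [halfQuadricBasis]
    push_cast
    ring)
  have h22 : quadricCoord P 2 * quadricCoord P 2 ∈ D := by
    have := hb 0
    rwa [halfQuadricBasis, pow_two] at this
  fin_cases i <;> fin_cases j
  · exact h00
  · exact h01
  · exact h02
  · exact mul_comm (quadricCoord P 0) _ ▸ h01
  · exact h11
  · exact h12
  · exact mul_comm (quadricCoord P 0) _ ▸ h02
  · exact mul_comm (quadricCoord P 1) _ ▸ h12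
  · exact h22

/-- The even functions on the family of quadrics are generated by the products of two
coordinates. -/
theorem range_val_halfQuadricRing : (halfQuadricRing P).val.range =
    Algebra.adjoin S (Set.range (halfQuadricBasis P)) := by
  rw [Subalgebra.range_val]
  set D := Algebra.adjoin S (Set.range (halfQuadricBasis P))
  have hD : D ≤ halfQuadricRing P := by
    refine Algebra.adjoin_le ?_
    rintro _ ⟨k, rfl⟩
    change quadricNeg P (halfQuadricBasis P k) = halfQuadricBasis P k
    have hn : ∀ (n : ℕ) [n.AtLeastTwo], quadricNeg P (OfNat.ofNat n) = OfNat.ofNat n :=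
      fun n => map_natCast (quadricNeg P) n
    rcases k with _ | _ | _ | _ | _ | k <;>
      simp only [halfQuadricBasis, map_add, map_mul, map_pow, map_neg, map_zero, hn,
        quadricNeg_quadricCoord] <;> ring
  refine le_antisymm (fun y hy => ?_) hD
  -- Every function is the sum of an even one in `D` and an odd one.
  have key : ∀ y : QuadricRing P, ∃ e ∈ D, ∃ o, quadricNeg P o = -o ∧
      (∀ i, o * quadricCoord P i ∈ D) ∧ y = e + o := by
    intro y
    obtain ⟨p, rfl⟩ := Ideal.Quotient.mk_surjective y
    induction p using MvPolynomial.induction_on with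
    | C r => exact ⟨_, D.algebraMap_mem r, 0, by simp, fun i => by
        rw [zero_mul]; exact zero_mem _, (add_zero _).symm⟩
    | add p q hp hq =>
      obtain ⟨e, he, o, ho, hoD, hp⟩ := hp
      obtain ⟨e', he', o', ho', hoD', hq⟩ := hq
      refine ⟨e + e', add_mem he he', o + o', by rw [map_add, ho, ho']; ring, fun i => ?_, ?_⟩
      · rw [add_mul]
        exact add_mem (hoD i) (hoD' i)
      · rw [map_add, hp, hq]
        ring
    | mul_X p i hp =>
      obtain ⟨e, he, o, ho, hoD, hp⟩ := hp
      have hneg : quadricNeg P e = e := hD he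
      refine ⟨_, hoD i, e * quadricCoord P i, ?_, fun j => ?_, ?_⟩
      · rw [map_mul, hneg, quadricNeg_quadricCoord]
        ring
      · rw [mul_assoc]
        exact mul_mem he (quadricCoord_mul_mem P i j)
      · rw [map_mul, hp, add_comm e, add_mul]
        rfl
  obtain ⟨e, he, o, ho, -, rfl⟩ := key y
  have h1 : quadricNeg P (e + o) = e + o := hy
  have h2 : quadricNeg P e = e := hD he
  rw [map_add, h2, ho] at h1
  have h3 : ((2 : ℕ) : QuadricRing P) * o = 0 := by
    push_cast
    linear_combination -h1
  rw [(isUnit_natCast_of_complex _ two_ne_zero).mul_right_eq_zero.1 h3, add_zero]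
  exact he

variable [IsDomain (QuadricRing P)]

theorem deriv_quadricAction_lower_quadricBasis (k : ℕ) :
    (isPolynomialFlow_quadricAction_lower P).deriv (quadricBasis P k) = quadricBasis P (k + 1) := by
  have h := deriv_quadricAction_lower P
  have h2 := (isPolynomialFlow_quadricAction_lower P).deriv.map_natCast 2
  rw [Nat.cast_ofNat] at h2
  rcases k with _ | _ | _ | k <;> simp [quadricBasis, h, h2, Derivation.leibniz]

theorem deriv_quadricAction_upper_quadricBasis_zero :
    (isPolynomialFlow_quadricAction_upper P).deriv (quadricBasis P 0) = 0 :=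
  deriv_quadricAction_upper P 2

theorem deriv_quadricAction_upper_quadricBasis_succ (k : ℕ) :
    (isPolynomialFlow_quadricAction_upper P).deriv (quadricBasis P (k + 1)) =
      ((k + 1) * ((2 : ℕ) - k) : QuadricRing P) * quadricBasis P k := by
  have h := deriv_quadricAction_upper P
  have h2 := (isPolynomialFlow_quadricAction_upper P).deriv.map_natCast 2
  rw [Nat.cast_ofNat] at h2
  rcases k with _ | _ | _ | k
  · simp [quadricBasis, h]
  · simp only [quadricBasis, Derivation.leibniz, h, h2, smul_eq_mul, Matrix.cons_val_zero]
    push_cast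
    ring
  · simp [quadricBasis]
  · simp [quadricBasis]

theorem deriv_quadricAction_lower_halfQuadricBasis (k : ℕ) :
    (isPolynomialFlow_quadricAction_lower P).deriv (halfQuadricBasis P k) =
      halfQuadricBasis P (k + 1) := by
  have h := deriv_quadricAction_lower P
  have hn : ∀ (n : ℕ) [n.AtLeastTwo], (isPolynomialFlow_quadricAction_lower P).deriv
      (OfNat.ofNat n) = 0 := fun n => (isPolynomialFlow_quadricAction_lower P).deriv.map_natCast n
  rcases k with _ | _ | _ | _ | _ | k <;>
    simp [halfQuadricBasis, h, hn, Derivation.leibniz, Derivation.leibniz_pow] <;> ring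

theorem deriv_quadricAction_upper_halfQuadricBasis_zero :
    (isPolynomialFlow_quadricAction_upper P).deriv (halfQuadricBasis P 0) = 0 := by
  have h := deriv_quadricAction_upper P
  simp [halfQuadricBasis, h, Derivation.leibniz_pow]

theorem deriv_quadricAction_upper_halfQuadricBasis_succ (k : ℕ) :
    (isPolynomialFlow_quadricAction_upper P).deriv (halfQuadricBasis P (k + 1)) =
      ((k + 1) * ((4 : ℕ) - k) : QuadricRing P) * halfQuadricBasis P k := by
  have h := deriv_quadricAction_upper P
  have hn : ∀ (n : ℕ) [n.AtLeastTwo], (isPolynomialFlow_quadricAction_upper P).deriv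
      (OfNat.ofNat n) = 0 := fun n => (isPolynomialFlow_quadricAction_upper P).deriv.map_natCast n
  rcases k with _ | _ | _ | _ | _ | k <;>
    simp [halfQuadricBasis, h, hn, Derivation.leibniz, Derivation.leibniz_pow] <;> ring

end Generators

section QuadricModel

variable {A : Type*} [CommRing A] [Algebra ℂ A] [MulSemiringAction SL(2, ℂ) A]
  [SMulCommClass SL(2, ℂ) ℂ A] [IsDomain A] (hact : IsAlgebraicAction A)
  (S : Type u) [CommRing S] [Algebra ℂ S] [IsDomain S] [Algebra (Invariants A) S]
  [IsScalarTower ℂ (Invariants A) S] {u : Invariants A} [IsLocalization.Away u S]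
  {L : Type*} [Field L] [Algebra A L] [FaithfulSMul A L] [Algebra S L]
  [IsScalarTower (Invariants A) S L]

omit [IsDomain A] [Algebra ℂ S] [IsDomain S] [IsScalarTower ℂ (Invariants A) S]
  [FaithfulSMul A L] in
theorem algebraMap_algebraMap_invariant (r : Invariants A) :
    algebraMap S L (algebraMap (Invariants A) S r) = algebraMap A L r :=
  (IsScalarTower.algebraMap_apply (Invariants A) S L r).symm

include L in
/-- If `f` has weight `2`, then `A` is a family of quadrics near the point in question: the equation
`2 f F²f - (F f)² = P` for the Hessian is `4 x z - y² = P` with `z = f`, `y = -F f` and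
`2 x = F²f`. -/
theorem isLocalModel_quadric {f : A} (hf : f ∈ weightSpace A (2 : ℕ)) (hfE : raise hact f = 0)
    (hf0 : f ≠ 0) (hu : u ≠ 0)
    (hloc : ∀ a : A, ∃ N : ℕ, (u : A) ^ N * a ∈ stringAlgebra hact f) {P : Invariants A}
    (hN : hessian hact 2 f = P) :
    IsLocalModel u (quadricAction (algebraMap (Invariants A) S P)) := by
  have hinj := FaithfulSMul.algebraMap_injective A L
  set P' := algebraMap (Invariants A) S P
  have : CharZero A := charZero_of_injective_algebraMap (algebraMap ℂ A).injective
  have : CharZero L := charZero_of_injective_algebraMap hinj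
  have hN' := congrArg (algebraMap A L) hN
  simp only [hessian, map_sub, map_mul, map_pow, map_natCast, map_one] at hN'
  push_cast at hN'
  let x : Fin 3 → L := ![algebraMap A L (lowerOp hact (lowerOp hact f)) / 2,
    -algebraMap A L (lowerOp hact f), algebraMap A L f]
  have hx : 4 * x 0 * x 2 - x 1 ^ 2 = algebraMap S L P' := by
    rw [algebraMap_algebraMap_invariant, ← hN']
    simp only [x, Matrix.cons_val]
    ring
  set ψ := quadricLift P' x hx
  have hψx : ∀ i, ψ (quadricCoord P' i) = x i := quadricLift_quadricCoord P' x hx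
  have hψ : Function.Injective ψ := by
    refine injective_of_algebraicIndependent P' ψ ?_
    rw [hψx, hψx]
    have hmem : ∀ i, (![x 1, x 2] : Fin 2 → L) i ∈
        Algebra.adjoin (Invariants A) (Set.range ![x 1, x 2]) :=
      fun i => Algebra.subset_adjoin ⟨i, rfl⟩
    refine algebraicIndependent_of_highest_mem_adjoin hact two_ne_zero hf hfE hf0 (hmem 1) ?_ hu S
    have := neg_mem (hmem 0)
    simpa [x] using this
  have : IsDomain (QuadricRing P') := hψ.isDomain ψ.toRingHom
  refine isLocalModel_of_generators hact hf hfE hloc ψ hψ (AlgHom.id S _) Function.injective_id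
    (quadricBasis P')
    (by rw [adjoin_range_quadricBasis, (AlgHom.range_eq_top _).2 Function.surjective_id]) ?_
    (quadricAction P') (quadricAction P') (fun _ _ => rfl)
    (isPolynomialFlow_quadricAction_upper P') (isPolynomialFlow_quadricAction_lower P')
    (deriv_quadricAction_upper_quadricBasis_zero P')
    (deriv_quadricAction_upper_quadricBasis_succ P')
    (deriv_quadricAction_lower_quadricBasis P')
  intro k
  rcases k with _ | _ | _ | k
  · exact hψx 2
  · rw [quadricBasis, map_neg, hψx]
    exact neg_neg _
  · rw [quadricBasis, map_mul, hψx, map_ofNat]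
    exact mul_div_cancel₀ _ two_ne_zero
  · rw [lowerOp_iterate_eq_zero hact hf hfE (by omega),
      show quadricBasis P' (k + 1 + 1 + 1) = 0 from rfl, map_zero, map_zero]

include L in
/-- If `f` has weight `4`, then `A` is the quotient by `ℤ/2` of a family of quadrics near the point
in question. The coordinate `z` of the family is a square root `g` of `f`, and the coordinates `y`
and `x` are the solutions `-F g` and `F² g / 2`. -/
theorem isLocalModel_halfQuadric [IsAlgClosed L] {f : A} (hf : f ∈ weightSpace A (4 : ℕ))
    (hfE : raise hact f = 0)
    (hf0 : f ≠ 0) (hu : u ≠ 0)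
    (hloc : ∀ a : A, ∃ N : ℕ, (u : A) ^ N * a ∈ stringAlgebra hact f) {P : Invariants A}
    (hN : hessian hact 4 f = 4 * P * f) :
    IsLocalModel u (halfQuadricAction (algebraMap (Invariants A) S P)) := by
  have hinj := FaithfulSMul.algebraMap_injective A L
  set P' := algebraMap (Invariants A) S P
  have : CharZero A := charZero_of_injective_algebraMap (algebraMap ℂ A).injective
  have : CharZero L := charZero_of_injective_algebraMap hinj
  have hn : ∀ (n : ℕ) [n.AtLeastTwo], lowerOp hact (OfNat.ofNat n) = 0 :=
    fun n => (lowerOp hact).map_natCast n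
  simp only [hessian] at hN
  push_cast at hN
  set f1 := lowerOp hact f with hf1
  set f2 := lowerOp hact f1 with hf2
  set f3 := lowerOp hact f2 with hf3
  set f4 := lowerOp hact f3 with hf4
  -- Applying `F` to the equation for the Hessian expresses all `Fᵏ f` in terms of `f`, `F f` and
  -- `P`.
  have h2 : 4 * f * f2 = 3 * f1 ^ 2 + 4 * P * f := by linear_combination hN
  have h3 : 4 * f * f3 = 2 * f1 * f2 + 4 * P * f1 := by
    have := congrArg (lowerOp hact) h2
    simp only [map_add, Derivation.leibniz, Derivation.leibniz_pow, hn, lowerOp_invariant,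
      smul_eq_mul, nsmul_eq_mul, ← hf1, ← hf2, ← hf3] at this
    push_cast at this
    linear_combination this
  have h4 : 4 * f * f4 = 2 * f2 ^ 2 - 2 * f1 * f3 + 4 * P * f2 := by
    have := congrArg (lowerOp hact) h3
    simp only [map_add, Derivation.leibniz, hn, lowerOp_invariant,
      smul_eq_mul, ← hf1, ← hf2, ← hf3, ← hf4] at this
    linear_combination this
  obtain ⟨g, hg⟩ := IsAlgClosed.exists_pow_nat_eq (algebraMap A L f) two_pos
  have hg0 : g ≠ 0 := by
    rintro rfl
    rw [zero_pow two_ne_zero, eq_comm, map_eq_zero_iff _ hinj] at hg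
    exact hf0 hg
  replace h2 := congrArg (algebraMap A L) h2
  replace h3 := congrArg (algebraMap A L) h3
  replace h4 := congrArg (algebraMap A L) h4
  simp only [map_add, map_sub, map_mul, map_pow, map_ofNat, ← hg] at h2 h3 h4
  set a := algebraMap A L f1 with ha
  set p := algebraMap A L P
  have h4g : 4 * g ^ 2 ≠ 0 := mul_ne_zero (by norm_num) (pow_ne_zero 2 hg0)
  have e2 : algebraMap A L f2 = (3 * a ^ 2 + 4 * p * g ^ 2) / (4 * g ^ 2) := by
    rw [eq_div_iff h4g]
    linear_combination h2
  have e3 : algebraMap A L f3 = (2 * a * algebraMap A L f2 + 4 * p * a) / (4 * g ^ 2) := by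
    rw [eq_div_iff h4g]
    linear_combination h3
  have e4 : algebraMap A L f4 = (2 * algebraMap A L f2 ^ 2 - 2 * a * algebraMap A L f3 +
      4 * p * algebraMap A L f2) / (4 * g ^ 2) := by
    rw [eq_div_iff h4g]
    linear_combination h4
  -- From `g ^ 2 = f` one gets `F g = F f / (2 g)`, and the equation `4 x z - y² = P` determines
  -- `x`.
  let x : Fin 3 → L := ![a ^ 2 / (16 * g ^ 3) + p / (4 * g), -a / (2 * g), g]
  have hx : 4 * x 0 * x 2 - x 1 ^ 2 = algebraMap S L P' := by
    rw [algebraMap_algebraMap_invariant]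
    change 4 * (a ^ 2 / (16 * g ^ 3) + p / (4 * g)) * g - (-a / (2 * g)) ^ 2 = p
    field_simp
    ring
  set ψ := quadricLift P' x hx
  have hψx : ∀ i, ψ (quadricCoord P' i) = x i := quadricLift_quadricCoord P' x hx
  have hψ : Function.Injective ψ := by
    refine injective_of_algebraicIndependent P' ψ ?_
    rw [hψx, hψx]
    have hmem : ∀ i, (![x 1, x 2] : Fin 2 → L) i ∈
        Algebra.adjoin (Invariants A) (Set.range ![x 1, x 2]) :=
      fun i => Algebra.subset_adjoin ⟨i, rfl⟩
    refine algebraicIndependent_of_highest_mem_adjoin hact four_ne_zero hf hfE hf0 ?_ ?_ hu S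
    · rw [← hg]
      exact pow_mem (hmem 1) 2
    · have h := neg_mem (add_mem (mul_mem (hmem 0) (hmem 1)) (mul_mem (hmem 0) (hmem 1)))
      convert h using 1
      change a = -(-a / (2 * g) * g + -a / (2 * g) * g)
      field_simp
      ring
  have : IsDomain (QuadricRing P') := hψ.isDomain ψ.toRingHom
  refine isLocalModel_of_generators hact hf hfE hloc ψ hψ (halfQuadricRing P').val
    Subtype.val_injective (halfQuadricBasis P') (range_val_halfQuadricRing P') ?_
    (halfQuadricAction P') (quadricAction P') (fun _ _ => rfl)
    (isPolynomialFlow_quadricAction_upper P') (isPolynomialFlow_quadricAction_lower P')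
    (deriv_quadricAction_upper_halfQuadricBasis_zero P')
    (deriv_quadricAction_upper_halfQuadricBasis_succ P')
    (deriv_quadricAction_lower_halfQuadricBasis P')
  have hψn : ∀ (n : ℕ) [n.AtLeastTwo], ψ (OfNat.ofNat n) = OfNat.ofNat n :=
    fun n => map_natCast ψ n
  intro k
  rcases k with _ | _ | _ | _ | _ | k
  · rw [halfQuadricBasis, map_pow, hψx]
    exact hg
  · simp only [halfQuadricBasis, map_mul, map_neg, hψn, hψx]
    change -2 * (-a / (2 * g)) * g = a
    field_simp
  · simp only [halfQuadricBasis, map_add, map_mul, map_pow, hψn, hψx]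
    change 4 * (a ^ 2 / (16 * g ^ 3) + p / (4 * g)) * g + 2 * (-a / (2 * g)) ^ 2 =
      algebraMap A L f2
    rw [e2]
    field_simp
    ring
  · simp only [halfQuadricBasis, map_mul, map_neg, hψn, hψx]
    change -12 * (a ^ 2 / (16 * g ^ 3) + p / (4 * g)) * (-a / (2 * g)) = algebraMap A L f3
    rw [e3, e2]
    field_simp
    ring
  · simp only [halfQuadricBasis, map_mul, map_pow, hψn, hψx]
    change 24 * (a ^ 2 / (16 * g ^ 3) + p / (4 * g)) ^ 2 = algebraMap A L f4
    rw [e4, e3, e2]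
    field_simp
    ring
  · rw [lowerOp_iterate_eq_zero hact hf hfE (by omega),
      show halfQuadricBasis P' (k + 1 + 1 + 1 + 1 + 1) = 0 from rfl, map_zero, map_zero]

end QuadricModel

/-! ### From algebras to schemes -/

theorem isLocalization_away_of_injective {A M : Type*} [CommRing A] [CommRing M] [Algebra A M]
    {u : A} (hu : IsUnit (algebraMap A M u)) (hinj : Function.Injective (algebraMap A M))
    (hsurj : ∀ x : M, ∃ (N : ℕ) (a : A), algebraMap A M u ^ N * x = algebraMap A M a) :
    IsLocalization.Away u M := by
  refine (isLocalization_iff _ _).2 ⟨?_, fun x => ?_, fun h => ⟨1, by rw [hinj h]⟩⟩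
  · rintro ⟨_, N, rfl⟩
    change IsUnit (algebraMap A M (u ^ N))
    rw [map_pow]
    exact hu.pow N
  · obtain ⟨N, a, h⟩ := hsurj x
    exact ⟨(a, ⟨u ^ N, N, rfl⟩), by rw [← h, mul_comm, map_pow]⟩

section Geometry

variable {A : Type u} [CommRing A] [Algebra ℂ A] [MulSemiringAction SL(2, ℂ) A]
  [SMulCommClass SL(2, ℂ) ℂ A]

/-- The ring of functions on an open subset of `Y` is an algebra over the ring of invariants. -/
noncomputable instance invariantsAlgebra (Δ : (quotient A).Opens) :
    Algebra (Invariants A) Γ(quotient A, Δ) :=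
  (((Scheme.ΓSpecIso (CommRingCat.of (Invariants A))).inv ≫
    (quotient A).presheaf.map (homOfLE le_top).op).hom).toAlgebra

instance isScalarTower_invariants (Δ : (quotient A).Opens) :
    IsScalarTower ℂ (Invariants A) Γ(quotient A, Δ) :=
  IsScalarTower.of_algebraMap_eq fun _ => rfl

variable (A) in
/-- The principal open subset `{δ ∈ Y | u(δ) ≠ 0}`. -/
abbrev awayOpen (u : Invariants A) : (quotient A).Opens :=
  PrimeSpectrum.basicOpen (R := Invariants A) u

/-- The functions on a principal open subset of `Y`. The structure of an algebra over the invariants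
on either side is that of Mathlib for a structure sheaf, up to unfolding. -/
theorem isLocalization_awayOpen (u : Invariants A) :
    IsLocalization.Away u Γ(quotient A, awayOpen A u) := by
  convert StructureSheaf.IsLocalization.to_basicOpen (Invariants A) u using 1
  · rfl
  · rfl
  · exact HEq.rfl
  · exact heq_of_eq (Algebra.algebra_ext _ _ fun _ => rfl)

theorem isAffineOpen_awayOpen (u : Invariants A) : IsAffineOpen (awayOpen A u) := by
  have := (isAffineOpen_top (quotient A)).basicOpen
    ((Scheme.ΓSpecIso (CommRingCat.of (Invariants A))).inv u)
  rwa [basicOpen_eq_of_affine] at this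

theorem fromSpec_eq (Δ : (quotient A).Opens) (h : IsAffineOpen Δ) :
    h.fromSpec = Spec.map (CommRingCat.ofHom (algebraMap (Invariants A) Γ(quotient A, Δ))) := by
  rw [← Category.comp_id h.fromSpec,
    ← toSpecΓ_SpecMap_ΓSpecIso_inv (CommRingCat.of (Invariants A)), ← Category.assoc]
  erw [h.fromSpec_toSpecΓ]
  rw [← Spec.map_comp]
  rfl

/-- An algebra that is the localization of `A` away from `u`, as an algebra with action, is the
algebra of functions on the preimage of the principal open set of `u`. -/
theorem preimageIsoModel_of_isLocalModel {u : Invariants A} {M : Type u} [CommRing M]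
    [Algebra Γ(quotient A, awayOpen A u) M]
    {ρ : SL(2, ℂ) →* (M →ₐ[Γ(quotient A, awayOpen A u)] M)} (h : IsLocalModel u ρ) :
    PreimageIsoModel (awayOpen A u) M ρ := by
  obtain ⟨j, hjr, hjρ, hjinj, hj⟩ := h
  have := isLocalization_awayOpen u
  obtain ⟨himm, hrange⟩ : IsOpenImmersion (Spec.map (CommRingCat.ofHom j)) ∧
      Set.range (Spec.map (CommRingCat.ofHom j)) =
        (PrimeSpectrum.basicOpen (u : A) : Set (PrimeSpectrum A)) := by
    algebraize [j]
    have hloc : IsLocalization.Away (u : A) M := by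
      refine isLocalization_away_of_injective ?_ hjinj fun x => ?_
      · change IsUnit (j u)
        rw [hjr u]
        exact (IsLocalization.Away.algebraMap_isUnit u).map _
      · change ∃ (N : ℕ) (a : A), j u ^ N * x = j a
        rw [hjr u]
        exact hj x
    exact ⟨IsOpenImmersion.of_isLocalization (R := A) (S := M) (u : A),
      PrimeSpectrum.localization_away_comap_range M (u : A)⟩
  have hrange : Set.range (quotientMap A ⁻¹ᵁ awayOpen A u).ι =
      Set.range (Spec.map (CommRingCat.ofHom j)) := by
    rw [Scheme.Opens.range_ι, hrange]
    rfl
  let e := IsOpenImmersion.isoOfRangeEq (quotientMap A ⁻¹ᵁ awayOpen A u).ι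
    (Spec.map (CommRingCat.ofHom j)) hrange
  have he : e.hom ≫ Spec.map (CommRingCat.ofHom j) = (quotientMap A ⁻¹ᵁ awayOpen A u).ι :=
    IsOpenImmersion.isoOfRangeEq_hom_fac _ _ _
  have he' : e.inv ≫ (quotientMap A ⁻¹ᵁ awayOpen A u).ι = Spec.map (CommRingCat.ofHom j) :=
    IsOpenImmersion.isoOfRangeEq_inv_fac _ _ _
  refine ⟨e, ?_, fun g => ?_⟩
  · have hΔ := isAffineOpen_awayOpen u
    rw [← cancel_mono hΔ.fromSpec, Category.assoc, Category.assoc, hΔ.toSpecΓ_fromSpec,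
      morphismRestrict_ι, fromSpec_eq, ← Spec.map_comp, ← he, Category.assoc]
    change _ = e.hom ≫ Spec.map (CommRingCat.ofHom j) ≫
      Spec.map (CommRingCat.ofHom (algebraMap (Invariants A) A))
    rw [← Spec.map_comp]
    congr 2
    ext r
    exact (hjr r).symm
  · rw [← Category.assoc e.inv, he']
    change _ = Spec.map (CommRingCat.ofHom j) ≫
      Spec.map (CommRingCat.ofHom (MulSemiringAction.toRingHom SL(2, ℂ) A g⁻¹))
    rw [← Spec.map_comp, ← Spec.map_comp]
    congr 1
    ext a
    exact hjρ g⁻¹ a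

/-- If the fibre of the quotient map over a closed point is reduced, then the extension of the
maximal ideal of the point is a radical ideal. -/
theorem mem_map_of_pow_mem_map (y : quotient A) [hy : y.asIdeal.IsMaximal]
    (hred : AlgebraicGeometry.IsReduced ((quotientMap A).fiber y)) (a : A) (k : ℕ)
    (h : a ^ k ∈ y.asIdeal.map (algebraMap (Invariants A) A)) :
    a ∈ y.asIdeal.map (algebraMap (Invariants A) A) := by
  let e : (quotientMap A).fiber y ≅ Spec (CommRingCat.of (y.asIdeal.Fiber A)) :=
    Arrow.leftFunc.mapIso (Spec.fiberToSpecResidueFieldIso (Invariants A) A y)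
  -- The fibre is the spectrum of `κ(y) ⊗ A`, which is `A` modulo the extended ideal.
  have h1 : AlgebraicGeometry.IsReduced
      (Spec (CommRingCat.of (y.asIdeal.Fiber A))) :=
    isReduced_of_isOpenImmersion e.inv
  have h2 : _root_.IsReduced (y.asIdeal.Fiber A) := (affine_isReduced_iff _).1 h1
  set I := y.asIdeal.map (algebraMap (Invariants A) A)
  let i : A →ₐ[Invariants A] y.asIdeal.Fiber A := Algebra.TensorProduct.includeRight
  have hi : I ≤ RingHom.ker i := by
    refine Ideal.map_le_iff_le_comap.2 fun r hr => ?_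
    rw [Ideal.mem_comap, RingHom.mem_ker, AlgHom.commutes,
      IsScalarTower.algebraMap_apply (Invariants A) y.asIdeal.ResidueField,
      Ideal.algebraMap_residueField_eq_zero.2 hr, map_zero]
  have h3 : i a = 0 := by
    refine (IsNilpotent.eq_zero (x := i a) ⟨k, ?_⟩)
    rw [← map_pow]
    exact hi h
  let φ : y.asIdeal.ResidueField →ₐ[Invariants A] A ⧸ I :=
    Ideal.ResidueField.liftₐ y.asIdeal (Algebra.ofId (Invariants A) (A ⧸ I)) (fun r hr => by
      rw [RingHom.mem_ker, Algebra.ofId_apply, IsScalarTower.algebraMap_apply _ A]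
      exact Ideal.Quotient.eq_zero_iff_mem.2 (Ideal.mem_map_of_mem _ hr)) (fun r hr => by
      obtain ⟨s, b, hb, hs⟩ := hy.exists_inv hr
      change IsUnit (algebraMap (Invariants A) (A ⧸ I) r)
      refine IsUnit.of_mul_eq_one (algebraMap _ _ s) ?_
      have hb0 : algebraMap (Invariants A) (A ⧸ I) b = 0 := by
        rw [IsScalarTower.algebraMap_apply _ A]
        exact Ideal.Quotient.eq_zero_iff_mem.2 (Ideal.mem_map_of_mem _ hb)
      rw [← map_mul, mul_comm, ← add_zero (algebraMap _ _ (s * r)), ← hb0, ← map_add, hs, map_one])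
  have h4 := congrArg (Algebra.TensorProduct.lift φ
    (Ideal.Quotient.mkₐ (Invariants A) I) (fun _ _ => Commute.all _ _)) h3
  rw [map_zero] at h4
  have h5 : Ideal.Quotient.mk I a = 0 := by
    rw [← h4]
    simp [i]
  exact Ideal.Quotient.eq_zero_iff_mem.1 h5

end Geometry

section Conclusion

variable {A : Type u} [CommRing A] [IsDomain A] [Algebra ℂ A] [MulSemiringAction SL(2, ℂ) A]
  [SMulCommClass SL(2, ℂ) ℂ A]

/-- The three local models, distinguished by the degree and the Hessian of the generating highest
weight vector. The predicate `Z` stands for the condition on the zeros of `P`, which is not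
affected by the factor `1 / 4` between the Hessian and the equation of the quadric in degree `4`. -/
theorem isLocalModel_of_hessian (hact : IsAlgebraicAction A) {d : ℕ} (hd : 0 < d) {f : A}
    (hf : f ∈ weightSpace A (d : ℤ)) (hfE : raise hact f = 0) (hf0 : f ≠ 0)
    {u : Invariants A} (hu : u ≠ 0) (hloc : ∀ a, ∃ N, (u : A) ^ N * a ∈ stringAlgebra hact f)
    {Z : Invariants A → Prop} (hZ : ∀ (c : ℂ) P, Z P → c ≠ 0 → Z (c • P))
    (hess : hessian hact d f = 0 ∨ ∃ P : Invariants A, Z P ∧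
      (d = 2 ∧ hessian hact d f = P ∨ d = 4 ∧ hessian hact d f = P * f))
    (S : Type u) [CommRing S] [Algebra ℂ S] [Algebra (Invariants A) S]
    [IsScalarTower ℂ (Invariants A) S] [IsLocalization.Away u S] :
    (∃ n, 1 ≤ n ∧ IsLocalModel u (productAction S n)) ∨
      ∃ P : Invariants A, Z P ∧
        (IsLocalModel u (quadricAction (algebraMap (Invariants A) S P)) ∨
          IsLocalModel u (halfQuadricAction (algebraMap (Invariants A) S P))) := by
  have hS : IsDomain S := IsLocalization.isDomain_of_le_nonZeroDivisors S
    (powers_le_nonZeroDivisors_of_noZeroDivisors hu)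
  let L := AlgebraicClosure (FractionRing A)
  have hAL : Function.Injective (algebraMap A L) := by
    rw [IsScalarTower.algebraMap_eq A (FractionRing A) L]
    exact (algebraMap (FractionRing A) L).injective.comp (IsFractionRing.injective A _)
  have : FaithfulSMul A L := (faithfulSMul_iff_algebraMap_injective A L).2 hAL
  have huL : IsUnit (algebraMap (Invariants A) L u) := by
    rw [isUnit_iff_ne_zero, IsScalarTower.algebraMap_apply (Invariants A) A L, Ne,
      map_eq_zero_iff _ hAL]
    exact fun h => hu (Subtype.ext h)
  let : Algebra S L := (IsLocalization.Away.lift u huL).toAlgebra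
  have : IsScalarTower (Invariants A) S L :=
    IsScalarTower.of_algebraMap_eq fun r => (IsLocalization.Away.lift_eq u huL r).symm
  rcases hess with hess | ⟨P, hP, ⟨rfl, hess⟩ | ⟨rfl, hess⟩⟩
  · exact .inl ⟨d, hd, isLocalModel_cone S hact hd.ne' hf hfE hf0 hu hloc hess (L := L)⟩
  · exact .inr ⟨P, hP, .inl (isLocalModel_quadric hact S (L := L) hf hfE hf0 hu hloc hess)⟩
  · refine .inr ⟨(1 / 4 : ℂ) • P, hZ _ P hP (by norm_num), .inr
      (isLocalModel_halfQuadric hact S (L := L) hf hfE hf0 hu hloc ?_)⟩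
    have h4 : (4 : A) = (4 : ℂ) • (1 : A) := by
      rw [← Algebra.algebraMap_eq_smul_one, map_ofNat]
    rw [hess, Subalgebra.coe_smul, h4, smul_mul_smul_comm]
    norm_num

end Conclusion

end SL2Variety

theorem proposition3p1 {A : Type*} [CommRing A] [IsDomain A] [IsIntegrallyClosed A]
    [Algebra ℂ A] [Algebra.FiniteType ℂ A]
    [MulSemiringAction SL(2, ℂ) A] [SMulCommClass SL(2, ℂ) ℂ A]
    (hact : SL2Variety.IsAlgebraicAction A)
    (hdim : topologicalKrullDim (SL2Variety.space A) = 3)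
    (hcurve : topologicalKrullDim (SL2Variety.quotient A) = 1)
    (y : SL2Variety.quotient A) (hy : IsClosed {y})
    (hred : AlgebraicGeometry.IsReduced ((SL2Variety.quotientMap A).fiber y)) :
    ∃ Δ : (SL2Variety.quotient A).Opens, y ∈ Δ ∧ IsAffineOpen Δ ∧
      ((∃ n : ℕ, 1 ≤ n ∧
          SL2Variety.PreimageIsoModel Δ (Γ(SL2Variety.quotient A, Δ) ⊗[ℂ] SL2Variety.coneRing n)
            (SL2Variety.productAction Γ(SL2Variety.quotient A, Δ) n)) ∨
        (∃ P : Γ(SL2Variety.quotient A, Δ),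
          (∀ η ∈ Δ, η ∉ (SL2Variety.quotient A).basicOpen P → η = y) ∧
          (SL2Variety.PreimageIsoModel Δ (SL2Variety.QuadricRing P)
              (SL2Variety.quadricAction P) ∨
            SL2Variety.PreimageIsoModel Δ (SL2Variety.halfQuadricRing P)
              (SL2Variety.halfQuadricAction P)))) := by
  have hmax : y.asIdeal.IsMaximal := (PrimeSpectrum.isClosed_singleton_iff_isMaximal y).1 hy
  obtain ⟨d, hd, f, hf, hfE, hf0, u, hu, hloc, hess⟩ :=
    SL2Variety.exists_local_generators hact
      ((PrimeSpectrum.topologicalKrullDim_eq_ringKrullDim A).symm.trans hdim)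
      ((PrimeSpectrum.topologicalKrullDim_eq_ringKrullDim _).symm.trans hcurve)
      (SL2Variety.mem_map_of_pow_mem_map y hred)
  have hu0 : u ≠ 0 := fun h => hu (h ▸ y.asIdeal.zero_mem)
  have := SL2Variety.isLocalization_awayOpen u
  refine ⟨SL2Variety.awayOpen A u, hu, SL2Variety.isAffineOpen_awayOpen u, ?_⟩
  refine (SL2Variety.isLocalModel_of_hessian hact hd hf hfE hf0 hu0 hloc ?_ hess
    Γ(SL2Variety.quotient A, SL2Variety.awayOpen A u)).imp ?_ ?_
  · intro c P hP hc p hp hup hcP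
    refine hP p hp hup ?_
    have := (p.restrictScalars ℂ).smul_mem c⁻¹ hcP
    rwa [inv_smul_smul₀ hc] at this
  · rintro ⟨n, hn, h⟩
    exact ⟨n, hn, SL2Variety.preimageIsoModel_of_isLocalModel h⟩
  · rintro ⟨P, hP, h⟩
    refine ⟨algebraMap (SL2Variety.Invariants A) _ P, fun η hη hηP => ?_,
      h.imp SL2Variety.preimageIsoModel_of_isLocalModel
        SL2Variety.preimageIsoModel_of_isLocalModel⟩
    refine PrimeSpectrum.ext (hP η.asIdeal η.isPrime hη (not_not.1 fun hPη => hηP ?_))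
    have h1 : (SL2Variety.quotient A).basicOpen (algebraMap (SL2Variety.Invariants A)
        Γ(SL2Variety.quotient A, SL2Variety.awayOpen A u) P) =
        SL2Variety.awayOpen A u ⊓ SL2Variety.awayOpen A P :=
      (Scheme.basicOpen_res _ _ _).trans (congrArg _ (basicOpen_eq_of_affine _))
    rw [h1]
    exact ⟨hη, hPη⟩
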